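/- **Setting.** Let $p,q,h,v$ be positive integers with $\gcd(q,p)=1$, $\gcd(q-1,p)=1$, $\gcd(h,p)=1$, $h+v<p$ and $h+vq\equiv 0 \pmod p$. Let $L(p,q)$ be the quotient of $S^3=\{(r_1,\theta_1,r_2,\theta_2): r_1^2+r_2^2=1\}\subset\mathbb C^2$ by the cyclic group generated by $(\theta_1,\theta_2)\mapsto(\theta_1+\frac{2\pi q}{p},\theta_2+\frac{2\pi}{p})$, with the contact form induced by $r_1^2d\theta_1+r_2^2d\theta_2$, whose Reeb flow is $(\theta_1,\theta_2)\mapsto(\theta_1+t,\theta_2+t)$. The Lagrangian projection $L(p,q)\to S^2$ sends a point to the point with azimuth $\phi=p(\theta_1-\theta_2)$ and height $r_2^2-r_1^2$; the north pole is $r_1=0$, the south pole is $r_1=1$, and $S^2$ is oriented so that (east, north) is positive. Its area form is the multiple of $d(r_1^2)\wedge d\phi$ with total area $1/p$. **The knot.** In the coordinates $X=\frac{p\theta_1}{2\pi}$, $Y=\frac{p\theta_2}{2\pi}$ the boxes of the grid are unit squares. Let $K_0\subset L(p,q)$ be the Legendrian knot with a *special front* for the grid number one diagram of $K(p,q,h)$: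 go from the centre of Box $0=[0,1]^2$ through $h$ boxes to the right and then $v$ boxes down, which closes up on the Heegaard torus; slide the $h+v$ basepoints (the centres of the boxes passed) inside their boxes in the direction $(1,1)$ so that the slopes of the $h+v$ segments joining consecutive basepoints are negative and strictly decrease; and round the corner at each basepoint, inside its box, by a curve whose slope interpolates smoothly and strictly monotonically between those of the adjacent segments. On $K_0$ the coordinate $r_1$ is given by $\frac{d\theta_2}{d\theta_1}=-\frac{r_1^2}{1-r_1^2}$. Assume that the double points of the Lagrangian projection $\Gamma\subset S^2$ of $K_0$ are transverse, and number these crossings $1,2,\dots$ from the top down. **Generators.** Each crossing is the image of two complementary Reeb chords of $K_0$; the length $l(x)\in(0,1)$ of a chord $x$ is measured as a fraction of the orbital period $2\pi$. A quadrant at the crossing is labelled $x^+$ if going along the source strand of $x$ to the crossing and then along the sink strand orients the quadrant positively, and $x^-$ otherwise. Let $a_i$ be the chord at the $i$-th crossing with $a_i^+$ on the north and south quadrants, $b_i$ the complementary chord; the $a_i$ are called preferred. Let $\mathcal A(K_0)$ be the tensor algebra over $\mathbb Z_2$ on all $a_i,b_i$. **Discs.** The defect of a component $R$ of $S^2-\Gamma$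 is $n(R)=-\mathrm{area}(R)+\sum\pm l(a_i)$, summed over the corners of $R$, with sign $+$ ($-$) if $R$ fills there a quadrant labelled $a_i^+$ ($a_i^-$). An admissible disc is a continuous map $f:(D^2,\partial D^2)\to(S^2,\Gamma)$ with marked points on $\partial D^2$, each of which goes to a crossing, where $f$ fills exactly one quadrant; away from the marked points $f$ is smooth up to the boundary and an orientation-preserving immersion, except possibly at interior points that go to a pole and near which $f$ is $z\mapsto z^p$ up to diffeomorphisms. Its defect $n(f)$ is the sum of the defects of the regions in its image, counted with multiplicity. If $f$ fills a quadrant $x^+$ at a marked point and, counterclockwise from there, quadrants $y_1^-,\dots,y_m^-$ at the other marked points, let $w(f,x)=y_1\cdots y_m$, and let $n_x(f)$ be $n(f)$ minus the number of non-preferred $y_i$, plus one if $x$ is not preferred. Then $\partial x=\sum w(f,x)$ over the admissible discs $f$, up to reparameterization, with $n_x(f)=0$; such an $f$ is said to contribute $w(f,x)$ to $\partial x$. A capping path for $x$ is a path that runs smoothly along $\Gamma$ (possibly several times around it) from the crossing of $x$ back to that crossing and turns there a corner around a quadrant labelled $x^+$; it bounds the disc $f$ if it is, up to reparameterization, the restriction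 of $f$ to the counterclockwise boundary circle. **Proposition.** Let $j=p \bmod (h+v)$. The generators $a_j$ and $a_{h+v-j}$ exist. Some capping path for $a_j$ bounds an admissible disc that is disjoint from the south pole and contributes the constant term $1$ to $\partial a_j$, and some capping path for $a_{h+v-j}$ bounds an admissible disc that is disjoint from the north pole and contributes the constant term $1$ to $\partial a_{h+v-j}$. -/

import Mathlib

open scoped ContDiff

noncomputable section

namespace LensKnot

/-! ## The contact lens space and its Lagrangian projection -/

/-- The unit sphere in `ℂ²`, with `z₁ = r₁ e^{iθ₁}` and `z₂ = r₂ e^{iθ₂}`. -/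
def S3 : Type := {z : ℂ × ℂ // ‖z.1‖ ^ 2 + ‖z.2‖ ^ 2 = 1}

/-- The map `(r₁, θ₁, r₂, θ₂) ↦ (r₁, θ₁ + α, r₂, θ₂ + β)`, as a bijection of the three-sphere. -/
def rot (α β : ℝ) : Equiv.Perm S3 where
  toFun z := ⟨((Circle.exp α : ℂ) * z.1.1, (Circle.exp β : ℂ) * z.1.2), by
    simpa [norm_mul] using z.2⟩
  invFun z := ⟨((Circle.exp (-α) : ℂ) * z.1.1, (Circle.exp (-β) : ℂ) * z.1.2), by
    simpa [norm_mul] using z.2⟩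
  left_inv z := by
    apply Subtype.ext
    simp [Circle.exp_neg]
  right_inv z := by
    apply Subtype.ext
    simp [Circle.exp_neg]

theorem rot_fst (α β : ℝ) (z : S3) : (rot α β z).1.1 = (Circle.exp α : ℂ) * z.1.1 := rfl

theorem rot_snd (α β : ℝ) (z : S3) : (rot α β z).1.2 = (Circle.exp β : ℂ) * z.1.2 := rfl

theorem rot_comm (α β γ δ : ℝ) (z : S3) : rot α β (rot γ δ z) = rot γ δ (rot α β z) := by
  apply Subtype.ext
  apply Prod.ext
  · rw [rot_fst, rot_fst, rot_fst, rot_fst]; ring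
  · rw [rot_snd, rot_snd, rot_snd, rot_snd]; ring

/-- The deck transformation `F_{p,q}`. -/
def deck (p q : ℕ) : Equiv.Perm S3 := rot (2 * Real.pi * q / p) (2 * Real.pi / p)

/-- The lens space `L(p,q)`: the quotient of the three-sphere by the cyclic group generated by
`F_{p,q}`. -/
def LensSpace (p q : ℕ) : Type :=
  MulAction.orbitRel.Quotient (Subgroup.zpowers (deck p q)) S3

def toLens (p q : ℕ) (z : S3) : LensSpace p q :=
  Quotient.mk (MulAction.orbitRel (Subgroup.zpowers (deck p q)) S3) z

theorem deck_zpow_rot (p q : ℕ) (t : ℝ) (k : ℤ) (z : S3) :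
    rot t t ((deck p q ^ k) z) = (deck p q ^ k) (rot t t z) := by
  have h : Commute (rot t t) (deck p q) := by
    ext1 w
    exact rot_comm _ _ _ _ _
  exact congrArg (fun e : Equiv.Perm S3 => e z) (h.zpow_right k)

/-- The time `t` Reeb flow on `L(p,q)`. On the three-sphere the contact form is
`r₁² dθ₁ + r₂² dθ₂`, whose Reeb flow is `(θ₁, θ₂) ↦ (θ₁ + t, θ₂ + t)`. If `gcd (q - 1, p) = 1`,
every Reeb orbit in `L(p,q)` other than the two core curves has period `2π`. -/
def reeb (p q : ℕ) (t : ℝ) : LensSpace p q → LensSpace p q :=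
  Quotient.map (rot t t) (by
    rintro a b ⟨⟨g, k, rfl⟩, rfl⟩
    exact ⟨⟨deck p q ^ k, k, rfl⟩, (deck_zpow_rot p q t k b).symm⟩)

/-- The space containing the base `S²` of the Lagrangian projection; the second coordinate is the
height, so the north pole is `(0, 1)`. -/
abbrev Space : Type := ℂ × ℝ

/-- The two-sphere. -/
def sphere2 : Set Space := {P | ‖P.1‖ ^ 2 + P.2 ^ 2 = 1}

def northPole : Space := (0, 1)

def southPole : Space := (0, -1)

/-- The point of `S²` with azimuth `φ = 2πs` and `r₁² = w`. The north pole is `r₁ = 0`, the south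
pole is `r₁ = 1`. -/
def spherePoint (s w : ℝ) : Space :=
  (((2 * Real.sqrt (w * (1 - w)) : ℝ) : ℂ) * (Circle.exp (2 * Real.pi * s) : ℂ), 1 - 2 * w)

/-- The Lagrangian projection on the three-sphere, for `gcd (q - 1, p) = 1`:
the point `(r₁, θ₁, r₂, θ₂)` goes to the point of `S²` with azimuth `φ = p (θ₁ - θ₂)` and height
`r₂² - r₁²` (hence at distance `2 r₁ r₂` from the axis). -/
def lagS3 (p : ℕ) (z : S3) : Space :=
  (2 * (z.1.1 * (starRingEnd ℂ) z.1.2) ^ p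
      / ((‖z.1.1 * (starRingEnd ℂ) z.1.2‖ ^ (p - 1) : ℝ) : ℂ),
    ‖z.1.2‖ ^ 2 - ‖z.1.1‖ ^ 2)

theorem lagS3_deck (p q : ℕ) (z : S3) : lagS3 p (deck p q z) = lagS3 p z := by
  have key : ((Circle.exp (2 * Real.pi * q / p) : ℂ)
      * (starRingEnd ℂ) (Circle.exp (2 * Real.pi / p) : ℂ)) ^ p = 1 := by
    rcases Nat.eq_zero_or_pos p with rfl | hp
    · simp
    have hp' : (p : ℂ) ≠ 0 := by exact_mod_cast hp.ne'
    rw [← Circle.coe_inv_eq_conj, ← Circle.exp_neg, Circle.coe_exp, Circle.coe_exp,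
      ← Complex.exp_add, ← Complex.exp_nat_mul]
    rw [Complex.exp_eq_one_iff]
    refine ⟨(q : ℤ) - 1, ?_⟩
    push_cast
    field_simp
    ring
  apply Prod.ext
  · have e : (deck p q z).1.1 * (starRingEnd ℂ) (deck p q z).1.2
        = ((Circle.exp (2 * Real.pi * q / p) : ℂ)
            * (starRingEnd ℂ) (Circle.exp (2 * Real.pi / p) : ℂ))
          * (z.1.1 * (starRingEnd ℂ) z.1.2) := by
      rw [deck, rot_fst, rot_snd, map_mul]
      ring
    simp only [lagS3]
    rw [e, mul_pow, key, one_mul]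
    rw [norm_mul (_ * _) (_ * _), norm_mul (Circle.exp _ : ℂ), Complex.norm_conj, Circle.norm_coe,
      Circle.norm_coe, one_mul, one_mul]
  · simp only [lagS3]
    rw [deck, rot_fst, rot_snd, norm_mul, norm_mul, Circle.norm_coe, Circle.norm_coe, one_mul,
      one_mul]

/-- The Lagrangian projection `L(p,q) → S²`, for `gcd (q - 1, p) = 1`. -/
def lag (p q : ℕ) : LensSpace p q → Space :=
  Quotient.lift (lagS3 p) (by
    have h1 : ∀ (k : ℕ) (z : S3), lagS3 p ((deck p q ^ k) z) = lagS3 p z := by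
      intro k
      induction k with
      | zero => intro z; rfl
      | succ k ih => intro z; rw [pow_succ, Equiv.Perm.mul_apply, ih, lagS3_deck]
    rintro a b ⟨⟨g, k, rfl⟩, rfl⟩
    change lagS3 p ((deck p q ^ k) b) = lagS3 p b
    obtain ⟨m, rfl | rfl⟩ := k.eq_nat_or_neg
    · rw [zpow_natCast]; exact h1 m b
    · have := h1 m ((deck p q ^ (-(m : ℤ))) b)
      rw [← this, ← Equiv.Perm.mul_apply, ← zpow_natCast, ← zpow_add]
      simp)

/-! ## Special front projections

The universal cover of the Heegaard torus has coordinates `X = p θ₁ / 2π` and `Y = p θ₂ / 2π`, in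
which the boxes of the grid are unit squares; Box `0` is `[0,1] × [0,1]`. -/

/-- The centre of the `i`-th box met by the rectilinear diagram which goes `h` boxes to the right
from Box `0` and then `v` boxes down (here `i - h` is truncated at `0`). -/
def boxCentre (h i : ℕ) : ℝ × ℝ := ((min i h : ℕ) + 1 / 2, 1 / 2 - ((i - h : ℕ) : ℝ))

/-- The `i`-th basepoint, at displacement `δ i` from the centre along the anti-diagonal
(the direction `(1,1)`) of its box. -/
def basept (h : ℕ) (δ : ℕ → ℝ) (i : ℕ) : ℝ × ℝ :=
  ((boxCentre h i).1 + δ i, (boxCentre h i).2 + δ i)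

/-- The slope of the segment from the `i`-th to the `(i+1)`-st basepoint. -/
def segSlope (h : ℕ) (δ : ℕ → ℝ) (i : ℕ) : ℝ :=
  ((basept h δ (i + 1)).2 - (basept h δ i).2) / ((basept h δ (i + 1)).1 - (basept h δ i).1)

/-- A special front projection of a knot in `L(p,q)`, for the grid number one diagram with
horizontal length `h` and vertical length `v`: a lift `s ↦ (X s, Y s)` of the front to the
universal cover of the torus. A curve of negative slope may be parameterized by `s = X - Y`, and
then the `i`-th basepoint is at `s = i`. The double points of the Lagrangian projection are
the pairs of parameters that differ by an integer and at which the slopes agree. -/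
structure SpecialFront (p q h v : ℕ) where
  X : ℝ → ℝ
  Y : ℝ → ℝ
  /-- displacements of the basepoints -/
  δ : ℕ → ℝ
  /-- size of the neighbourhoods of the basepoints in which corners are rounded -/
  ε : ℝ
  smooth_X : ContDiff ℝ ∞ X
  smooth_Y : ContDiff ℝ ∞ Y
  param : ∀ s, X s - Y s = s
  deriv_X_pos : ∀ s, 0 < deriv X s
  deriv_Y_neg : ∀ s, deriv Y s < 0
  /-- the front closes up on the torus after `h + v` segments -/
  closed_X : ∀ s, X (s + (h + v : ℕ)) = X s + h
  closed_Y : ∀ s, Y (s + (h + v : ℕ)) = Y s - v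
  ε_pos : 0 < ε
  ε_lt : ε < 1 / 2
  δ_small : ∀ i, |δ i| < 1 / 2
  δ_closed : δ (h + v) = δ 0
  /-- away from the basepoints the front is a union of line segments joining the basepoints -/
  segment : ∀ i < h + v, ∀ s ∈ Set.Icc (i + ε) (i + 1 - ε),
    (X s, Y s) = AffineMap.lineMap (basept h δ i) (basept h δ (i + 1)) (s - i)
  /-- the slopes of the segments decrease strictly -/
  slopes : StrictAntiOn (segSlope h δ) (Set.Iio (h + v))
  /-- near Box `0` the slope interpolates from the most to the least negative value -/
  ascending : StrictMonoOn (fun s => deriv Y s / deriv X s) (Set.Icc (-ε) ε)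
  /-- near every other basepoint the slope decreases strictly -/
  descending : ∀ i, 0 < i → i < h + v →
    StrictAntiOn (fun s => deriv Y s / deriv X s) (Set.Icc (i - ε) (i + ε))
  /-- the connecting curves stay in their boxes -/
  in_box : ∀ i < h + v, ∀ s ∈ Set.Icc (i - ε) (i + ε),
    |X s - (boxCentre h i).1| < 1 / 2 ∧ |Y s - (boxCentre h i).2| < 1 / 2
  /-- the double points of the Lagrangian projection are transverse -/
  transverse : ∀ (s : ℝ) (k : ℤ), (¬ ∃ l : ℤ, k = l * (h + v : ℕ)) →
    deriv Y s / deriv X s = deriv Y (s + k) / deriv X (s + k) →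
    deriv (fun t => deriv Y t / deriv X t) s ≠ deriv (fun t => deriv Y t / deriv X t) (s + k)

/-- The four quadrants at a crossing. -/
inductive Quadrant
  | north
  | east
  | south
  | west

/-- The determinant of three vectors. For `n` on the sphere and tangent vectors `a`, `b` at `n`,
`triple n a b > 0` says that `(a, b)` is a positive basis for the orientation in which (east, north)
is positive; this is the orientation of `S²` by the differential of the contact form. -/
def triple (n a b : Space) : ℝ :=
  Matrix.det !![n.1.re, n.1.im, n.2; a.1.re, a.1.im, a.2; b.1.re, b.1.im, b.2]

/-- The closed unit disc. -/
def disc : Set ℂ := Metric.closedBall 0 1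

/-- `f` is smooth and an orientation-preserving immersion at the point `z` of the disc. -/
def ImmersionAt (f : ℂ → Space) (z : ℂ) : Prop :=
  0 < triple (f z) (fderivWithin ℝ f disc z 1) (fderivWithin ℝ f disc z Complex.I)

/-- Near `z`, the map `f` to the sphere is `z ↦ z ^ p` up to smooth (orientation-preserving)
changes of coordinates `α` in the source and `β` in the target. -/
def BranchedAt (p : ℕ) (f : ℂ → Space) (z : ℂ) : Prop :=
  ∃ (α : ℂ → ℂ) (β : ℂ → Space),
    α z = 0 ∧ ContDiffAt ℝ ∞ α z ∧ 0 < (fderiv ℝ α z).det ∧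
    (∀ᶠ w in nhds 0, β w ∈ sphere2) ∧ ContDiffAt ℝ ∞ β 0 ∧
    0 < triple (β 0) (fderiv ℝ β 0 1) (fderiv ℝ β 0 Complex.I) ∧
    ∀ᶠ w in nhds z, f w = β (α w ^ p)

namespace SpecialFront

variable {p q h v : ℕ} (F : SpecialFront p q h v)

/-- The slope `dθ₂/dθ₁` of the front. -/
def slope (s : ℝ) : ℝ := deriv F.Y s / deriv F.X s

/-- The value of `r₁²` on the Legendrian knot, determined by the slope through
`slope = - r₁² / (1 - r₁²)`. -/
def rSq (s : ℝ) : ℝ := -F.slope s / (1 - F.slope s)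

theorem slope_neg (s : ℝ) : F.slope s < 0 := div_neg_of_neg_of_pos (F.deriv_Y_neg s) (F.deriv_X_pos s)

theorem rSq_pos (s : ℝ) : 0 < F.rSq s := by
  have := F.slope_neg s
  exact div_pos (by linarith) (by linarith)

theorem rSq_lt_one (s : ℝ) : F.rSq s < 1 := by
  have := F.slope_neg s
  unfold rSq
  rw [div_lt_one (by linarith)]
  linarith

theorem slope_eq (s : ℝ) : F.slope s = -F.rSq s / (1 - F.rSq s) := by
  have h1 := F.slope_neg s
  have h2 : (1 - F.slope s) ≠ 0 := by linarith
  have h3 : 1 - F.rSq s = 1 / (1 - F.slope s) := by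
    unfold rSq
    field_simp
    ring
  rw [h3]
  unfold rSq
  field_simp

/-- The lift to the three-sphere of the Legendrian knot with the given front. -/
def knotS3 (s : ℝ) : S3 :=
  ⟨((Real.sqrt (F.rSq s) : ℂ) * (Circle.exp (2 * Real.pi * F.X s / p) : ℂ),
    (Real.sqrt (1 - F.rSq s) : ℂ) * (Circle.exp (2 * Real.pi * F.Y s / p) : ℂ)), by
    have h1 := (F.rSq_pos s).le
    have h2 := sub_nonneg.2 (F.rSq_lt_one s).le
    rw [norm_mul, norm_mul, Circle.norm_coe, Circle.norm_coe, mul_one, mul_one, Complex.norm_real,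
      Complex.norm_real, Real.norm_eq_abs, Real.norm_eq_abs, sq_abs, sq_abs, Real.sq_sqrt h1,
      Real.sq_sqrt h2, add_sub_cancel]⟩

/-- The parameterized Legendrian knot `K₀` in `L(p,q)`, of period `h + v`. -/
def knot (s : ℝ) : LensSpace p q := toLens p q (F.knotS3 s)

/-- The parameterized Lagrangian projection of `K₀`. -/
def gamma (s : ℝ) : Space := lag p q (F.knot s)

/-- The Lagrangian projection `Γ` of `K₀`. -/
def Gamma : Set Space := Set.range F.gamma

/-- The crossings of `Γ`. -/
def crossings : Set Space :=
  {P | ∃ s ∈ Set.Ico (0 : ℝ) (h + v : ℕ), ∃ t ∈ Set.Ico (0 : ℝ) (h + v : ℕ),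
    s ≠ t ∧ F.gamma s = P ∧ F.gamma t = P}

/-- A Reeb chord of `K₀`, from the point with parameter `source` to the point with parameter
`sink`. Its length is measured as a fraction of the orbital period `2π`. -/
@[ext]
structure ReebChord (F : SpecialFront p q h v) where
  source : ℝ
  sink : ℝ
  length : ℝ
  source_mem : source ∈ Set.Ico (0 : ℝ) (h + v : ℕ)
  sink_mem : sink ∈ Set.Ico (0 : ℝ) (h + v : ℕ)
  length_mem : length ∈ Set.Ioo (0 : ℝ) 1
  flow : reeb p q (2 * Real.pi * length) (F.knot source) = F.knot sink

variable {F}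

namespace ReebChord

/-- The crossing of `Γ` to which the chord projects. -/
def crossing (x : F.ReebChord) : Space := F.gamma x.source

/-- The number of the crossing, counting crossings from the top down, starting with `1`. -/
def number (x : F.ReebChord) : ℕ := {P ∈ F.crossings | x.crossing.2 < P.2}.ncard + 1

/-- The (open) quadrants at the crossing of `x`; only their germs at the crossing matter.
A point near the crossing has azimuth `2π (source + r)`, and above it `r₁²` is smaller. -/
def quadrant (x : F.ReebChord) : Quadrant → Set Space
  | .north => {P | ∃ r ∈ Set.Ioo (-1 / 2 : ℝ) (1 / 2), ∃ w ∈ Set.Ioo (0 : ℝ) 1,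
      P = spherePoint (x.source + r) w ∧ w < F.rSq (x.source + r) ∧ w < F.rSq (x.sink + r)}
  | .south => {P | ∃ r ∈ Set.Ioo (-1 / 2 : ℝ) (1 / 2), ∃ w ∈ Set.Ioo (0 : ℝ) 1,
      P = spherePoint (x.source + r) w ∧ F.rSq (x.source + r) < w ∧ F.rSq (x.sink + r) < w}
  | .east => {P | ∃ r ∈ Set.Ioo (0 : ℝ) (1 / 2), ∃ w ∈ Set.Ioo (0 : ℝ) 1,
      P = spherePoint (x.source + r) w ∧
      w ∈ Set.Ioo (min (F.rSq (x.source + r)) (F.rSq (x.sink + r)))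
        (max (F.rSq (x.source + r)) (F.rSq (x.sink + r)))}
  | .west => {P | ∃ r ∈ Set.Ioo (-1 / 2 : ℝ) 0, ∃ w ∈ Set.Ioo (0 : ℝ) 1,
      P = spherePoint (x.source + r) w ∧
      w ∈ Set.Ioo (min (F.rSq (x.source + r)) (F.rSq (x.sink + r)))
        (max (F.rSq (x.source + r)) (F.rSq (x.sink + r)))}

/-- The label of a quadrant: `1` for `x⁺` and `-1` for `x⁻`. In the coordinates (east, north) the
two strands have the directions `(1, -rSq')` up to a positive rescaling of the second coordinate.
The north (south) quadrant is bounded by the western half of one strand and the eastern half of the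
other one, the east (west) quadrant by the halves on the same side; entering the crossing along the
source strand and leaving it along the sink strand, one goes around the quadrant
counterclockwise exactly if the following sign is `1`. -/
def label (x : F.ReebChord) : Quadrant → SignType
  | .north => SignType.sign (deriv F.rSq x.source - deriv F.rSq x.sink)
  | .south => SignType.sign (deriv F.rSq x.source - deriv F.rSq x.sink)
  | .east => SignType.sign (deriv F.rSq x.sink - deriv F.rSq x.source)
  | .west => SignType.sign (deriv F.rSq x.sink - deriv F.rSq x.source)

/-- `x` is an `a`-type generator: its `+` labels are on the north and south quadrants. These are the
preferred generators. -/
def IsAType (x : F.ReebChord) : Prop := x.label .north = 1 ∧ x.label .south = 1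

/-- `x` is the generator `a_i`. -/
def IsA (x : F.ReebChord) (i : ℕ) : Prop := x.IsAType ∧ x.number = i

end ReebChord

variable (F)

/-! ## Defects -/

/-- The components of `S² - Γ`. -/
def regions : Set (Set Space) :=
  {R | ∃ P ∈ sphere2 \ F.Gamma, R = connectedComponentIn (sphere2 \ F.Gamma) P}

/-- The area on `S²`. The differential of the contact form is `d(r₁²) ∧ d(θ₁ - θ₂)`, so the area form
is a constant multiple of `d(r₁²) ∧ dφ`, and it is normalized so that the total area
is `1 / p`. -/
def area (_F : SpecialFront p q h v) (R : Set Space) : ℝ :=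
  1 / p * (MeasureTheory.volume
    {c : ℝ × ℝ | c ∈ Set.Ioc (0 : ℝ) 1 ×ˢ Set.Ioo (0 : ℝ) 1 ∧ spherePoint c.1 c.2 ∈ R}).toReal

/-- The region `R` has a corner at the crossing of `x` and fills the quadrant `Q` there. -/
def RegionFills (R : Set Space) (x : F.ReebChord) (Q : Quadrant) : Prop :=
  ∃ V ∈ nhds x.crossing, x.quadrant Q ∩ V ⊆ R

open Classical in
/-- The contribution of the quadrant `Q` at the crossing of the preferred generator `x` to the
defect of `R`. -/
def cornerTerm (R : Set Space) (x : F.ReebChord) (Q : Quadrant) : ℝ :=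
  if F.RegionFills R x Q then ((x.label Q : SignType) : ℝ) * x.length else 0

/-- The defect of a region: minus the area, plus the signed lengths of the preferred generators at
its corners. -/
def regionDefect (R : Set Space) : ℝ :=
  -F.area R + ∑ᶠ (x : F.ReebChord) (_ : x.IsAType),
    (F.cornerTerm R x .north + F.cornerTerm R x .east
      + F.cornerTerm R x .south + F.cornerTerm R x .west)

/-- The multiplicity of the region `R` in the image of `f`: the number of preimages of a point of
`R` other than a pole (this number does not depend on the point if `f` is an admissible disc). -/
def multiplicity (f : ℂ → Space) (R : Set Space) : ℕ :=
  sSup ((fun P => {z ∈ disc | f z = P}.ncard) '' (R \ {northPole, southPole}))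

/-- The defect of the image of `f`: the sum of the defects of the regions, with multiplicity. -/
def discDefect (f : ℂ → Space) : ℝ :=
  ∑ᶠ (R : Set Space) (_ : R ∈ F.regions), (multiplicity f R : ℝ) * F.regionDefect R

/-! ## Admissible discs and the boundary map -/

/-- At the boundary point `z` of the disc, which goes to the crossing of `x`, the image of `f` fills
the quadrant `Q` and no other one. -/
def DiscFills (f : ℂ → Space) (z : ℂ) (x : F.ReebChord) (Q : Quadrant) : Prop :=
  f z = x.crossing ∧
  (∀ᶠ w in nhdsWithin z (Metric.ball 0 1), f w ∈ x.quadrant Q) ∧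
  ∀ U ∈ nhds z, ∃ V ∈ nhds x.crossing, x.quadrant Q ∩ V ⊆ f '' (U ∩ Metric.ball 0 1)

/-- An admissible disc with `m + 1` marked points `exp (i · angle k)`, listed counterclockwise. -/
structure AdmissibleDisc (F : SpecialFront p q h v) where
  f : ℂ → Space
  m : ℕ
  angle : Fin (m + 1) → ℝ
  angle_mono : StrictMono angle
  angle_lt : angle (Fin.last m) < angle 0 + 2 * Real.pi
  maps_sphere : ∀ z ∈ disc, f z ∈ sphere2
  continuous : ContinuousOn f disc
  boundary : ∀ z ∈ Metric.sphere (0 : ℂ) 1, f z ∈ F.Gamma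
  smooth : ContDiffOn ℝ ∞ f (disc \ Set.range fun k => (Circle.exp (angle k) : ℂ))
  /-- away from the marked points, `f` is an immersion except possibly at some points that go to
  the poles, near which it looks like `z ↦ z ^ p` -/
  immersion : ∀ z ∈ disc \ Set.range (fun k => (Circle.exp (angle k) : ℂ)),
    ImmersionAt f z ∨
      (z ∈ Metric.ball (0 : ℂ) 1 ∧ (f z = northPole ∨ f z = southPole) ∧ BranchedAt p f z)
  corner : ∀ k, ∃ x Q, F.DiscFills f (Circle.exp (angle k) : ℂ) x Q

variable {F}

namespace AdmissibleDisc

/-- The `k`-th marked point. -/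
def mark (D : F.AdmissibleDisc) (k : Fin (D.m + 1)) : ℂ := (Circle.exp (D.angle k) : ℂ)

/-- At the `k`-th marked point the disc fills a quadrant with the label `x⁺` (if `e = 1`) or `x⁻`
(if `e = -1`). -/
def HasCorner (D : F.AdmissibleDisc) (k : Fin (D.m + 1)) (x : F.ReebChord) (e : SignType) : Prop :=
  ∃ Q, F.DiscFills D.f (D.mark k) x Q ∧ x.label Q = e

end AdmissibleDisc

open Classical in
/-- A disc that is counted in `∂ x`: an admissible disc with a corner `x⁺` at the initial marked
point, with negative labels `neg 0, neg 1, …` at the other marked points in counterclockwise order,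
and with `x`-defect zero. -/
structure BoundaryDisc (x : F.ReebChord) extends F.AdmissibleDisc where
  neg : Fin m → F.ReebChord
  pos_corner : toAdmissibleDisc.HasCorner 0 x 1
  neg_corner : ∀ k : Fin m, toAdmissibleDisc.HasCorner k.succ (neg k) (-1)
  defect_eq_zero : F.discDefect f - ({k | ¬ (neg k).IsAType} : Set (Fin m)).ncard
    + (if x.IsAType then 0 else 1) = 0

/-- The algebra `𝒜(K₀)`: the tensor algebra over `ℤ/2` generated by the Reeb chords. -/
abbrev Algebra (F : SpecialFront p q h v) : Type := FreeAlgebra (ZMod 2) F.ReebChord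

namespace BoundaryDisc

variable {x : F.ReebChord}

/-- The boundary word `w(f, x)`. -/
def word (d : F.BoundaryDisc x) : F.Algebra := ((List.ofFn d.neg).map (FreeAlgebra.ι (ZMod 2))).prod

/-- Equivalence of discs: reparameterization by a smooth automorphism of the disc, compatible with
the marked points. (The list of labels is then automatically the same.) -/
def Equivalent (d e : F.BoundaryDisc x) : Prop :=
  (∃ a b : ℂ → ℂ, ContDiffOn ℝ ∞ a disc ∧ ContDiffOn ℝ ∞ b disc ∧
    Set.MapsTo a disc disc ∧ Set.MapsTo b disc disc ∧ Set.InvOn b a disc disc ∧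
    (∀ z ∈ disc, d.f z = e.f (a z)) ∧
    a (d.mark 0) = e.mark 0 ∧ a '' Set.range d.mark = Set.range e.mark) ∧
  List.ofFn d.neg = List.ofFn e.neg

end BoundaryDisc

/-- The boundary map on generators: `∂ x` is the sum of the words `w(f, x)` over the equivalence
classes of discs `f` with `x`-defect zero. -/
def boundaryMap (x : F.ReebChord) : F.Algebra :=
  ∑ᶠ c : Quot (BoundaryDisc.Equivalent (x := x)),
    Quot.lift BoundaryDisc.word (fun d e hde => by
      unfold BoundaryDisc.word
      rw [hde.2]) c

/-! ## Capping paths -/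

/-- A capping path for `x`: a path that runs smoothly along `Γ`, from the parameter `start` to the
parameter `finish` (in either direction, and possibly several times around `Γ`), leaves the crossing
of `x` on one strand and returns to it on the other strand, and there turns a corner around a
quadrant labelled `x⁺`, i.e. starts and ends along the two edges of that quadrant. -/
structure CappingPath (x : F.ReebChord) where
  start : ℝ
  finish : ℝ
  strands : ((∃ k : ℤ, start = x.source + k * (h + v : ℕ)) ∧
      (∃ k : ℤ, finish = x.sink + k * (h + v : ℕ))) ∨
    ((∃ k : ℤ, start = x.sink + k * (h + v : ℕ)) ∧
      (∃ k : ℤ, finish = x.source + k * (h + v : ℕ)))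
  turns : ∃ Q, x.label Q = 1 ∧
    ∀ᶠ τ in nhdsWithin (0 : ℝ) (Set.Ioi 0),
      F.gamma (start + τ * (finish - start)) ∈ closure (x.quadrant Q) ∧
      F.gamma (finish + τ * (start - finish)) ∈ closure (x.quadrant Q)

/-- The path itself, parameterized by `[0,1]`. -/
def CappingPath.path {x : F.ReebChord} (η : F.CappingPath x) (τ : ℝ) : Space :=
  F.gamma (η.start + τ * (η.finish - η.start))

/-- The capping path bounds the disc `d` (positively): up to an increasing reparameterization it is
the restriction of `d` to the boundary circle, run through once counterclockwise from the initial
marked point. -/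
def CappingPath.Bounds {x : F.ReebChord} (η : F.CappingPath x) (d : F.BoundaryDisc x) : Prop :=
  ∃ c : ℝ → ℝ, ContinuousOn c (Set.Icc 0 1) ∧ StrictMonoOn c (Set.Icc 0 1) ∧ c 0 = 0 ∧ c 1 = 1 ∧
    ∀ τ ∈ Set.Icc (0 : ℝ) 1,
      d.f (Circle.exp (d.angle 0 + 2 * Real.pi * τ) : ℂ) = η.path (c τ)

/-- Some capping path for `x` bounds a disc which is disjoint from the point `P` and which
contributes the constant term `1` to `∂ x`. -/
def CapContributesOne (x : F.ReebChord) (P : Space) : Prop :=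
  ∃ (η : F.CappingPath x) (d : F.BoundaryDisc x),
    η.Bounds d ∧ (∀ z ∈ disc, d.f z ≠ P) ∧ d.word = 1

end SpecialFront

end LensKnot

end

/-!
Parameterize the front by `s = X - Y`. Then the Lagrangian projection `Γ` has azimuth `2 π s` at the
parameter `s`, and there `r₁² = rSq s = -Y' s` (`gamma_eq`, `rSq_eq`). Over each meridian there are
`N = h + v` branches `rSq (s + i)`, `0 ≤ i < N`. Near the azimuth of Box `0` the `0`-th branch
descends through the others, which stay in order (`rSq_lower_lt_upper`). Hence the crossings are
those of the `0`-th branch with the `i`-th one, `0 < i < N`, numbered by `i` from the top down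
(`double_params`, `ReebChord.number_eq`), the preferred chord `a_i` starts on the `i`-th branch and
ends on the `0`-th one (`ReebChord.isA_iff`), and the components of `S² - Γ` are the sets of points
with a given number `k` of branches towards the north pole, the depth (`regions_eq`).

Write `p = u N + j`, where `0 < j` because `N` does not divide `p` (`not_dvd_of_dvd_add_mul`). The
arc of `Γ` which leaves the `j`-th crossing on the `0`-th branch and makes `p` turns to the east
comes back on the `j`-th branch. It bounds a disc which covers the north pole by `z ↦ z ^ p`; the
cap is written down in polar coordinates, with the kink of the boundary at the corner smoothed
inside (`CapData.cap`). Its multiplicity on the region of depth `k` is the number of branches below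
a point within `p` turns, `u (N - k) + max (j - k) 0` (`card_lt_eq`).

The corners of the regions at the `i`-th crossing contribute the second difference of the
multiplicities at `k = i`, times the length of `a_i`, to the defect (`ReebChord.sum_cornerTerm`).
Here the second difference is `1` for `i = j` and `0` otherwise, so the lengths add up to that of
`a_j`. On the other hand, the integral of `rSq = -Y'` along the arc is the difference of `Y` at its
ends, and the area of the disc is `1 / p` times this (`sum_area`). The Reeb flow moves `Y` at a
constant rate, and so this is the length of the chord as well. Hence the defect is zero
(`discDefect_eq`), and without negative corners the disc contributes the empty word.

The disc at the crossing `N - j` is obtained likewise from the arc that makes `p` turns to the west,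
after the rotation of the sphere that exchanges the poles (`flip`); its multiplicities are
`u k + max (k - (N - j)) 0` (`card_gt_eq`).
-/

noncomputable section

namespace LensKnot

/-! ### Cylindrical coordinates on the sphere -/

theorem norm_spherePoint_fst {s w : ℝ} (h : 0 ≤ w * (1 - w)) :
    ‖(spherePoint s w).1‖ ^ 2 = 4 * (w * (1 - w)) := by
  simp only [spherePoint]
  rw [norm_mul, Circle.norm_coe, mul_one, Complex.norm_real, Real.norm_eq_abs, sq_abs, mul_pow,
    Real.sq_sqrt h]
  ring

theorem spherePoint_mem {s w : ℝ} (h0 : 0 ≤ w) (h1 : w ≤ 1) : spherePoint s w ∈ sphere2 := by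
  have h : 0 ≤ w * (1 - w) := mul_nonneg h0 (by linarith)
  change ‖(spherePoint s w).1‖ ^ 2 + (spherePoint s w).2 ^ 2 = 1
  rw [norm_spherePoint_fst h]
  simp only [spherePoint]
  ring

theorem spherePoint_zero (s : ℝ) : spherePoint s 0 = northPole := by
  simp [spherePoint, northPole]

theorem spherePoint_one (s : ℝ) : spherePoint s 1 = southPole := by
  simp [spherePoint, southPole]
  norm_num

theorem spherePoint_add_int (s w : ℝ) (k : ℤ) : spherePoint (s + k) w = spherePoint s w := by
  have : Circle.exp (2 * Real.pi * (s + k)) = Circle.exp (2 * Real.pi * s) := by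
    rw [Circle.exp_eq_exp]
    exact ⟨k, by ring⟩
  simp only [spherePoint, this]

theorem spherePoint_add_nat (s w : ℝ) (k : ℕ) : spherePoint (s + k) w = spherePoint s w := by
  simpa using spherePoint_add_int s w k

theorem spherePoint_height {s w s' w' : ℝ} (h : spherePoint s w = spherePoint s' w') : w = w' := by
  have := congrArg Prod.snd h
  simp only [spherePoint] at this
  linarith

/-- Away from the poles, cylindrical coordinates are unique up to full turns. -/
theorem spherePoint_inj {s w s' w' : ℝ} (hw : w ∈ Set.Ioo (0 : ℝ) 1)
    (h : spherePoint s w = spherePoint s' w') : w = w' ∧ ∃ k : ℤ, s = s' + k := by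
  have hww := spherePoint_height h
  refine ⟨hww, ?_⟩
  subst hww
  have h1 := congrArg Prod.fst h
  simp only [spherePoint] at h1
  have hpos : 0 < w * (1 - w) := mul_pos hw.1 (by linarith [hw.2])
  have h2 : ((2 * Real.sqrt (w * (1 - w)) : ℝ) : ℂ) ≠ 0 := by
    have := Real.sqrt_pos.2 hpos
    exact_mod_cast (by positivity : (2 * Real.sqrt (w * (1 - w))) ≠ 0)
  have h3 := mul_left_cancel₀ h2 h1
  have h4 : Circle.exp (2 * Real.pi * s) = Circle.exp (2 * Real.pi * s') := Subtype.ext h3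
  rw [Circle.exp_eq_exp] at h4
  obtain ⟨k, hk⟩ := h4
  refine ⟨k, ?_⟩
  have : 2 * Real.pi * (s - (s' + k)) = 0 := by linear_combination hk
  have := (mul_eq_zero.1 this).resolve_left (by positivity)
  linarith

theorem continuous_spherePoint : Continuous fun c : ℝ × ℝ => spherePoint c.1 c.2 := by
  unfold spherePoint
  fun_prop

/-- Every point of the sphere has cylindrical coordinates with azimuth in a given fundamental
domain. -/
theorem exists_spherePoint {P : Space} (hP : P ∈ sphere2) (a : ℝ) :
    ∃ s ∈ Set.Ico a (a + 1), ∃ w ∈ Set.Icc (0 : ℝ) 1, P = spherePoint s w := by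
  have hP' : ‖P.1‖ ^ 2 + P.2 ^ 2 = 1 := hP
  set t : ℝ := P.1.arg / (2 * Real.pi) with ht
  set w : ℝ := (1 - P.2) / 2 with hw
  have hsq : ‖P.1‖ ^ 2 = 4 * (w * (1 - w)) := by rw [hw]; linear_combination hP'
  have hb := abs_le.1 (abs_le_one_iff_mul_self_le_one.2
    (by nlinarith [sq_nonneg ‖P.1‖] : P.2 * P.2 ≤ 1))
  have key : P = spherePoint t w := by
    apply Prod.ext
    · simp only [spherePoint]
      have h1 : 2 * Real.sqrt (w * (1 - w)) = ‖P.1‖ := by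
        have h3 : w * (1 - w) = (‖P.1‖ / 2) ^ 2 := by rw [div_pow, hsq]; ring
        rw [h3, Real.sqrt_sq (by positivity)]
        ring
      have h2 : 2 * Real.pi * t = P.1.arg := by rw [ht]; field_simp
      rw [h1, h2, Circle.coe_exp]
      exact (Complex.norm_mul_exp_arg_mul_I P.1).symm
    · simp only [spherePoint, hw]; ring
  refine ⟨toIcoMod one_pos a t, toIcoMod_mem_Ico _ _ _, w,
    ⟨by rw [hw]; linarith, by rw [hw]; linarith⟩, ?_⟩
  rw [toIcoMod, key]
  have := spherePoint_add_int t w (-toIcoDiv one_pos a t)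
  rw [← this]
  congr 1
  push_cast
  simp [sub_eq_add_neg]

/-- Cylindrical coordinates are local coordinates away from the poles. -/
theorem exists_nhds_spherePoint (s₀ : ℝ) {w₀ δ : ℝ} (hw₀ : w₀ ∈ Set.Ioo (0 : ℝ) 1) (hδ : 0 < δ) :
    ∃ V ∈ nhds (spherePoint s₀ w₀), ∀ r ∈ Set.Icc (-1 / 2 : ℝ) (1 / 2), ∀ w ∈ Set.Icc (0 : ℝ) 1,
      spherePoint (s₀ + r) w ∈ V → |r| < δ ∧ |w - w₀| < δ := by
  -- the compact image of the coordinates that are not close avoids the point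
  set T : Set (ℝ × ℝ) := (Set.Icc (-1 / 2 : ℝ) (1 / 2) ×ˢ Set.Icc (0 : ℝ) 1) ∩
    {c | δ ≤ |c.1| ∨ δ ≤ |c.2 - w₀|} with hT
  have hTc : IsCompact T := by
    apply (isCompact_Icc.prod isCompact_Icc).inter_right
    exact (isClosed_le continuous_const (by fun_prop : Continuous fun c : ℝ × ℝ => |c.1|)).union
      (isClosed_le continuous_const (by fun_prop : Continuous fun c : ℝ × ℝ => |c.2 - w₀|))
  have hcont : Continuous fun c : ℝ × ℝ => spherePoint (s₀ + c.1) c.2 :=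
    continuous_spherePoint.comp (by fun_prop : Continuous fun c : ℝ × ℝ => (s₀ + c.1, c.2))
  have himg : IsClosed ((fun c : ℝ × ℝ => spherePoint (s₀ + c.1) c.2) '' T) :=
    (hTc.image hcont).isClosed
  refine ⟨_, himg.isOpen_compl.mem_nhds ?_, ?_⟩
  · rintro ⟨⟨r, w⟩, ⟨⟨hr, hw⟩, hbad⟩, heq⟩
    obtain ⟨h1, k, hk⟩ := spherePoint_inj hw₀ heq.symm
    simp only [Set.mem_ofPred_eq, Set.mem_Icc] at h1 hk hr hw hbad
    have hk0 : k = 0 := by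
      have h2 : (k : ℝ) = -r := by linarith
      have h3 : (k : ℝ) < 1 := by linarith [hr.1]
      have h4 : (-1 : ℝ) < k := by linarith [hr.2]
      have h3' : k < 1 := by exact_mod_cast h3
      have h4' : -1 < k := by exact_mod_cast h4
      omega
    subst hk0
    have hr0 : r = 0 := by push_cast at hk; linarith
    subst hr0
    rw [← h1] at hbad
    simp at hbad
    linarith
  · intro r hr w hw hV
    by_contra hcon
    apply hV
    refine ⟨(r, w), ⟨⟨hr, hw⟩, ?_⟩, rfl⟩
    rw [not_and_or, not_lt, not_lt] at hcon
    exact hcon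

/-! ### The branched cap bounded by an arc with one corner -/

/-- Data for a disc over the north pole: the curve `w = g s` on the sphere, run through for azimuths
from `s₀` to `s₀ + p`, returns to its initial point, where the initial strand leaves below the
final one in `w` (so above it on the sphere), and the final strand arrives below the initial one.
The bounds `η` and `b` quantify these conditions. -/
structure CapData (p : ℕ) (g : ℝ → ℝ) (s₀ : ℝ) where
  η : ℝ
  b : ℝ
  p_pos : 0 < p
  smooth : ContDiff ℝ ∞ g
  closed : g (s₀ + p) = g s₀
  lt_one : ∀ s, g s < 1
  η_pos : 0 < η
  η_le : η ≤ 1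
  lt_of_pos : ∀ θ ∈ Set.Ioo 0 η,
    g (s₀ + p * θ / (2 * Real.pi)) < g (s₀ + p + p * θ / (2 * Real.pi))
  lt_of_neg : ∀ θ ∈ Set.Ioo (-η) 0,
    g (s₀ + p + p * θ / (2 * Real.pi)) < g (s₀ + p * θ / (2 * Real.pi))
  b_pos : 0 < b
  b_le : ∀ s, 2 * b ≤ g s

namespace CapData

variable {p : ℕ} {g : ℝ → ℝ} {s₀ : ℝ} (d : CapData p g s₀)

/-- The strand that leaves the corner, as a function of the angle in the disc. -/
def out (_d : CapData p g s₀) (θ : ℝ) : ℝ := g (s₀ + p * θ / (2 * Real.pi))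

/-- The strand that arrives at the corner. -/
def inc (_d : CapData p g s₀) (θ : ℝ) : ℝ := g (s₀ + p + p * θ / (2 * Real.pi))

/-- A cutoff function around the corner. -/
def bump : ContDiffBump (0 : ℝ) where
  rIn := d.η / 4
  rOut := d.η / 2
  rIn_pos := by linarith [d.η_pos]
  rIn_lt_rOut := by linarith [d.η_pos]

/-- A function which near the corner is the minimum of the two strands for `t = 1`, and a smooth
approximation of it from below for `t < 1`. -/
def smoothMin (t θ : ℝ) : ℝ :=
  (d.out θ + d.inc θ - √((d.out θ - d.inc θ) ^ 2 + d.bump θ * (d.b ^ 2 * (1 - t)))) / 2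

open Classical in
/-- On the unit circle, this is the value of `g` along the boundary arc; inside the disc the kink at
the corner is smoothed. -/
def rim (z : ℂ) : ℝ :=
  if |z.arg| < d.η then d.smoothMin (‖z‖ ^ 2) z.arg else d.out ((-z).arg + Real.pi)

/-- A smooth cutoff, `0` for `t ≤ 1 / 2` and `1` at `t = 1`. -/
def ramp (t : ℝ) : ℝ := Real.smoothTransition (2 * t - 1)

/-- The coordinate `w` of the cap divided by `‖z‖ ^ (2 * p)`; it is constant near `0`. -/
def Q (z : ℂ) : ℝ := d.b ^ (2 * p) + ramp (‖z‖ ^ 2) * (d.rim z - d.b ^ (2 * p))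

/-- The coordinate `w` of the cap. -/
def G (z : ℂ) : ℝ := ‖z‖ ^ (2 * p) * d.Q z

/-- The cap: the `p`-fold cover of the north pole, branched at `0`, which takes the ray of angle `θ`
to the meridian of azimuth `2 π s₀ + p θ`. -/
def cap (z : ℂ) : Space :=
  (((2 * √(d.Q z * (1 - d.G z)) : ℝ) : ℂ) * (z ^ p * (Circle.exp (2 * Real.pi * s₀) : ℂ)),
    1 - 2 * d.G z)

theorem b_lt_half : d.b < 1 / 2 := by linarith [d.b_le 0, d.lt_one 0]

theorem pow_b_pos : 0 < d.b ^ (2 * p) := pow_pos d.b_pos _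

theorem pow_b_le : d.b ^ (2 * p) ≤ d.b := by
  have := d.p_pos
  calc d.b ^ (2 * p) ≤ d.b ^ 1 :=
        pow_le_pow_of_le_one d.b_pos.le (by linarith [d.b_lt_half]) (by omega)
    _ = d.b := pow_one _

theorem contDiff_out : ContDiff ℝ ∞ d.out := by
  unfold out
  exact d.smooth.comp (by fun_prop)

theorem contDiff_inc : ContDiff ℝ ∞ d.inc := by
  unfold inc
  exact d.smooth.comp (by fun_prop)

theorem inc_eq (θ : ℝ) : d.inc θ = d.out (θ + 2 * Real.pi) := by
  unfold inc out
  congr 1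
  field_simp
  ring

theorem out_zero_eq : d.out 0 = d.inc 0 := by
  simp [out, inc, d.closed]

theorem out_le_inc {θ : ℝ} (h0 : 0 ≤ θ) (h1 : θ < d.η) : d.out θ ≤ d.inc θ := by
  rcases h0.eq_or_lt with rfl | h0
  · exact d.out_zero_eq.le
  · exact (d.lt_of_pos θ ⟨h0, h1⟩).le

theorem inc_le_out {θ : ℝ} (h0 : θ ≤ 0) (h1 : -d.η < θ) : d.inc θ ≤ d.out θ := by
  rcases h0.eq_or_lt with rfl | h0
  · exact d.out_zero_eq.ge
  · exact (d.lt_of_neg θ ⟨h1, h0⟩).le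

theorem out_ne_inc {θ : ℝ} (h0 : θ ≠ 0) (h1 : |θ| < d.η) : d.out θ ≠ d.inc θ := by
  rw [abs_lt] at h1
  rcases lt_or_gt_of_ne h0 with h | h
  · exact (d.lt_of_neg θ ⟨h1.1, h⟩).ne'
  · exact (d.lt_of_pos θ ⟨h, h1.2⟩).ne

theorem bump_eq_zero {θ : ℝ} (h : d.η / 2 ≤ |θ|) : d.bump θ = 0 := by
  apply d.bump.zero_of_le_dist
  simpa [bump] using h

theorem bump_zero : d.bump 0 = 1 :=
  d.bump.one_of_mem_closedBall (by simp [bump]; linarith [d.η_pos])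

theorem min_eq_half_add_sub_abs (x y : ℝ) : min x y = (x + y - |x - y|) / 2 := by
  rcases le_total x y with h | h
  · rw [min_eq_left h, abs_of_nonpos (by linarith)]; ring
  · rw [min_eq_right h, abs_of_nonneg (by linarith)]; ring

theorem smoothMin_eq_min {t θ : ℝ} (h : d.bump θ * (1 - t) = 0) :
    d.smoothMin t θ = min (d.out θ) (d.inc θ) := by
  have h1 : d.bump θ * (d.b ^ 2 * (1 - t)) = 0 := by linear_combination d.b ^ 2 * h
  rw [smoothMin, h1, add_zero, Real.sqrt_sq_eq_abs, min_eq_half_add_sub_abs]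

theorem smoothMin_mono {t t' θ : ℝ} (h : t ≤ t') : d.smoothMin t θ ≤ d.smoothMin t' θ := by
  unfold smoothMin
  have h1 : d.bump θ * (d.b ^ 2 * (1 - t')) ≤ d.bump θ * (d.b ^ 2 * (1 - t)) := by
    have := d.bump.nonneg (x := θ)
    gcongr
  have := Real.sqrt_le_sqrt (by linarith : (d.out θ - d.inc θ) ^ 2 + d.bump θ * (d.b ^ 2 * (1 - t'))
    ≤ (d.out θ - d.inc θ) ^ 2 + d.bump θ * (d.b ^ 2 * (1 - t)))
  linarith

theorem smoothMin_le_min {t θ : ℝ} (h : t ≤ 1) :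
    d.smoothMin t θ ≤ min (d.out θ) (d.inc θ) := by
  rw [← d.smoothMin_eq_min (t := 1) (by simp)]
  exact d.smoothMin_mono h

/-- The smoothing costs at most half of the lower bound `2 * b` of the two strands. -/
theorem b_le_smoothMin {t θ : ℝ} (h0 : 0 ≤ t) : d.b ≤ d.smoothMin t θ := by
  refine le_trans ?_ (d.smoothMin_mono h0)
  unfold smoothMin
  have hb := d.b_pos
  have h1 : √((d.out θ - d.inc θ) ^ 2 + d.bump θ * (d.b ^ 2 * (1 - 0)))
      ≤ |d.out θ - d.inc θ| + d.b := by
    apply Real.sqrt_le_iff.2 ⟨by positivity, ?_⟩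
    have h2 : d.bump θ * (d.b ^ 2 * (1 - 0)) ≤ 1 * d.b ^ 2 := by
      rw [sub_zero, mul_one]
      exact mul_le_mul_of_nonneg_right d.bump.le_one (by positivity)
    have h3 := abs_nonneg (d.out θ - d.inc θ)
    have h4 := sq_abs (d.out θ - d.inc θ)
    nlinarith
  have h5 : 2 * d.b ≤ min (d.out θ) (d.inc θ) := le_min (d.b_le _) (d.b_le _)
  rw [min_eq_half_add_sub_abs] at h5
  generalize √((d.out θ - d.inc θ) ^ 2 + d.bump θ * (d.b ^ 2 * (1 - 0))) = x at h1 ⊢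
  linarith

theorem contDiff_smoothMin_radicand : ContDiff ℝ ∞ fun c : ℝ × ℝ =>
    (d.out c.2 - d.inc c.2) ^ 2 + d.bump c.2 * (d.b ^ 2 * (1 - c.1)) := by
  have h1 : ContDiff ℝ ∞ fun c : ℝ × ℝ => d.out c.2 := d.contDiff_out.comp contDiff_snd
  have h2 : ContDiff ℝ ∞ fun c : ℝ × ℝ => d.inc c.2 := d.contDiff_inc.comp contDiff_snd
  have h3 : ContDiff ℝ ∞ fun c : ℝ × ℝ => d.bump c.2 := (d.bump.contDiff (n := ⊤)).comp contDiff_snd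
  exact ((h1.sub h2).pow 2).add (h3.mul (contDiff_const.mul (contDiff_const.sub contDiff_fst)))

theorem continuous_smoothMin : Continuous fun c : ℝ × ℝ => d.smoothMin c.1 c.2 := by
  have h1 : Continuous fun c : ℝ × ℝ => d.out c.2 := d.contDiff_out.continuous.comp continuous_snd
  have h2 : Continuous fun c : ℝ × ℝ => d.inc c.2 := d.contDiff_inc.continuous.comp continuous_snd
  unfold smoothMin
  exact ((h1.add h2).sub d.contDiff_smoothMin_radicand.continuous.sqrt).div_const 2

/-- The radicand is positive except at the corner: for `θ ≠ 0` the strands are different, and for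
`θ = 0` the cutoff is `1`. -/
theorem contDiffAt_smoothMin {t θ : ℝ} (hθ : |θ| < d.η) (ht : t ≤ 1) (h : t < 1 ∨ θ ≠ 0) :
    ContDiffAt ℝ ∞ (fun c : ℝ × ℝ => d.smoothMin c.1 c.2) (t, θ) := by
  have h1 : ContDiff ℝ ∞ fun c : ℝ × ℝ => d.out c.2 := d.contDiff_out.comp contDiff_snd
  have h2 : ContDiff ℝ ∞ fun c : ℝ × ℝ => d.inc c.2 := d.contDiff_inc.comp contDiff_snd
  have hb := d.b_pos
  have hne : (d.out θ - d.inc θ) ^ 2 + d.bump θ * (d.b ^ 2 * (1 - t)) ≠ 0 := by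
    apply ne_of_gt
    by_cases h0 : θ = 0
    · subst h0
      rw [d.bump_zero]
      have : 0 < 1 - t := by
        rcases h with h | h
        · linarith
        · exact absurd rfl h
      positivity
    · have h3 : 0 < (d.out θ - d.inc θ) ^ 2 := by
        have := sub_ne_zero.2 (d.out_ne_inc h0 hθ)
        positivity
      have h4 : 0 ≤ d.bump θ * (d.b ^ 2 * (1 - t)) :=
        mul_nonneg d.bump.nonneg (mul_nonneg (by positivity) (by linarith))
      linarith
  unfold smoothMin
  exact ((h1.add h2).contDiffAt.sub (d.contDiff_smoothMin_radicand.contDiffAt.sqrt hne)).div_const 2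

theorem arg_neg_add_pi_of_pos {z : ℂ} (h : 0 < z.arg) : (-z).arg + Real.pi = z.arg := by
  have h1 : (-z).arg = z.arg - Real.pi := by
    rw [Complex.arg_neg_eq_arg_sub_pi_iff]
    by_cases him : z.im = 0
    · right
      refine ⟨him, ?_⟩
      by_contra hre
      rw [not_lt] at hre
      have := Complex.arg_eq_zero_iff.2 ⟨hre, him⟩
      linarith
    · left
      exact lt_of_le_of_ne (Complex.arg_nonneg_iff.1 h.le) (Ne.symm him)
  linarith

theorem arg_neg_add_pi_of_nonpos {z : ℂ} (hz : z ≠ 0) (h : z.arg ≤ 0) :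
    (-z).arg + Real.pi = z.arg + 2 * Real.pi := by
  have h1 : (-z).arg = z.arg + Real.pi := by
    rw [Complex.arg_neg_eq_arg_add_pi_iff]
    rcases h.eq_or_lt with h | h
    · right
      obtain ⟨hre, him⟩ := Complex.arg_eq_zero_iff.1 h
      refine ⟨him, lt_of_le_of_ne hre fun h0 => hz (Complex.ext h0.symm him)⟩
    · left
      exact Complex.arg_neg_iff.1 h
  linarith

/-- The branch of the argument on which `rim` is defined away from the corner; it is smooth across
the negative real axis. -/
theorem out_arg_neg {z : ℂ} (hz : z ≠ 0) :
    d.out ((-z).arg + Real.pi) = if 0 < z.arg then d.out z.arg else d.inc z.arg := by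
  split_ifs with h
  · rw [arg_neg_add_pi_of_pos h]
  · rw [arg_neg_add_pi_of_nonpos hz (not_lt.1 h), d.inc_eq]

theorem rim_of_lt {z : ℂ} (h : |z.arg| < d.η) : d.rim z = d.smoothMin (‖z‖ ^ 2) z.arg := if_pos h

/-- The two formulas for `rim` agree where the cutoff vanishes. -/
theorem rim_of_half_lt {z : ℂ} (hz : z ≠ 0) (h : d.η / 2 < |z.arg|) :
    d.rim z = d.out ((-z).arg + Real.pi) := by
  by_cases h1 : |z.arg| < d.η
  · rw [d.rim_of_lt h1, d.smoothMin_eq_min (by rw [d.bump_eq_zero h.le, zero_mul]),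
      d.out_arg_neg hz]
    rw [abs_lt] at h1
    split_ifs with h2
    · exact min_eq_left (d.out_le_inc h2.le h1.2)
    · exact min_eq_right (d.inc_le_out (not_lt.1 h2) h1.1)
  · exact if_neg h1

theorem rim_lt_one {z : ℂ} (hz : ‖z‖ ≤ 1) : d.rim z < 1 := by
  unfold rim
  split_ifs
  · exact (d.smoothMin_le_min (pow_le_one₀ (norm_nonneg z) hz)).trans_lt
      (lt_of_le_of_lt (min_le_left _ _) (d.lt_one _))
  · exact d.lt_one _

theorem b_le_rim (z : ℂ) : d.b ≤ d.rim z := by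
  unfold rim
  split_ifs
  · exact d.b_le_smoothMin (by positivity)
  · have := d.b_le (s₀ + p * ((-z).arg + Real.pi) / (2 * Real.pi))
    have := d.b_pos
    unfold out
    linarith

theorem rim_of_norm_eq_one {z : ℂ} (hz : ‖z‖ = 1) :
    d.rim z = if 0 ≤ z.arg then d.out z.arg else d.inc z.arg := by
  have hz0 : z ≠ 0 := by rintro rfl; simp at hz
  by_cases h1 : |z.arg| < d.η
  · rw [d.rim_of_lt h1, d.smoothMin_eq_min (by rw [hz]; ring)]
    rw [abs_lt] at h1
    split_ifs with h2
    · exact min_eq_left (d.out_le_inc h2 h1.2)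
    · exact min_eq_right (d.inc_le_out (not_le.1 h2).le h1.1)
  · rw [d.rim_of_half_lt hz0 (by linarith [d.η_pos, not_lt.1 h1]), d.out_arg_neg hz0]
    have : z.arg ≠ 0 := by
      intro h0
      rw [h0, abs_zero] at h1
      exact h1 d.η_pos
    split_ifs with h2 h3 h3
    · rfl
    · exact absurd h2.le h3
    · exact absurd (lt_of_le_of_ne h3 this.symm) h2
    · rfl

/-- Along a ray, `rim` is monotone, since the smoothing vanishes towards the unit circle. -/
theorem rim_ray_mono {z : ℂ} {r r' : ℝ} (hr : 0 < r) (h : r ≤ r') :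
    d.rim (r * z) ≤ d.rim (r' * z) := by
  have hr' : 0 < r' := hr.trans_le h
  unfold rim
  rw [← mul_neg, ← mul_neg, Complex.arg_real_mul _ hr, Complex.arg_real_mul _ hr',
    Complex.arg_real_mul _ hr, Complex.arg_real_mul _ hr']
  split_ifs
  · apply d.smoothMin_mono
    rw [norm_mul, norm_mul, Complex.norm_real, Complex.norm_real, Real.norm_of_nonneg hr.le,
      Real.norm_of_nonneg hr'.le]
    gcongr
  · exact le_rfl

theorem contDiffAt_arg {z : ℂ} (hz : z ∈ Complex.slitPlane) : ContDiffAt ℝ ∞ Complex.arg z := by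
  have h1 : ContDiffAt ℝ ∞ Complex.log z := (Complex.contDiffAt_log hz).restrict_scalars ℝ
  have h2 := Complex.imCLM.contDiff.contDiffAt.comp z h1
  exact h2.congr_of_eventuallyEq (Filter.Eventually.of_forall fun w => by simp [Complex.log_im])

theorem mem_slitPlane_of_abs_arg_lt {z : ℂ} (hz : z ≠ 0) (h : |z.arg| < d.η) :
    z ∈ Complex.slitPlane := by
  rw [Complex.mem_slitPlane_iff_arg]
  refine ⟨fun h0 => ?_, hz⟩
  rw [h0, abs_of_pos Real.pi_pos] at h
  linarith [d.η_le, Real.pi_gt_three]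

/-- Points off the positive real axis. -/
theorem neg_mem_slitPlane {z : ℂ} (hz : z ≠ 0) (h : z.arg ≠ 0) : -z ∈ Complex.slitPlane := by
  rw [Complex.mem_slitPlane_iff_arg]
  refine ⟨fun h0 => ?_, neg_ne_zero.2 hz⟩
  rcases lt_or_ge 0 z.arg with h1 | h1
  · have := arg_neg_add_pi_of_pos h1
    linarith [Complex.arg_le_pi z, Real.pi_pos]
  · have := arg_neg_add_pi_of_nonpos hz h1
    exact h (by linarith)

theorem rim_eventuallyEq_smoothMin {z : ℂ} (hz : z ≠ 0) (h : |z.arg| < d.η) :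
    d.rim =ᶠ[nhds z] fun w => d.smoothMin (‖w‖ ^ 2) w.arg := by
  have h1 := (Complex.continuousAt_arg (d.mem_slitPlane_of_abs_arg_lt hz h)).abs
  filter_upwards [h1.eventually_lt continuousAt_const h] with w hw
  exact d.rim_of_lt hw

theorem rim_eventuallyEq_out {z : ℂ} (hz : z ≠ 0) (h : d.η / 2 < |z.arg|) :
    d.rim =ᶠ[nhds z] fun w => d.out ((-w).arg + Real.pi) := by
  by_cases hs : z ∈ Complex.slitPlane
  · have h1 := (Complex.continuousAt_arg hs).abs
    filter_upwards [continuousAt_const.eventually_lt h1 h, eventually_ne_nhds hz] with w hw hw0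
    exact d.rim_of_half_lt hw0 hw
  · -- near the negative real axis the argument jumps, but its absolute value is continuous
    have h0 : -z ∈ Complex.slitPlane := by
      refine neg_mem_slitPlane hz fun h0 => ?_
      rw [h0, abs_zero] at h
      linarith [d.η_pos]
    have harg : z.arg = Real.pi := by
      by_contra h2
      exact hs (Complex.mem_slitPlane_iff_arg.2 ⟨h2, hz⟩)
    have h1 : ContinuousAt (fun w : ℂ => |(-w).arg|) z :=
      ((Complex.continuousAt_arg h0).comp (continuous_neg.continuousAt (x := z))).abs
    have hz1 : |(-z).arg| < 1 := by
      have := arg_neg_add_pi_of_pos (z := z) (by rw [harg]; exact Real.pi_pos)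
      rw [harg] at this
      rw [show (-z).arg = 0 by linarith]
      simp
    filter_upwards [h1.eventually_lt continuousAt_const hz1, eventually_ne_nhds hz] with w hw hw0
    apply d.rim_of_half_lt hw0
    rw [abs_lt] at hw
    have h3 := Real.pi_gt_three
    have h4 := d.η_le
    rcases lt_or_ge 0 w.arg with h5 | h5
    · have := arg_neg_add_pi_of_pos h5
      rw [abs_of_pos h5]
      linarith
    · have := arg_neg_add_pi_of_nonpos hw0 h5
      rw [abs_of_nonpos h5]
      linarith

theorem ne_zero_of_half_lt {z : ℂ} (h : d.η / 2 < |z.arg|) : z.arg ≠ 0 := by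
  intro h0
  rw [h0, abs_zero] at h
  linarith [d.η_pos]

theorem contDiffAt_out_arg {z : ℂ} (hz : z ≠ 0) (h : d.η / 2 < |z.arg|) :
    ContDiffAt ℝ ∞ (fun w : ℂ => d.out ((-w).arg + Real.pi)) z := by
  have h1 := (contDiffAt_arg (neg_mem_slitPlane hz (d.ne_zero_of_half_lt h))).comp z
    (contDiff_neg.contDiffAt (x := z))
  exact d.contDiff_out.contDiffAt.comp z (h1.add contDiffAt_const)

/-- `rim` is smooth on the closed disc, without the centre and the corner. -/
theorem contDiffAt_rim {z : ℂ} (hz : z ≠ 0) (hz1 : ‖z‖ ≤ 1) (hne : z ≠ 1) :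
    ContDiffAt ℝ ∞ d.rim z := by
  by_cases h : |z.arg| < d.η
  · refine ContDiffAt.congr_of_eventuallyEq ?_ (d.rim_eventuallyEq_smoothMin hz h)
    have h1 : ContDiffAt ℝ ∞ (fun w : ℂ => (‖w‖ ^ 2, w.arg)) z :=
      (contDiff_norm_sq ℝ).contDiffAt.prodMk
        (contDiffAt_arg (d.mem_slitPlane_of_abs_arg_lt hz h))
    refine (d.contDiffAt_smoothMin h (pow_le_one₀ (norm_nonneg z) hz1) ?_).comp z h1
    by_contra hcon
    rw [not_or, not_lt, not_ne_iff] at hcon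
    apply hne
    have h2 : ‖z‖ = 1 := by nlinarith [norm_nonneg z]
    rw [← Complex.norm_mul_exp_arg_mul_I z, h2, hcon.2]
    simp
  · exact (d.contDiffAt_out_arg hz (by linarith [d.η_pos])).congr_of_eventuallyEq
      (d.rim_eventuallyEq_out hz (by linarith [d.η_pos]))

theorem continuousAt_rim {z : ℂ} (hz : z ≠ 0) : ContinuousAt d.rim z := by
  by_cases h : |z.arg| < d.η
  · refine ContinuousAt.congr ?_ (d.rim_eventuallyEq_smoothMin hz h).symm
    exact d.continuous_smoothMin.continuousAt.comp (f := fun w : ℂ => (‖w‖ ^ 2, w.arg))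
      ((continuous_norm.pow 2).continuousAt.prodMk
        (Complex.continuousAt_arg (d.mem_slitPlane_of_abs_arg_lt hz h)))
  · exact (d.contDiffAt_out_arg hz (by linarith [d.η_pos])).continuousAt.congr
      (d.rim_eventuallyEq_out hz (by linarith [d.η_pos])).symm

end CapData

theorem uniqueDiffWithinAt_disc {z : ℂ} (hz : z ∈ disc) : UniqueDiffWithinAt ℝ disc z :=
  (uniqueDiffOn_convex (convex_closedBall 0 1)
    ⟨0, by rw [interior_closedBall _ one_ne_zero]; simp⟩) z hz

/-- A map to the sphere of the form `(K z ^ p, 1 - 2 G)`, with real functions `K` and `G`, is an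
orientation-preserving immersion where `G` increases in the radial direction. -/
theorem immersionAt_of_radial {p : ℕ} {f : ℂ → Space} {z e : ℂ} {K G : ℂ → ℝ} (hp : 0 < p)
    (hz : z ∈ disc) (hz0 : z ≠ 0)
    (hf : f =ᶠ[nhds z] fun w => ((K w : ℂ) * (w ^ p * e), 1 - 2 * G w))
    (hK : DifferentiableAt ℝ K z) (hG : DifferentiableAt ℝ G z)
    (hsph : ∀ᶠ w in nhds z, f w ∈ sphere2) (hdG : 0 < fderiv ℝ G z z) : ImmersionAt f z := by
  set u : ℂ := z ^ p * e with hu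
  have hpow := ((hasDerivAt_pow p z).mul_const e).hasFDerivAt
  have h1 : HasFDerivAt (fun w : ℂ => (K w : ℂ)) (Complex.ofRealCLM.comp (fderiv ℝ K z)) z :=
    Complex.ofRealCLM.hasFDerivAt.comp z hK.hasFDerivAt
  have h2 := (h1.mul (hpow.restrictScalars ℝ)).prodMk ((hG.hasFDerivAt.const_mul 2).const_sub 1)
  have h3 := h2.congr_of_eventuallyEq hf
  set L : ℂ →L[ℝ] Space := _ with hL
  change HasFDerivAt f L z at h3
  have hLv : ∀ v, L v = ((fderiv ℝ K z v : ℂ) * u + (K z : ℂ) * (p * z ^ (p - 1) * e * v),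
      - (2 * fderiv ℝ G z v)) := by
    intro v
    rw [hL]
    apply Prod.ext
    · simp [hu]
      ring
    · simp
  have hzp : z ^ (p - 1) * z = z ^ p := by
    rw [← pow_succ, Nat.sub_add_cancel hp]
  have hLz : L z = (((fderiv ℝ K z z + p * K z : ℝ) : ℂ) * u, - (2 * fderiv ℝ G z z)) := by
    rw [hLv]
    apply Prod.ext
    · rw [hu, ← hzp]; push_cast; ring
    · rfl
  have hLiz : L (Complex.I * z) =
      (((fderiv ℝ K z (Complex.I * z) : ℝ) + (p * K z : ℝ) * Complex.I) * u,
        - (2 * fderiv ℝ G z (Complex.I * z))) := by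
    rw [hLv]
    apply Prod.ext
    · rw [hu, ← hzp]; push_cast; ring
    · rfl
  have hfz : f z = ((K z : ℂ) * u, 1 - 2 * G z) := hf.self_of_nhds
  -- the derivative of the equation of the sphere in the radial direction
  have hrel : K z * (fderiv ℝ K z z + p * K z) * (u.re ^ 2 + u.im ^ 2)
      - (1 - 2 * G z) * (2 * fderiv ℝ G z z) = 0 := by
    have h4 := (h3.fst.norm_sq).add ((h3.snd).pow 2)
    have h5 : (fun w => ‖(f w).1‖ ^ 2 + (f w).2 ^ 2) =ᶠ[nhds z] fun _ => (1 : ℝ) := by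
      filter_upwards [hsph] with w hw
      exact hw
    have h6 := h4.unique ((hasFDerivAt_const (1 : ℝ) z).congr_of_eventuallyEq h5)
    have h7 := congrArg (fun M : ℂ →L[ℝ] ℝ => M z) h6
    simp only [add_apply, smul_apply,
      ContinuousLinearMap.comp_apply, hLz, hfz, ContinuousLinearMap.coe_fst',
      ContinuousLinearMap.coe_snd', innerSL_apply_apply, Complex.inner, map_mul,
      Complex.conj_ofReal] at h7
    simp at h7
    linarith
  -- in the basis `(z, i z)` of radial and angular directions
  have hdet : triple (f z) (L z) (L (Complex.I * z)) = 2 * p * fderiv ℝ G z z := by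
    have hs : (K z) ^ 2 * (u.re ^ 2 + u.im ^ 2) + (1 - 2 * G z) ^ 2 = 1 := by
      have : ‖(f z).1‖ ^ 2 + (f z).2 ^ 2 = 1 := hsph.self_of_nhds
      rw [hfz, Complex.sq_norm, Complex.normSq_apply] at this
      simp at this
      linarith
    unfold triple
    rw [hLz, hLiz, hfz, Matrix.det_fin_three]
    simp
    linear_combination 2 * p * fderiv ℝ G z z * hs + p * (1 - 2 * G z) * hrel
  have hlin : triple (f z) (L z) (L (Complex.I * z))
      = (z.re ^ 2 + z.im ^ 2) * triple (f z) (L 1) (L Complex.I) := by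
    have e1 : z = z.re • (1 : ℂ) + z.im • Complex.I := by
      simp [Complex.re_add_im]
    have e2 : Complex.I * z = (-z.im) • (1 : ℂ) + z.re • Complex.I := by
      apply Complex.ext <;> simp
    have e3 : L z = z.re • L 1 + z.im • L Complex.I := by
      conv_lhs => rw [e1]
      rw [map_add, map_smul, map_smul]
    have e4 : L (Complex.I * z) = (-z.im) • L 1 + z.re • L Complex.I := by
      rw [e2, map_add, map_smul, map_smul]
    unfold triple
    rw [e3, e4, Matrix.det_fin_three, Matrix.det_fin_three]
    simp
    ring
  unfold ImmersionAt
  rw [h3.hasFDerivWithinAt.fderivWithin (uniqueDiffWithinAt_disc hz)]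
  have hn : 0 < z.re ^ 2 + z.im ^ 2 := by
    have := Complex.normSq_pos.2 hz0
    rw [Complex.normSq_apply] at this
    nlinarith
  have hpp : (0 : ℝ) < p := by exact_mod_cast hp
  have : 0 < (z.re ^ 2 + z.im ^ 2) * triple (f z) (L 1) (L Complex.I) := by
    rw [← hlin, hdet]
    positivity
  exact pos_of_mul_pos_right this hn.le

namespace CapData

variable {p : ℕ} {g : ℝ → ℝ} {s₀ : ℝ} (d : CapData p g s₀)

theorem ramp_mono : Monotone ramp := fun x y h =>
  Real.smoothTransition.monotone (by linarith)

theorem ramp_nonneg (t : ℝ) : 0 ≤ ramp t := Real.smoothTransition.nonneg _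

theorem ramp_le_one (t : ℝ) : ramp t ≤ 1 := Real.smoothTransition.le_one _

theorem ramp_one : ramp 1 = 1 := Real.smoothTransition.one_of_one_le (by norm_num)

theorem ramp_eq_zero {t : ℝ} (h : t ≤ 1 / 2) : ramp t = 0 :=
  Real.smoothTransition.zero_of_nonpos (by linarith)

theorem contDiff_ramp : ContDiff ℝ ∞ ramp :=
  (Real.smoothTransition.contDiff (n := ⊤)).comp (by fun_prop)

theorem pow_le_rim (z : ℂ) : d.b ^ (2 * p) ≤ d.rim z := d.pow_b_le.trans (d.b_le_rim z)

theorem pow_le_Q (z : ℂ) : d.b ^ (2 * p) ≤ d.Q z := by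
  have := mul_nonneg (ramp_nonneg (‖z‖ ^ 2)) (sub_nonneg.2 (d.pow_le_rim z))
  unfold Q
  linarith

theorem Q_pos (z : ℂ) : 0 < d.Q z := d.pow_b_pos.trans_le (d.pow_le_Q z)

theorem Q_le_rim (z : ℂ) : d.Q z ≤ d.rim z := by
  have := mul_le_mul_of_nonneg_right (ramp_le_one (‖z‖ ^ 2)) (sub_nonneg.2 (d.pow_le_rim z))
  unfold Q
  linarith

theorem Q_of_norm_eq_one {z : ℂ} (hz : ‖z‖ = 1) : d.Q z = d.rim z := by
  rw [Q, hz, one_pow, ramp_one]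
  ring

theorem Q_ray_mono {z : ℂ} {r r' : ℝ} (hr : 0 < r) (h : r ≤ r') : d.Q (r * z) ≤ d.Q (r' * z) := by
  have h1 := d.rim_ray_mono (z := z) hr h
  have h2 : ramp (‖(r : ℂ) * z‖ ^ 2) ≤ ramp (‖(r' : ℂ) * z‖ ^ 2) := by
    apply ramp_mono
    rw [norm_mul, norm_mul, Complex.norm_real, Complex.norm_real, Real.norm_of_nonneg hr.le,
      Real.norm_of_nonneg (hr.le.trans h)]
    gcongr
  unfold Q
  have := mul_le_mul h2 (sub_le_sub_right h1 (d.b ^ (2 * p))) (sub_nonneg.2 (d.pow_le_rim _))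
    (ramp_nonneg _)
  linarith

theorem G_nonneg (z : ℂ) : 0 ≤ d.G z := mul_nonneg (by positivity) (d.Q_pos z).le

theorem G_pos {z : ℂ} (hz : z ≠ 0) : 0 < d.G z :=
  mul_pos (pow_pos (norm_pos_iff.2 hz) _) (d.Q_pos z)

theorem G_le_rim {z : ℂ} (hz : ‖z‖ ≤ 1) : d.G z ≤ d.rim z :=
  (mul_le_of_le_one_left (d.Q_pos z).le (pow_le_one₀ (norm_nonneg z) hz)).trans (d.Q_le_rim z)

theorem G_lt_rim {z : ℂ} (hz : ‖z‖ < 1) : d.G z < d.rim z := by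
  have hp := d.p_pos
  exact (mul_lt_of_lt_one_left (d.Q_pos z) (pow_lt_one₀ (norm_nonneg z) hz (by omega))).trans_le
    (d.Q_le_rim z)

theorem G_lt_one {z : ℂ} (hz : ‖z‖ ≤ 1) : d.G z < 1 := (d.G_le_rim hz).trans_lt (d.rim_lt_one hz)

theorem G_zero : d.G 0 = 0 := by
  have hp := d.p_pos
  rw [G, norm_zero, zero_pow (by omega), zero_mul]

theorem G_ray (z : ℂ) (r : ℝ) : d.G (r * z) = r ^ (2 * p) * (‖z‖ ^ (2 * p) * d.Q (r * z)) := by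
  rw [G, norm_mul, Complex.norm_real, mul_pow, Real.norm_eq_abs, (even_two_mul p).pow_abs,
    mul_assoc]

/-- Along a ray, the cap moves strictly away from the pole. -/
theorem G_ray_strictMono {z : ℂ} (hz : z ≠ 0) {r r' : ℝ} (hr : 0 ≤ r) (h : r < r') :
    d.G (r * z) < d.G (r' * z) := by
  have hp := d.p_pos
  rcases hr.eq_or_lt with rfl | hr
  · rw [Complex.ofReal_zero, zero_mul, d.G_zero]
    exact d.G_pos (mul_ne_zero (by exact_mod_cast h.ne') hz)
  · rw [d.G_ray, d.G_ray]
    have hr' := hr.trans h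
    have h1 := d.Q_ray_mono (z := z) hr h.le
    have h2 := norm_pos_iff.2 hz
    have h3 := d.Q_pos (r * z)
    have h4 : r ^ (2 * p) < r' ^ (2 * p) := pow_lt_pow_left₀ h hr.le (by omega)
    have h5 : 0 < ‖z‖ ^ (2 * p) * d.Q (r * z) := by positivity
    calc r ^ (2 * p) * (‖z‖ ^ (2 * p) * d.Q (r * z))
        < r' ^ (2 * p) * (‖z‖ ^ (2 * p) * d.Q (r * z)) := mul_lt_mul_of_pos_right h4 h5
      _ ≤ _ := by gcongr

theorem Q_eventuallyEq_const {z : ℂ} (hz : ‖z‖ ^ 2 < 1 / 2) :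
    ∀ᶠ w in nhds z, d.Q w = d.b ^ (2 * p) := by
  have h : ContinuousAt (fun w : ℂ => ‖w‖ ^ 2) z := (continuous_norm.pow 2).continuousAt
  filter_upwards [h.eventually_lt continuousAt_const hz] with w hw
  rw [Q, ramp_eq_zero hw.le, zero_mul, add_zero]

theorem contDiffAt_Q {z : ℂ} (hz : ‖z‖ ≤ 1) (hne : z ≠ 1) : ContDiffAt ℝ ∞ d.Q z := by
  by_cases h0 : z = 0
  · subst h0
    exact contDiffAt_const.congr_of_eventuallyEq (d.Q_eventuallyEq_const (by norm_num))
  · exact contDiffAt_const.add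
      ((contDiff_ramp.comp (contDiff_norm_sq ℝ)).contDiffAt.mul
        ((d.contDiffAt_rim h0 hz hne).sub contDiffAt_const))

theorem continuousAt_Q (z : ℂ) : ContinuousAt d.Q z := by
  by_cases h0 : z = 0
  · subst h0
    exact (contDiffAt_const (𝕜 := ℝ) (n := 0)).continuousAt.congr
      (Filter.EventuallyEq.symm (d.Q_eventuallyEq_const (by norm_num)))
  · exact continuousAt_const.add
      ((contDiff_ramp.continuous.comp (continuous_norm.pow 2)).continuousAt.mul
        ((d.continuousAt_rim h0).sub continuousAt_const))

theorem continuous_G : Continuous d.G :=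
  (continuous_norm.pow _).mul (continuous_iff_continuousAt.2 d.continuousAt_Q)

theorem contDiffAt_G {z : ℂ} (hz : ‖z‖ ≤ 1) (hne : z ≠ 1) : ContDiffAt ℝ ∞ d.G z := by
  have h : (fun w : ℂ => ‖w‖ ^ (2 * p)) = fun w : ℂ => (‖w‖ ^ 2) ^ p := by
    ext w; rw [pow_mul]
  have h1 : ContDiff ℝ ∞ fun w : ℂ => ‖w‖ ^ (2 * p) := by
    rw [h]; exact (contDiff_norm_sq ℝ).pow p
  exact h1.contDiffAt.mul (d.contDiffAt_Q hz hne)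

/-- The cap increases in the radial direction. -/
theorem fderiv_G_pos {z : ℂ} (h0 : z ≠ 0) (hz : ‖z‖ ≤ 1) (hne : z ≠ 1) :
    0 < fderiv ℝ d.G z z := by
  have hray : HasDerivAt (fun r : ℝ => (r : ℂ) * z) z 1 := by
    simpa using (Complex.ofRealCLM.hasDerivAt (x := (1 : ℝ))).mul_const z
  have hG := (d.contDiffAt_G hz hne).differentiableAt (by simp)
  have hQ := (d.contDiffAt_Q hz hne).differentiableAt (by simp)
  have h1 : HasDerivAt (fun r : ℝ => d.G (r * z)) (fderiv ℝ d.G z z) 1 :=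
    HasFDerivAt.comp_hasDerivAt_of_eq (1 : ℝ) hG.hasFDerivAt hray (by simp)
  have h2 : HasDerivAt (fun r : ℝ => d.Q (r * z)) (fderiv ℝ d.Q z z) 1 :=
    HasFDerivAt.comp_hasDerivAt_of_eq (1 : ℝ) hQ.hasFDerivAt hray (by simp)
  have h3 : 0 ≤ fderiv ℝ d.Q z z := by
    have hmono : MonotoneOn (fun r : ℝ => d.Q (r * z)) (Set.Icc (1 / 2) 1) :=
      fun r hr r' _ h => d.Q_ray_mono (by linarith [hr.1]) h
    have := hmono.derivWithin_nonneg (x := 1)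
    rwa [h2.hasDerivWithinAt.derivWithin (uniqueDiffOn_Icc (by norm_num) 1 (by norm_num))] at this
  have h4 := (hasDerivAt_pow (2 * p) (1 : ℝ)).mul (h2.const_mul (‖z‖ ^ (2 * p)))
  have h5 : (fun r : ℝ => d.G (r * z)) =
      (fun r : ℝ => r ^ (2 * p)) * fun r : ℝ => ‖z‖ ^ (2 * p) * d.Q (r * z) := by
    ext r; exact d.G_ray z r
  rw [h5] at h1
  rw [h1.unique h4]
  have hp : (0 : ℝ) < p := by exact_mod_cast d.p_pos
  have hn := norm_pos_iff.2 h0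
  have hQp := d.Q_pos z
  simp only [one_pow, mul_one, Complex.ofReal_one, one_mul]
  push_cast
  positivity

/-- The cap in polar coordinates of the disc and cylindrical coordinates of the sphere. -/
theorem cap_polar {r : ℝ} (hr : 0 ≤ r) (θ : ℝ) :
    d.cap (r * (Circle.exp θ : ℂ)) =
      spherePoint (s₀ + p * θ / (2 * Real.pi)) (d.G (r * (Circle.exp θ : ℂ))) := by
  set z : ℂ := r * (Circle.exp θ : ℂ) with hz
  have hn : ‖z‖ = r := by rw [hz, norm_mul, Circle.norm_coe, mul_one, Complex.norm_of_nonneg hr]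
  apply Prod.ext
  · simp only [cap, spherePoint]
    have h1 : √(d.G z * (1 - d.G z)) = r ^ p * √(d.Q z * (1 - d.G z)) := by
      rw [← Real.sqrt_sq (pow_nonneg hr p), ← Real.sqrt_mul (by positivity)]
      congr 1
      have h3 : ∀ x, d.G z * x = (r ^ p) ^ 2 * (d.Q z * x) := by
        intro x
        rw [G, hn]
        ring
      exact h3 _
    have h2 : (Circle.exp (2 * Real.pi * (s₀ + p * θ / (2 * Real.pi))) : ℂ)
        = (Circle.exp θ : ℂ) ^ p * (Circle.exp (2 * Real.pi * s₀) : ℂ) := by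
      rw [Circle.coe_exp, Circle.coe_exp, Circle.coe_exp, ← Complex.exp_nat_mul, ← Complex.exp_add]
      congr 1
      have : (Real.pi : ℂ) ≠ 0 := by exact_mod_cast Real.pi_ne_zero
      push_cast
      field_simp
      ring
    rw [h1, h2, hz, mul_pow]
    push_cast
    ring
  · rfl

theorem exists_polar (z : ℂ) : z = (‖z‖ : ℂ) * (Circle.exp z.arg : ℂ) := by
  rw [Circle.coe_exp, Complex.norm_mul_exp_arg_mul_I]

theorem cap_eq_spherePoint (z : ℂ) :
    d.cap z = spherePoint (s₀ + p * z.arg / (2 * Real.pi)) (d.G z) := by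
  have := d.cap_polar (norm_nonneg z) z.arg
  rwa [← exists_polar] at this

theorem cap_mem_sphere {z : ℂ} (hz : ‖z‖ ≤ 1) : d.cap z ∈ sphere2 := by
  rw [d.cap_eq_spherePoint]
  exact spherePoint_mem (d.G_nonneg z) (d.G_lt_one hz).le

theorem continuous_cap : Continuous d.cap := by
  have hQ : Continuous d.Q := continuous_iff_continuousAt.2 d.continuousAt_Q
  have hG := d.continuous_G
  unfold cap
  fun_prop

theorem contDiffAt_factor {z : ℂ} (hz : ‖z‖ ≤ 1) (hne : z ≠ 1) :
    ContDiffAt ℝ ∞ (fun w => 2 * √(d.Q w * (1 - d.G w))) z := by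
  refine contDiffAt_const.mul (ContDiffAt.sqrt ?_ ?_)
  · exact (d.contDiffAt_Q hz hne).mul (contDiffAt_const.sub (d.contDiffAt_G hz hne))
  · exact (mul_pos (d.Q_pos z) (sub_pos.2 (d.G_lt_one hz))).ne'

theorem contDiffAt_cap {z : ℂ} (hz : ‖z‖ ≤ 1) (hne : z ≠ 1) : ContDiffAt ℝ ∞ d.cap z := by
  have h1 : ContDiffAt ℝ ∞ (fun w : ℂ => w ^ p * (Circle.exp (2 * Real.pi * s₀) : ℂ)) z := by
    fun_prop
  exact ((Complex.ofRealCLM.contDiff.contDiffAt.comp z (d.contDiffAt_factor hz hne)).mul h1).prodMk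
    (contDiffAt_const.sub (contDiffAt_const.mul (d.contDiffAt_G hz hne)))

theorem immersionAt_cap {z : ℂ} (hz : ‖z‖ ≤ 1) (hne : z ≠ 1) (h0 : z ≠ 0) :
    ImmersionAt d.cap z := by
  refine immersionAt_of_radial (K := fun w => 2 * √(d.Q w * (1 - d.G w))) (G := d.G)
    (e := (Circle.exp (2 * Real.pi * s₀) : ℂ)) d.p_pos (by simpa [disc] using hz) h0
    (Filter.Eventually.of_forall fun w => rfl)
    ((d.contDiffAt_factor hz hne).differentiableAt (by simp))
    ((d.contDiffAt_G hz hne).differentiableAt (by simp)) ?_ (d.fderiv_G_pos h0 hz hne)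
  filter_upwards [d.continuous_G.continuousAt.eventually_lt continuousAt_const (d.G_lt_one hz)]
    with w hw
  rw [d.cap_eq_spherePoint]
  exact spherePoint_mem (d.G_nonneg w) hw.le

theorem cap_zero : d.cap 0 = northPole := by
  rw [d.cap_eq_spherePoint, d.G_zero, spherePoint_zero]

theorem branchedAt_cap : BranchedAt p d.cap 0 := by
  set e : ℂ := (Circle.exp (2 * Real.pi * s₀) : ℂ) with he
  have hen : ‖e‖ = 1 := Circle.norm_coe _
  set K : ℂ → ℝ := fun w => 2 * √(1 - ‖w‖ ^ 2) with hK
  have hKs : ContDiffAt ℝ ∞ K 0 :=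
    contDiffAt_const.mul ((contDiffAt_const.sub (contDiff_norm_sq ℝ).contDiffAt).sqrt (by simp))
  have hsnd : ContDiff ℝ ∞ fun w : ℂ => 1 - 2 * ‖w‖ ^ 2 :=
    contDiff_const.sub (contDiff_const.mul (contDiff_norm_sq ℝ))
  -- Where `Q` is the constant `b ^ (2 * p)`, the coordinate `w` of the cap is `‖(b z) ^ p‖ ^ 2`.
  refine ⟨fun w => d.b • w, fun w => ((K w : ℂ) * (w * e), 1 - 2 * ‖w‖ ^ 2), by simp, by fun_prop,
    ?_, ?_, ?_, ?_, ?_⟩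
  · have h1 : fderiv ℝ (fun w : ℂ => d.b • w) 0 = d.b • ContinuousLinearMap.id ℝ ℂ :=
      ((hasFDerivAt_id (𝕜 := ℝ) (0 : ℂ)).const_smul d.b).fderiv
    rw [h1]
    have h2 : (d.b • ContinuousLinearMap.id ℝ ℂ).det = d.b ^ 2 := by
      unfold ContinuousLinearMap.det
      rw [ContinuousLinearMap.toLinearMap_smul, LinearMap.det_smul, Complex.finrank_real_complex]
      simp
    rw [h2]
    have := d.b_pos
    positivity
  · have h : ContinuousAt (fun w : ℂ => ‖w‖ ^ 2) 0 := (continuous_norm.pow 2).continuousAt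
    filter_upwards [h.eventually_lt (g := fun _ => (1 : ℝ)) continuousAt_const (by simp)] with w hw
    change ‖(K w : ℂ) * (w * e)‖ ^ 2 + (1 - 2 * ‖w‖ ^ 2) ^ 2 = 1
    rw [norm_mul, norm_mul, hen, mul_one, Complex.norm_real, mul_pow, Real.norm_eq_abs, sq_abs, hK]
    simp only
    rw [mul_pow, Real.sq_sqrt (by linarith)]
    ring
  · exact ((Complex.ofRealCLM.contDiff.contDiffAt.comp 0 hKs).mul (by fun_prop)).prodMk
      hsnd.contDiffAt
  · have h1 : HasFDerivAt (fun w : ℂ => (K w : ℂ)) (Complex.ofRealCLM.comp (fderiv ℝ K 0)) 0 :=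
      Complex.ofRealCLM.hasFDerivAt.comp 0 (hKs.differentiableAt (by simp)).hasFDerivAt
    have h2 := (h1.mul ((hasFDerivAt_id (𝕜 := ℝ) (0 : ℂ)).mul_const e)).prodMk
      (((hasFDerivAt_id (𝕜 := ℝ) (0 : ℂ)).norm_sq.const_mul 2).const_sub 1)
    have h3 : fderiv ℝ (fun w : ℂ => (((K w : ℂ) * (w * e), 1 - 2 * ‖w‖ ^ 2) : Space)) 0 = _ :=
      h2.fderiv
    rw [h3]
    have hK0 : K 0 = 2 := by simp [hK]
    have hnn : e.re * e.re + e.im * e.im = 1 := by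
      have := Complex.normSq_eq_norm_sq e
      rw [hen, Complex.normSq_apply] at this
      linarith
    unfold triple
    rw [Matrix.det_fin_three]
    simp [hK0]
    nlinarith
  · filter_upwards [d.Q_eventuallyEq_const (z := 0) (by norm_num)] with w hw
    have hb := d.b_pos
    have h1 : ‖(d.b • w) ^ p‖ ^ 2 = ‖w‖ ^ (2 * p) * d.b ^ (2 * p) := by
      rw [norm_pow, norm_smul, Real.norm_of_nonneg hb.le]
      ring
    apply Prod.ext
    · simp only [cap, hK]
      rw [← he, h1, G, hw, Real.sqrt_mul (by positivity),
        show d.b ^ (2 * p) = (d.b ^ p) ^ 2 by ring, Real.sqrt_sq (by positivity), Complex.real_smul]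
      push_cast
      ring
    · simp only [cap]
      rw [h1, G, hw]

theorem G_circle {θ : ℝ} (h0 : 0 ≤ θ) (h1 : θ ≤ 2 * Real.pi) :
    d.G (Circle.exp θ : ℂ) = d.out θ := by
  have hn : ‖(Circle.exp θ : ℂ)‖ = 1 := Circle.norm_coe _
  have hpi := Real.pi_pos
  rw [G, hn, one_pow, one_mul, d.Q_of_norm_eq_one hn, d.rim_of_norm_eq_one hn]
  rcases le_or_gt θ Real.pi with h2 | h2
  · rw [Circle.arg_exp (by linarith) h2, if_pos h0]
  · have h3 : (Circle.exp θ : ℂ) = (Circle.exp (θ - 2 * Real.pi) : ℂ) := by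
      rw [Circle.exp_sub_two_pi]
    rw [h3, Circle.arg_exp (by linarith) (by linarith)]
    have h4 : d.inc (θ - 2 * Real.pi) = d.out θ := by rw [d.inc_eq]; congr 1; ring
    rw [h4]
    split_ifs with h5
    · have h6 : θ = 2 * Real.pi := by linarith
      rw [h6, sub_self, d.out_zero_eq, d.inc_eq, zero_add]
    · rfl

/-- The boundary circle of the cap is the arc `w = g s`, `s₀ ≤ s ≤ s₀ + p`. -/
theorem cap_boundary {τ : ℝ} (h0 : 0 ≤ τ) (h1 : τ ≤ 1) :
    d.cap (Circle.exp (2 * Real.pi * τ) : ℂ) = spherePoint (s₀ + p * τ) (g (s₀ + p * τ)) := by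
  have hpi := Real.pi_pos
  have h := d.cap_polar zero_le_one (2 * Real.pi * τ)
  rw [Complex.ofReal_one, one_mul, d.G_circle (by positivity) (by nlinarith)] at h
  have h2 : s₀ + p * (2 * Real.pi * τ) / (2 * Real.pi) = s₀ + p * τ := by field_simp
  rwa [out, h2] at h

theorem G_circle_eq_min {θ : ℝ} (h : |θ| < d.η) :
    d.G (Circle.exp θ : ℂ) = min (d.out θ) (d.inc θ) := by
  have hn : ‖(Circle.exp θ : ℂ)‖ = 1 := Circle.norm_coe _
  have h1 := abs_lt.1 h
  have h2 := d.η_le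
  have h3 := Real.pi_gt_three
  have harg : (Circle.exp θ : ℂ).arg = θ := Circle.arg_exp (by linarith) (by linarith)
  rw [G, hn, one_pow, one_mul, d.Q_of_norm_eq_one hn, d.rim_of_lt (by rwa [harg]), hn, harg,
    d.smoothMin_eq_min (by ring)]

/-- At the corner the cap lies in the quadrant below both strands in the coordinate `w`. -/
theorem cap_corner : ∀ᶠ z in nhdsWithin (1 : ℂ) (Metric.ball 0 1),
    ∃ r ∈ Set.Ioo (-1 / 2 : ℝ) (1 / 2), ∃ y ∈ Set.Ioo (0 : ℝ) 1,
      d.cap z = spherePoint (s₀ + r) y ∧ y < g (s₀ + r) ∧ y < g (s₀ + p + r) := by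
  have harg : ContinuousAt Complex.arg 1 := Complex.continuousAt_arg (by simp)
  have h1 : ∀ᶠ z in nhds (1 : ℂ), |z.arg| < d.η :=
    harg.abs.eventually_lt continuousAt_const (by simpa using d.η_pos)
  have h2 : ∀ᶠ z in nhds (1 : ℂ), |p * z.arg / (2 * Real.pi)| < 1 / 2 :=
    ((continuousAt_const.mul harg).div_const _).abs.eventually_lt continuousAt_const (by simp)
  filter_upwards [self_mem_nhdsWithin, nhdsWithin_le_nhds h1, nhdsWithin_le_nhds h2,
    nhdsWithin_le_nhds (eventually_ne_nhds (one_ne_zero (α := ℂ)))] with z hz hz1 hz2 hz0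
  rw [mem_ball_zero_iff] at hz
  have h3 := (d.G_lt_rim hz).trans_le ((d.rim_of_lt hz1).le.trans
    (d.smoothMin_le_min (pow_le_one₀ (norm_nonneg z) hz.le)))
  rw [lt_min_iff] at h3
  rw [abs_lt] at hz2
  exact ⟨_, ⟨by linarith, hz2.2⟩, d.G z, ⟨d.G_pos hz0, d.G_lt_one hz.le⟩, d.cap_eq_spherePoint z,
    h3.1, h3.2⟩

/-- The cap covers a neighbourhood of the corner in the quadrant below both strands. -/
theorem cap_fills {U : Set ℂ} (hU : U ∈ nhds (1 : ℂ)) : ∀ᶠ c : ℝ × ℝ in nhds (0, g s₀),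
    c.2 < g (s₀ + c.1) → c.2 < g (s₀ + p + c.1) →
      spherePoint (s₀ + c.1) c.2 ∈ d.cap '' (U ∩ Metric.ball 0 1) := by
  have hp : (0 : ℝ) < p := by exact_mod_cast d.p_pos
  have hpi := Real.pi_pos
  have hcont : Continuous fun x : ℝ × ℝ =>
      (x.1 : ℂ) * (Circle.exp (2 * Real.pi * x.2 / p) : ℂ) := by fun_prop
  have hU' : ∀ᶠ x in nhds ((1 : ℝ), (0 : ℝ)),
      (x.1 : ℂ) * (Circle.exp (2 * Real.pi * x.2 / p) : ℂ) ∈ U := by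
    apply hcont.continuousAt.eventually_mem
    simpa using hU
  rw [nhds_prod_eq] at hU'
  obtain ⟨pa, hpa, pb, hpb, hab⟩ := Filter.eventually_prod_iff.1 hU'
  obtain ⟨ε, hε, hball⟩ := Metric.eventually_nhds_iff.1 hpa
  obtain ⟨ρ, hρ0, hρ1⟩ : ∃ ρ : ℝ, max 0 (1 - ε) < ρ ∧ ρ < 1 :=
    exists_between (max_lt one_pos (by linarith))
  rw [max_lt_iff] at hρ0
  have hGρ : d.G (ρ * (Circle.exp (2 * Real.pi * 0 / p) : ℂ)) < g s₀ := by
    have h1 := d.G_ray_strictMono (z := 1) one_ne_zero hρ0.1.le hρ1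
    have h2 := d.G_circle le_rfl (by positivity : (0 : ℝ) ≤ 2 * Real.pi)
    simp [out] at h1 h2
    simpa [h2] using h1
  have hc1 : Continuous fun c : ℝ × ℝ => d.G (ρ * (Circle.exp (2 * Real.pi * c.1 / p) : ℂ)) :=
    d.continuous_G.comp (by fun_prop)
  have e1 : ∀ᶠ c : ℝ × ℝ in nhds (0, g s₀),
      d.G (ρ * (Circle.exp (2 * Real.pi * c.1 / p) : ℂ)) < c.2 :=
    hc1.continuousAt.eventually_lt continuousAt_snd hGρ
  have e2 : ∀ᶠ c : ℝ × ℝ in nhds (0, g s₀), |2 * Real.pi * c.1 / p| < d.η :=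
    (by fun_prop : Continuous fun c : ℝ × ℝ => |2 * Real.pi * c.1 / p|).continuousAt.eventually_lt
      continuousAt_const (by simpa using d.η_pos)
  have e3 : ∀ᶠ c : ℝ × ℝ in nhds (0, g s₀), pb c.1 := by
    rw [nhds_prod_eq]; exact hpb.prod_inl _
  filter_upwards [e1, e2, e3] with c h1 h2 h3 h4 h5
  have hθ : p * (2 * Real.pi * c.1 / p) / (2 * Real.pi) = c.1 := by field_simp
  have hone : c.2 < d.G ((1 : ℝ) * (Circle.exp (2 * Real.pi * c.1 / p) : ℂ)) := by
    rw [Complex.ofReal_one, one_mul, d.G_circle_eq_min h2, out, inc, hθ]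
    exact lt_min h4 h5
  have hcr : Continuous fun r : ℝ => d.G (r * (Circle.exp (2 * Real.pi * c.1 / p) : ℂ)) :=
    d.continuous_G.comp (by fun_prop)
  obtain ⟨r, hr, hGr⟩ := intermediate_value_Ioo hρ1.le hcr.continuousOn ⟨h1, hone⟩
  have hr0 : 0 < r := hρ0.1.trans hr.1
  refine ⟨r * (Circle.exp (2 * Real.pi * c.1 / p) : ℂ), ⟨?_, ?_⟩, ?_⟩
  · refine hab (hball ?_) h3
    rw [Real.dist_eq, abs_lt]
    constructor <;> linarith [hr.1, hr.2]
  · rw [mem_ball_zero_iff, norm_mul, Circle.norm_coe, mul_one, Complex.norm_of_nonneg hr0.le]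
    exact hr.2
  · rw [d.cap_polar hr0.le, hθ]
    exact congrArg _ hGr

/-- The number of preimages of a point under the cap. -/
theorem ncard_cap_preimage {s y : ℝ} (hs : s ∈ Set.Icc s₀ (s₀ + 1)) (hy : y ∈ Set.Ioo (0 : ℝ) 1)
    (hne : ∀ n < p, y ≠ g (s + n)) :
    {z ∈ disc | d.cap z = spherePoint s y}.ncard
      = ((Finset.range p).filter fun n : ℕ => y < g (s + n)).card := by
  have hp : (0 : ℝ) < p := by exact_mod_cast d.p_pos
  have hpi := Real.pi_pos
  -- The preimages are on the `p` rays over the meridian, at most one on each of them, since the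
  -- distance from the pole increases along a ray from `0` to `g (s + n)`.
  set e : ℕ → ℂ := fun n => (Circle.exp (2 * Real.pi * (s + n - s₀) / p) : ℂ) with he
  have he0 : ∀ n, e n ≠ 0 := fun n => Circle.coe_ne_zero _
  have haz : ∀ n : ℕ, s₀ + p * (2 * Real.pi * (s + n - s₀) / p) / (2 * Real.pi) = s + n := by
    intro n; field_simp; ring
  have hrim : ∀ n < p, d.G (e n) = g (s + n) := by
    intro n hn
    have hn' : (n : ℝ) + 1 ≤ p := by exact_mod_cast hn
    have hn0 : (0 : ℝ) ≤ n := by positivity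
    rw [he]
    simp only
    rw [d.G_circle, out, haz]
    · apply div_nonneg _ hp.le
      have : 0 ≤ s + n - s₀ := by linarith [hs.1]
      positivity
    · rw [div_le_iff₀ hp]
      have : s + n - s₀ ≤ p := by linarith [hs.2]
      nlinarith
  have hex : ∀ n : ℕ, ∃ r : ℝ, n < p → y < g (s + n) → 0 < r ∧ r < 1 ∧ d.G (r * e n) = y := by
    intro n
    by_cases h : n < p ∧ y < g (s + n)
    · have hcr : Continuous fun r : ℝ => d.G (r * e n) := d.continuous_G.comp (by fun_prop)
      have hm : y ∈ Set.Ioo (d.G ((0 : ℝ) * e n)) (d.G ((1 : ℝ) * e n)) := by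
        rw [Complex.ofReal_one, one_mul, hrim n h.1, Complex.ofReal_zero, zero_mul, d.G_zero]
        exact ⟨hy.1, h.2⟩
      obtain ⟨r, hr, hG⟩ := intermediate_value_Ioo zero_le_one hcr.continuousOn hm
      exact ⟨r, fun _ _ => ⟨hr.1, hr.2, hG⟩⟩
    · exact ⟨0, fun h1 h2 => absurd ⟨h1, h2⟩ h⟩
  choose r hr using hex
  have hset : {z ∈ disc | d.cap z = spherePoint s y} =
      (fun n : ℕ => (r n : ℂ) * e n) '' ({n ∈ Finset.range p | y < g (s + n)} : Finset ℕ) := by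
    ext z
    simp only [Set.mem_image, Finset.coe_filter, Finset.mem_range, Set.mem_ofPred_eq]
    constructor
    · rintro ⟨hz, hcap⟩
      have hz1 : ‖z‖ ≤ 1 := by simpa [disc] using hz
      rw [d.cap_eq_spherePoint] at hcap
      obtain ⟨hG, k, hk⟩ := spherePoint_inj
        ⟨by rw [spherePoint_height hcap]; exact hy.1, d.G_lt_one hz1⟩ hcap
      have hz0 : z ≠ 0 := by
        rintro rfl
        rw [d.G_zero] at hG
        exact hy.1.ne hG
      have hmod : 0 ≤ k % p := Int.emod_nonneg _ (by exact_mod_cast d.p_pos.ne')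
      obtain ⟨n, hn⟩ := Int.eq_ofNat_of_zero_le hmod
      have hnp : n < p := by
        have := Int.emod_lt_of_pos k (by exact_mod_cast d.p_pos : (0 : ℤ) < p)
        rw [hn] at this
        exact_mod_cast this
      have hkn : (k : ℝ) = n + p * ((k / p : ℤ) : ℝ) := by
        have h := Int.emod_add_mul_ediv k p
        rw [hn] at h
        exact_mod_cast h.symm
      have harg : (Circle.exp z.arg : ℂ) = e n := by
        refine congrArg Subtype.val (?_ : Circle.exp z.arg = Circle.exp _)
        rw [Circle.exp_eq_exp]
        refine ⟨k / p, ?_⟩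
        rw [hkn] at hk
        field_simp at hk ⊢
        linear_combination hk
      have hzn : z = (‖z‖ : ℂ) * e n := by rw [← harg]; exact exists_polar z
      have hylt : y < g (s + n) := by
        refine lt_of_le_of_ne ?_ (hne n hnp)
        rw [← hG, ← hrim n hnp]
        rcases hz1.eq_or_lt with h1 | h1
        · rw [h1, Complex.ofReal_one, one_mul] at hzn
          rw [hzn]
        · have := d.G_ray_strictMono (he0 n) (norm_nonneg z) h1
          rw [← hzn, Complex.ofReal_one, one_mul] at this
          exact this.le
      refine ⟨n, ⟨hnp, hylt⟩, ?_⟩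
      obtain ⟨h1, h2, h3⟩ := hr n hnp hylt
      have : r n = ‖z‖ := by
        rw [← hG, hzn] at h3
        rcases lt_trichotomy (r n) ‖z‖ with h | h | h
        · exact absurd h3 (d.G_ray_strictMono (he0 n) h1.le h).ne
        · exact h
        · exact absurd h3 (d.G_ray_strictMono (he0 n) (norm_nonneg z) h).ne'
      rw [this, ← hzn]
    · rintro ⟨n, ⟨hn, hyn⟩, rfl⟩
      obtain ⟨h1, h2, h3⟩ := hr n hn hyn
      refine ⟨?_, ?_⟩
      · simp only [disc, Metric.mem_closedBall, dist_zero_right, norm_mul, he, Circle.norm_coe,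
          mul_one, Complex.norm_real]
        rw [Real.norm_of_nonneg h1.le]
        exact h2.le
      · rw [he] at h3 ⊢
        simp only at h3 ⊢
        rw [d.cap_polar h1.le, h3, haz, spherePoint_add_nat]
  rw [hset, Set.InjOn.ncard_image, Set.ncard_coe_finset]
  intro n hn m hm hnm
  simp only [Finset.coe_filter, Finset.mem_range, Set.mem_ofPred_eq] at hn hm hnm
  obtain ⟨h1, -, -⟩ := hr n hn.1 hn.2
  obtain ⟨h2, -, -⟩ := hr m hm.1 hm.2
  have hrr : r n = r m := by
    have hen : ∀ n, ‖e n‖ = 1 := fun n => Circle.norm_coe _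
    have := congrArg norm hnm
    rwa [norm_mul, norm_mul, hen, hen, Complex.norm_of_nonneg h1.le, Complex.norm_of_nonneg h2.le,
      mul_one, mul_one] at this
  rw [hrr] at hnm
  have hee := mul_left_cancel₀ (by exact_mod_cast h2.ne') hnm
  have hee' : Circle.exp (2 * Real.pi * (s + n - s₀) / p)
      = Circle.exp (2 * Real.pi * (s + m - s₀) / p) := Subtype.ext hee
  rw [Circle.exp_eq_exp] at hee'
  obtain ⟨k, hk⟩ := hee'
  field_simp at hk
  have hk1 : (n : ℝ) = m + k * p := by linarith
  have hk2 : (n : ℤ) = m + k * p := by exact_mod_cast hk1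
  have hk0 : k = 0 := by
    have h3 : (n : ℤ) < p := by exact_mod_cast hn.1
    have h4 : (m : ℤ) < p := by exact_mod_cast hm.1
    have h5 : (0 : ℤ) ≤ m := by positivity
    have h6 : (0 : ℤ) ≤ n := by positivity
    by_contra hk0
    rcases lt_or_gt_of_ne hk0 with h | h
    · nlinarith
    · nlinarith
  rw [hk0] at hk2
  simpa using hk2

/-- The two strands are transverse at the corner, and then the derivatives determine their order
nearby. -/
theorem nonempty_of_deriv_lt {p : ℕ} {g : ℝ → ℝ} {s₀ : ℝ} (hp : 0 < p) (smooth : ContDiff ℝ ∞ g)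
    (closed : g (s₀ + p) = g s₀) (lt_one : ∀ s, g s < 1) (hder : deriv g s₀ < deriv g (s₀ + p))
    (hlow : ∃ c > 0, ∀ s, c ≤ g s) : Nonempty (CapData p g s₀) := by
  have hpp : (0 : ℝ) < p := by exact_mod_cast hp
  have hpi := Real.pi_pos
  have hdiff : ∀ s, HasDerivAt g (deriv g s) s := fun s =>
    (smooth.differentiable (by simp) s).hasDerivAt
  set u : ℝ → ℝ := fun θ => g (s₀ + p + p * θ / (2 * Real.pi)) - g (s₀ + p * θ / (2 * Real.pi))
    with hu
  have hlin : ∀ c : ℝ,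
      HasDerivAt (fun θ : ℝ => c + p * θ / (2 * Real.pi)) (p / (2 * Real.pi)) 0 := by
    intro c
    simpa using (((hasDerivAt_id (0 : ℝ)).const_mul (p : ℝ)).div_const (2 * Real.pi)).const_add c
  have hud : HasDerivAt u
      (deriv g (s₀ + p) * (p / (2 * Real.pi)) - deriv g s₀ * (p / (2 * Real.pi))) 0 :=
    (HasDerivAt.comp_of_eq (0 : ℝ) (hdiff (s₀ + p)) (hlin (s₀ + p)) (by simp)).sub
      (HasDerivAt.comp_of_eq (0 : ℝ) (hdiff s₀) (hlin s₀) (by simp))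
  have hpos : 0 < deriv u 0 := by
    rw [hud.deriv, ← sub_mul]
    have := sub_pos.2 hder
    positivity
  have hu0 : u 0 = 0 := by simp [hu, closed]
  obtain ⟨ε, hε, hsign⟩ := Metric.eventually_nhds_iff.1
    (eventually_nhdsWithin_sign_eq_of_deriv_pos hpos hu0)
  obtain ⟨c, hc, hcg⟩ := hlow
  refine ⟨⟨min ε 1, c / 2, hp, smooth, closed, lt_one, lt_min hε one_pos, min_le_right _ _, ?_, ?_,
    by positivity, fun s => by linarith [hcg s]⟩⟩
  · intro θ hθ
    have h1 : |θ| < ε := by rw [abs_of_pos hθ.1]; exact hθ.2.trans_le (min_le_left _ _)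
    have h2 := hsign (y := θ) (by simpa using h1)
    rw [sub_zero, sign_pos hθ.1, sign_eq_one_iff] at h2
    exact sub_pos.1 h2
  · intro θ hθ
    have h1 : |θ| < ε := by
      rw [abs_of_neg hθ.2]
      linarith [hθ.1, min_le_left ε 1]
    have h2 := hsign (y := θ) (by simpa using h1)
    rw [sub_zero, sign_neg hθ.2, sign_eq_neg_one_iff] at h2
    exact sub_neg.1 h2

end CapData

/-! ### Rotation of the sphere that exchanges the poles -/

/-- The rotation of the sphere by `π` around a horizontal axis. -/
def flip : Space ≃L[ℝ] Space := Complex.conjCLE.prodCongr (ContinuousLinearEquiv.neg ℝ)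

theorem flip_apply (P : Space) : flip P = ((starRingEnd ℂ) P.1, -P.2) := rfl

theorem flip_flip (P : Space) : flip (flip P) = P := by
  rw [flip_apply, flip_apply]
  simp

theorem flip_spherePoint (s w : ℝ) : flip (spherePoint s w) = spherePoint (-s) (1 - w) := by
  rw [flip_apply]
  apply Prod.ext
  · simp only [spherePoint]
    rw [map_mul, Complex.conj_ofReal, ← Circle.coe_inv_eq_conj, ← Circle.exp_neg,
      show (1 - w) * (1 - (1 - w)) = w * (1 - w) by ring,
      show 2 * Real.pi * -s = -(2 * Real.pi * s) by ring]
  · simp only [spherePoint]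
    ring

theorem flip_mem_sphere {P : Space} (h : P ∈ sphere2) : flip P ∈ sphere2 := by
  have h' : ‖P.1‖ ^ 2 + P.2 ^ 2 = 1 := h
  change ‖(flip P).1‖ ^ 2 + (flip P).2 ^ 2 = 1
  rw [flip_apply]
  simpa using h'

theorem flip_northPole : flip northPole = southPole := by
  rw [flip_apply]; simp [northPole, southPole]

theorem triple_flip (a b c : Space) : triple (flip a) (flip b) (flip c) = triple a b c := by
  unfold triple
  rw [Matrix.det_fin_three, Matrix.det_fin_three]
  simp [flip_apply]

theorem ImmersionAt.flip {f : ℂ → Space} {z : ℂ} (hz : z ∈ disc) (h : ImmersionAt f z) :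
    ImmersionAt (LensKnot.flip ∘ f) z := by
  unfold ImmersionAt at h ⊢
  rw [LensKnot.flip.comp_fderivWithin (uniqueDiffWithinAt_disc hz)]
  simpa [triple_flip] using h

theorem BranchedAt.flip {p : ℕ} {f : ℂ → Space} {z : ℂ} (h : BranchedAt p f z) :
    BranchedAt p (LensKnot.flip ∘ f) z := by
  obtain ⟨α, β, h1, h2, h3, h4, h5, h6, h7⟩ := h
  refine ⟨α, LensKnot.flip ∘ β, h1, h2, h3, ?_, LensKnot.flip.contDiff.contDiffAt.comp 0 h5, ?_, ?_⟩
  · filter_upwards [h4] with w hw using flip_mem_sphere hw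
  · rw [LensKnot.flip.comp_fderiv]
    simpa [triple_flip] using h6
  · filter_upwards [h7] with w hw
    simp [hw]

/-- A disc in the sphere with one marked point `1`, branched of order `p` over a pole and
otherwise immersed. -/
structure IsCapDisc (p : ℕ) (f : ℂ → Space) (pole : Space) : Prop where
  continuous : Continuous f
  maps_sphere : ∀ z ∈ disc, f z ∈ sphere2
  smooth : ∀ z ∈ disc, z ≠ 1 → ContDiffAt ℝ ∞ f z
  immersion : ∀ z ∈ disc, z ≠ 1 → z ≠ 0 → ImmersionAt f z
  zero : f 0 = pole
  branched : BranchedAt p f 0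

theorem CapData.isCapDisc {p : ℕ} {g : ℝ → ℝ} {s₀ : ℝ} (d : CapData p g s₀) :
    IsCapDisc p d.cap northPole where
  continuous := d.continuous_cap
  maps_sphere z hz := d.cap_mem_sphere (by simpa [disc] using hz)
  smooth z hz h1 := d.contDiffAt_cap (by simpa [disc] using hz) h1
  immersion z hz h1 h0 := d.immersionAt_cap (by simpa [disc] using hz) h1 h0
  zero := d.cap_zero
  branched := d.branchedAt_cap

theorem IsCapDisc.flip {p : ℕ} {f : ℂ → Space} {pole : Space} (h : IsCapDisc p f pole) :
    IsCapDisc p (LensKnot.flip ∘ f) (LensKnot.flip pole) where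
  continuous := LensKnot.flip.continuous.comp h.continuous
  maps_sphere z hz := flip_mem_sphere (h.maps_sphere z hz)
  smooth z hz h1 := LensKnot.flip.contDiff.contDiffAt.comp z (h.smooth z hz h1)
  immersion z hz h1 h0 := (h.immersion z hz h1 h0).flip hz
  zero := congrArg _ h.zero
  branched := h.branched.flip

namespace SpecialFront

/-! ### The shape of a special front -/

variable {p q h v : ℕ} (F : SpecialFront p q h v)

theorem deriv_X_eq (s : ℝ) : deriv F.X s = 1 + deriv F.Y s := by
  have h1 : F.X = fun s => s + F.Y s := by
    ext s
    linarith [F.param s]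
  have hY : DifferentiableAt ℝ F.Y s := F.smooth_Y.differentiable (by simp) s
  rw [h1]
  exact ((hasDerivAt_id s).add hY.hasDerivAt).deriv

/-- In the parameterization by `X - Y`, the Legendrian condition reads `r₁² = -Y'`. -/
theorem rSq_eq (s : ℝ) : F.rSq s = -deriv F.Y s := by
  have h1 := F.deriv_X_pos s
  have h2 := F.deriv_X_eq s
  have h3 : 1 - F.slope s = 1 / deriv F.X s := by
    rw [slope]
    field_simp
    linarith
  rw [rSq, h3, slope]
  field_simp

theorem contDiff_rSq : ContDiff ℝ ∞ F.rSq := by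
  have h1 : F.rSq = fun s => -deriv F.Y s := by
    ext s
    exact F.rSq_eq s
  rw [h1]
  exact (contDiff_infty_iff_deriv.1 F.smooth_Y).2.neg

theorem rSq_add_period (s : ℝ) : F.rSq (s + (h + v : ℕ)) = F.rSq s := by
  rw [rSq_eq, rSq_eq]
  have h1 : (fun s => F.Y (s + (h + v : ℕ))) = fun s => F.Y s - v := funext F.closed_Y
  have h2 := congrArg (fun f => deriv f s) h1
  rw [deriv_comp_add_const, deriv_sub_const] at h2
  rw [h2]

theorem rSq_periodic : Function.Periodic F.rSq (h + v : ℕ) := F.rSq_add_period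

theorem rSq_add_int_mul (s : ℝ) (k : ℤ) : F.rSq (s + k * (h + v : ℕ)) = F.rSq s :=
  F.rSq_periodic.int_mul k s

theorem rSq_eq_one_sub (s : ℝ) : F.rSq s = 1 - 1 / (1 - F.slope s) := by
  have := F.slope_neg s
  have h1 : 1 - F.slope s ≠ 0 := by linarith
  rw [rSq]
  field_simp
  ring

theorem rSq_lt_of_slope_lt {s t : ℝ} (hst : F.slope s < F.slope t) : F.rSq t < F.rSq s := by
  have h1 := F.slope_neg t
  rw [rSq_eq_one_sub, rSq_eq_one_sub]
  have := one_div_lt_one_div_of_lt (by linarith : 0 < 1 - F.slope t)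
    (by linarith : 1 - F.slope t < 1 - F.slope s)
  linarith

/-- The value of `r₁²` on the `i`-th segment. -/
def level (i : ℕ) : ℝ := F.rSq (i + 1 / 2)

theorem deriv_segment {i : ℕ} (hi : i < h + v) {s : ℝ} (hs : s ∈ Set.Ioo (i + F.ε) (i + 1 - F.ε)) :
    deriv F.X s = (basept h F.δ (i + 1)).1 - (basept h F.δ i).1 ∧
    deriv F.Y s = (basept h F.δ (i + 1)).2 - (basept h F.δ i).2 := by
  have hnhds : Set.Ioo (i + F.ε) (i + 1 - F.ε) ∈ nhds s := isOpen_Ioo.mem_nhds hs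
  have hlin : ∀ a b : ℝ, HasDerivAt (fun t : ℝ => (t - i) * a + b) a s := by
    intro a b
    simpa using (((hasDerivAt_id s).sub_const (i : ℝ)).mul_const a).add_const b
  have hseg : ∀ t ∈ Set.Ioo (i + F.ε) (i + 1 - F.ε), (F.X t, F.Y t) =
      AffineMap.lineMap (basept h F.δ i) (basept h F.δ (i + 1)) (t - i) :=
    fun t ht => F.segment i hi t (Set.Ioo_subset_Icc_self ht)
  constructor
  · refine HasDerivAt.deriv ((hlin _ (basept h F.δ i).1).congr_of_eventuallyEq ?_)
    filter_upwards [hnhds] with t ht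
    have := congrArg Prod.fst (hseg t ht)
    simpa [AffineMap.lineMap_apply] using this
  · refine HasDerivAt.deriv ((hlin _ (basept h F.δ i).2).congr_of_eventuallyEq ?_)
    filter_upwards [hnhds] with t ht
    have := congrArg Prod.snd (hseg t ht)
    simpa [AffineMap.lineMap_apply] using this

theorem mid_mem (i : ℕ) : (i + 1 / 2 : ℝ) ∈ Set.Ioo (i + F.ε) (i + 1 - F.ε) := by
  have := F.ε_lt
  constructor <;> linarith

/-- Along a segment of the front `r₁²` is constant. -/
theorem rSq_segment {i : ℕ} (hi : i < h + v) {s : ℝ} (hs : s ∈ Set.Icc (i + F.ε) (i + 1 - F.ε)) :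
    F.rSq s = F.level i := by
  have h1 : Set.EqOn F.rSq (fun _ => F.level i) (Set.Ioo (i + F.ε) (i + 1 - F.ε)) := by
    intro t ht
    simp only
    rw [level, rSq_eq, rSq_eq, (F.deriv_segment hi ht).2, (F.deriv_segment hi (F.mid_mem i)).2]
  have h2 := h1.closure F.contDiff_rSq.continuous continuous_const
  rw [closure_Ioo (by linarith [F.ε_lt])] at h2
  exact h2 hs

theorem slope_mid {i : ℕ} (hi : i < h + v) : F.slope (i + 1 / 2) = segSlope h F.δ i := by
  rw [slope, segSlope, (F.deriv_segment hi (F.mid_mem i)).1, (F.deriv_segment hi (F.mid_mem i)).2]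

/-- The slopes of the segments decrease, so their levels increase. -/
theorem level_lt {i j : ℕ} (hij : i < j) (hj : j < h + v) : F.level i < F.level j := by
  apply F.rSq_lt_of_slope_lt
  rw [F.slope_mid hj, F.slope_mid (hij.trans hj)]
  exact F.slopes (hij.trans hj) hj hij

theorem level_le {i j : ℕ} (hij : i ≤ j) (hj : j < h + v) : F.level i ≤ F.level j := by
  rcases hij.eq_or_lt with rfl | hlt
  · exact le_rfl
  · exact (F.level_lt hlt hj).le

theorem strictAntiOn_rSq : StrictAntiOn F.rSq (Set.Icc (-F.ε) F.ε) :=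
  fun _ hs _ ht hst => F.rSq_lt_of_slope_lt (F.ascending hs ht hst)

theorem strictMonoOn_rSq {i : ℕ} (h0 : 0 < i) (hi : i < h + v) :
    StrictMonoOn F.rSq (Set.Icc (i - F.ε) (i + F.ε)) :=
  fun _ hs _ ht hst => F.rSq_lt_of_slope_lt (F.descending i h0 hi hs ht hst)

theorem rSq_lt_of_lt {i : ℕ} (h0 : 0 < i) (hi : i < h + v) {s t : ℝ} (hs : -F.ε ≤ s) (hst : s < t)
    (ht : t ≤ F.ε) : F.rSq (s + i) < F.rSq (t + i) :=
  F.strictMonoOn_rSq h0 hi ⟨by linarith, by linarith⟩ ⟨by linarith, by linarith⟩ (by linarith)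

theorem rSq_ε (i : ℕ) (hi : i < h + v) : F.rSq (F.ε + i) = F.level i :=
  F.rSq_segment hi ⟨by linarith, by linarith [F.ε_lt]⟩

theorem rSq_neg_ε (i : ℕ) (hi : i < h + v) : F.rSq (-F.ε + (i + 1 : ℕ)) = F.level i := by
  push_cast
  exact F.rSq_segment hi ⟨by linarith [F.ε_lt], by linarith⟩

theorem rSq_middle {i : ℕ} (hi : i < h + v) {s : ℝ} (h0 : F.ε ≤ s) (h1 : s ≤ 1 - F.ε) :
    F.rSq (s + i) = F.level i :=
  F.rSq_segment hi ⟨by linarith, by linarith⟩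

theorem rSq_le_level {i : ℕ} (h0 : 0 < i) (hi : i < h + v) {s : ℝ} (hs : -F.ε ≤ s)
    (ht : s ≤ F.ε) : F.rSq (s + i) ≤ F.level i := by
  rw [← F.rSq_ε i hi]
  rcases ht.eq_or_lt with rfl | ht
  · exact le_rfl
  · exact (F.rSq_lt_of_lt h0 hi hs ht le_rfl).le

theorem rSq_lt_level {i : ℕ} (h0 : 0 < i) (hi : i < h + v) {s : ℝ} (hs : -F.ε ≤ s)
    (ht : s < F.ε) : F.rSq (s + i) < F.level i := by
  rw [← F.rSq_ε i hi]
  exact F.rSq_lt_of_lt h0 hi hs ht le_rfl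

theorem level_le_rSq {i : ℕ} (hi : i + 1 < h + v) {s : ℝ} (hs : -F.ε ≤ s)
    (ht : s ≤ F.ε) : F.level i ≤ F.rSq (s + (i + 1 : ℕ)) := by
  rw [← F.rSq_neg_ε i (by omega)]
  rcases hs.eq_or_lt with rfl | hs
  · exact le_rfl
  · exact (F.rSq_lt_of_lt (by omega) hi le_rfl hs ht).le

theorem level_lt_rSq {i : ℕ} (hi : i + 1 < h + v) {s : ℝ} (hs : -F.ε < s)
    (ht : s ≤ F.ε) : F.level i < F.rSq (s + (i + 1 : ℕ)) := by
  rw [← F.rSq_neg_ε i (by omega)]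
  exact F.rSq_lt_of_lt (by omega) hi le_rfl hs ht

/-- Near an integer, the branches other than the `0`-th one are ordered. -/
theorem rSq_branch_lt {i j : ℕ} (h0 : 0 < i) (hij : i < j) (hj : j < h + v) {s : ℝ} (hs : -F.ε ≤ s)
    (ht : s ≤ F.ε) : F.rSq (s + i) < F.rSq (s + j) := by
  obtain ⟨k, rfl⟩ := Nat.exists_eq_succ_of_ne_zero (by omega : j ≠ 0)
  rcases hs.eq_or_lt with rfl | hs
  · exact (F.rSq_lt_level h0 (hij.trans hj) le_rfl (by linarith [F.ε_pos])).trans_le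
      ((F.level_le (by omega) (by omega)).trans (F.level_le_rSq hj le_rfl (by linarith [F.ε_pos])))
  · exact (F.rSq_le_level h0 (hij.trans hj) hs.le ht).trans_lt
      ((F.level_le (by omega) (by omega)).trans_lt (F.level_lt_rSq hj hs ht))

/-- Near Box `0` the `0`-th branch descends in `r₁²` from the highest level to the lowest one, and
so it crosses each of the other branches. -/
theorem exists_crossing {i : ℕ} (h0 : 0 < i) (hi : i < h + v) :
    ∃ r ∈ Set.Ioo (-F.ε) F.ε, F.rSq r = F.rSq (r + i) := by
  have hε := F.ε_pos
  have hcont : Continuous fun r => F.rSq (r + i) - F.rSq r :=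
    (F.contDiff_rSq.continuous.comp (by fun_prop)).sub F.contDiff_rSq.continuous
  have hl : F.rSq (-F.ε + i) - F.rSq (-F.ε) < 0 := by
    obtain ⟨k, rfl⟩ := Nat.exists_eq_succ_of_ne_zero h0.ne'
    obtain ⟨N, hN⟩ := Nat.exists_eq_succ_of_ne_zero (by omega : h + v ≠ 0)
    have h1 := F.rSq_neg_ε k (by omega)
    have h2 := F.rSq_neg_ε N (by omega)
    have h3 : F.rSq (-F.ε + (N + 1 : ℕ)) = F.rSq (-F.ε) := by
      rw [← F.rSq_add_period (-F.ε), hN]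
    have h4 := F.level_lt (i := k) (j := N) (by omega) (by omega)
    rw [← h3, h2]
    simp only [Nat.succ_eq_add_one]
    rw [h1]
    linarith
  have hr : 0 < F.rSq (F.ε + i) - F.rSq F.ε := by
    have h1 := F.rSq_ε 0 (by omega)
    have h2 := F.rSq_ε i hi
    have h4 := F.level_lt h0 hi
    simp only [Nat.cast_zero, add_zero] at h1
    linarith
  obtain ⟨r, hr, h1⟩ := intermediate_value_Ioo (by linarith) hcont.continuousOn ⟨hl, hr⟩
  exact ⟨r, hr, by simp only at h1; linarith⟩

open Classical in
/-- The azimuth (as a fraction of `2 π`) of the crossing of the `0`-th and the `i`-th branch, for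
`0 < i < h + v`. -/
def cross (i : ℕ) : ℝ :=
  if H : 0 < i ∧ i < h + v then (F.exists_crossing H.1 H.2).choose else 0

theorem cross_mem {i : ℕ} (h0 : 0 < i) (hi : i < h + v) : F.cross i ∈ Set.Ioo (-F.ε) F.ε := by
  rw [cross, dif_pos ⟨h0, hi⟩]
  exact (F.exists_crossing h0 hi).choose_spec.1

theorem rSq_cross {i : ℕ} (h0 : 0 < i) (hi : i < h + v) :
    F.rSq (F.cross i) = F.rSq (F.cross i + i) := by
  rw [cross, dif_pos ⟨h0, hi⟩]
  exact (F.exists_crossing h0 hi).choose_spec.2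

theorem branch_lt_zero_branch {i : ℕ} (h0 : 0 < i) (hi : i < h + v) {s : ℝ} (hs : -F.ε ≤ s)
    (ht : s < F.cross i) : F.rSq (s + i) < F.rSq s := by
  have h1 := F.cross_mem h0 hi
  have h2 := F.rSq_lt_of_lt h0 hi hs ht h1.2.le
  have h3 := F.strictAntiOn_rSq ⟨hs, by linarith [h1.2]⟩ ⟨h1.1.le, h1.2.le⟩ ht
  rw [F.rSq_cross h0 hi] at h3
  linarith

theorem zero_branch_lt_branch {i : ℕ} (h0 : 0 < i) (hi : i < h + v) {s : ℝ} (hs : F.cross i < s)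
    (ht : s ≤ F.ε) : F.rSq s < F.rSq (s + i) := by
  have h1 := F.cross_mem h0 hi
  have h2 := F.rSq_lt_of_lt h0 hi h1.1.le hs ht
  have h3 := F.strictAntiOn_rSq ⟨h1.1.le, h1.2.le⟩ ⟨by linarith [h1.1], ht⟩ hs
  rw [F.rSq_cross h0 hi] at h3
  linarith

/-- The `0`-th branch and the `i`-th branch are monotone in opposite directions, so that they cross
only once. -/
theorem eq_cross {i : ℕ} (h0 : 0 < i) (hi : i < h + v) {s : ℝ} (hs : -F.ε ≤ s)
    (ht : s ≤ F.ε) (he : F.rSq s = F.rSq (s + i)) : s = F.cross i := by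
  rcases lt_trichotomy s (F.cross i) with hlt | heq | hlt
  · exact absurd he (F.branch_lt_zero_branch h0 hi hs hlt).ne'
  · exact heq
  · exact absurd he (F.zero_branch_lt_branch h0 hi hlt ht).ne

/-- Between two passages of the crossing `k`, the branches `0, …, k - 1` lie below the branches
`k, …, h + v - 1` in the coordinate `r₁²`. -/
theorem rSq_lower_lt_upper {k : ℕ} (h0 : 0 < k) (hk : k < h + v) {s : ℝ}
    (hs : s ∈ Set.Ioo (F.cross k) (F.cross k + 1)) {i j : ℕ} (hi : i < k) (hkj : k ≤ j)
    (hj : j < h + v) : F.rSq (s + i) < F.rSq (s + j) := by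
  have hc := F.cross_mem h0 hk
  have hε := F.ε_lt
  rcases le_or_gt s F.ε with h1 | h1
  · -- the `0`-th branch has already crossed the `k`-th one
    rcases Nat.eq_zero_or_pos i with rfl | hi0
    · have h2 := F.zero_branch_lt_branch h0 hk hs.1 h1
      rw [Nat.cast_zero, add_zero]
      rcases hkj.eq_or_lt with rfl | hkj
      · exact h2
      · exact h2.trans (F.rSq_branch_lt h0 hkj hj (by linarith [hs.1, hc.1]) h1)
    · exact F.rSq_branch_lt hi0 (by omega) hj (by linarith [hs.1, hc.1]) h1
  rcases le_or_gt s (1 - F.ε) with h2 | h2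
  · rw [F.rSq_middle (by omega) h1.le h2, F.rSq_middle hj h1.le h2]
    exact F.level_lt (by omega) hj
  · -- the branch `h + v - 1` continues as the `0`-th branch, which has not yet crossed the `k`-th
    obtain ⟨t, rfl⟩ : ∃ t, s = t + 1 := ⟨s - 1, by ring⟩
    have e1 : ∀ n : ℕ, t + 1 + n = t + (n + 1 : ℕ) := by intro n; push_cast; ring
    have ht : -F.ε ≤ t := by linarith
    have ht1 : t < F.cross k := by linarith [hs.2]
    have ht2 : t ≤ F.ε := by linarith [hc.2]
    rw [e1, e1]
    rcases (by omega : j + 1 < h + v ∨ j + 1 = h + v) with h3 | h3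
    · exact F.rSq_branch_lt (by omega) (by omega) h3 ht ht2
    · rw [h3, F.rSq_add_period]
      have h4 := F.branch_lt_zero_branch h0 hk ht ht1
      rcases (by omega : i + 1 < k ∨ i + 1 = k) with h5 | h5
      · exact (F.rSq_branch_lt (by omega) h5 hk ht ht2).trans h4
      · rwa [h5]

theorem rSq_lower_le_upper {k : ℕ} (h0 : 0 < k) (hk : k < h + v) {s : ℝ}
    (hs : s ∈ Set.Icc (F.cross k) (F.cross k + 1)) {i j : ℕ} (hi : i < k) (hkj : k ≤ j)
    (hj : j < h + v) : F.rSq (s + i) ≤ F.rSq (s + j) := by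
  have hc : ∀ n : ℕ, Continuous fun t => F.rSq (t + n) := fun n =>
    F.contDiff_rSq.continuous.comp (by fun_prop)
  have h1 : Set.Ioo (F.cross k) (F.cross k + 1) ⊆ {t | F.rSq (t + i) ≤ F.rSq (t + j)} :=
    fun t ht => (F.rSq_lower_lt_upper h0 hk ht hi hkj hj).le
  have h2 := closure_minimal h1 (isClosed_le (hc i) (hc j))
  rw [closure_Ioo (by linarith)] at h2
  exact h2 hs

theorem hasDerivAt_slope (s : ℝ) :
    HasDerivAt F.slope (-deriv F.rSq s / (1 - F.rSq s) ^ 2) s := by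
  have h1 : F.slope = fun s => 1 - 1 / (1 - F.rSq s) := by
    ext s
    have := F.rSq_lt_one s
    have h2 : 1 - F.rSq s ≠ 0 := by linarith
    rw [F.slope_eq s]
    field_simp
    ring
  have h3 : HasDerivAt F.rSq (deriv F.rSq s) s :=
    (F.contDiff_rSq.differentiable (by simp) s).hasDerivAt
  have h4 := F.rSq_lt_one s
  have h5 : 1 - F.rSq s ≠ 0 := by linarith
  rw [h1]
  have h6 := ((h3.const_sub 1).inv h5).const_sub 1
  exact (h6.congr_deriv (by ring)).congr_of_eventuallyEq
    (Filter.Eventually.of_forall fun t => by simp)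

/-- At a crossing the `0`-th branch descends and the other one ascends in the coordinate `r₁²`. -/
theorem deriv_cross_lt {i : ℕ} (h0 : 0 < i) (hi : i < h + v) :
    deriv F.rSq (F.cross i) < deriv F.rSq (F.cross i + i) := by
  have hc := F.cross_mem h0 hi
  have h1 : deriv F.rSq (F.cross i) ≤ 0 := by
    have := F.strictAntiOn_rSq.antitoneOn.derivWithin_nonpos (x := F.cross i)
    rwa [derivWithin_of_mem_nhds (Icc_mem_nhds hc.1 hc.2)] at this
  have h2 : 0 ≤ deriv F.rSq (F.cross i + i) := by
    have := (F.strictMonoOn_rSq h0 hi).monotoneOn.derivWithin_nonneg (x := F.cross i + i)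
    rwa [derivWithin_of_mem_nhds (Icc_mem_nhds (by linarith [hc.1]) (by linarith [hc.2]))] at this
  -- equality would be a tangency, which `transverse` excludes
  refine lt_of_le_of_ne (h1.trans h2) fun heq => ?_
  have hr := F.rSq_cross h0 hi
  have h3 : ¬ ∃ l : ℤ, (i : ℤ) = l * (h + v : ℕ) := by
    rintro ⟨l, hl⟩
    have hdvd : ((h + v : ℕ) : ℤ) ∣ (i : ℤ) := ⟨l, by rw [hl]; ring⟩
    have := Nat.le_of_dvd h0 (by exact_mod_cast hdvd)
    omega
  have h4 : F.slope (F.cross i) = F.slope (F.cross i + i) := by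
    rw [F.slope_eq, F.slope_eq, hr]
  refine F.transverse (F.cross i) i h3 (by rw [Int.cast_natCast]; exact h4) ?_
  change deriv F.slope _ = deriv F.slope _
  rw [Int.cast_natCast, (F.hasDerivAt_slope _).deriv, (F.hasDerivAt_slope _).deriv, heq, hr]

/-- The double points of the Lagrangian projection. -/
theorem double_point {s : ℝ} {i j : ℕ} (hij : i < j) (hj : j < h + v)
    (hs : s ∈ Set.Ico (-F.ε) (1 - F.ε)) (he : F.rSq (s + i) = F.rSq (s + j)) :
    i = 0 ∧ s = F.cross j := by
  rcases le_or_gt s F.ε with h1 | h1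
  · rcases Nat.eq_zero_or_pos i with rfl | hi0
    · rw [Nat.cast_zero, add_zero] at he
      exact ⟨rfl, F.eq_cross hij hj hs.1 h1 he⟩
    · exact absurd he (F.rSq_branch_lt hi0 hij hj hs.1 h1).ne
  · rw [F.rSq_middle (hij.trans hj) h1.le hs.2.le, F.rSq_middle hj h1.le hs.2.le] at he
    exact absurd he (F.level_lt hij hj).ne

/-- The value of `r₁²` at the `i`-th crossing. -/
def crossHeight (i : ℕ) : ℝ := F.rSq (F.cross i)

theorem crossHeight_lt {i j : ℕ} (h0 : 0 < i) (hij : i < j) (hj : j < h + v) :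
    F.crossHeight i < F.crossHeight j := by
  have hi := F.cross_mem h0 (hij.trans hj)
  have hjm := F.cross_mem (h0.trans hij) hj
  obtain ⟨k, rfl⟩ := Nat.exists_eq_succ_of_ne_zero (by omega : j ≠ 0)
  rw [crossHeight, crossHeight, F.rSq_cross h0 (hij.trans hj), F.rSq_cross (h0.trans hij) hj]
  exact (F.rSq_lt_level h0 (hij.trans hj) hi.1.le hi.2).trans_le
    ((F.level_le (by omega) (by omega)).trans (F.level_lt_rSq hj hjm.1 hjm.2.le).le)

theorem exists_rSq_lower (hpos : 0 < h + v) : ∃ c > 0, ∀ s, c ≤ F.rSq s := by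
  have hN : (0 : ℝ) < (h + v : ℕ) := by exact_mod_cast hpos
  obtain ⟨x, -, hx⟩ := isCompact_Icc.exists_isMinOn (s := Set.Icc (0 : ℝ) (h + v : ℕ))
    ⟨0, le_rfl, hN.le⟩ F.contDiff_rSq.continuous.continuousOn
  refine ⟨F.rSq x, F.rSq_pos x, fun s => ?_⟩
  obtain ⟨y, hy, hys⟩ := F.rSq_periodic.exists_mem_Ico₀ hN s
  rw [hys]
  exact hx ⟨hy.1, hy.2.le⟩

theorem exists_rSq_upper (hpos : 0 < h + v) : ∃ c > 0, ∀ s, c ≤ 1 - F.rSq s := by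
  have hN : (0 : ℝ) < (h + v : ℕ) := by exact_mod_cast hpos
  obtain ⟨x, -, hx⟩ := isCompact_Icc.exists_isMaxOn (s := Set.Icc (0 : ℝ) (h + v : ℕ))
    ⟨0, le_rfl, hN.le⟩ F.contDiff_rSq.continuous.continuousOn
  refine ⟨1 - F.rSq x, sub_pos.2 (F.rSq_lt_one x), fun s => ?_⟩
  obtain ⟨y, hy, hys⟩ := F.rSq_periodic.exists_mem_Ico₀ hN s
  rw [hys]
  exact sub_le_sub_left (hx ⟨hy.1, hy.2.le⟩) 1

end SpecialFront

/-! ### The Lagrangian projection and the Reeb chords -/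

theorem rot_mul (α β γ δ : ℝ) : rot α β * rot γ δ = rot (α + γ) (β + δ) := by
  ext1 z
  apply Subtype.ext
  apply Prod.ext
  · rw [Equiv.Perm.mul_apply, rot_fst, rot_fst, rot_fst, Circle.exp_add, Circle.coe_mul, mul_assoc]
  · rw [Equiv.Perm.mul_apply, rot_snd, rot_snd, rot_snd, Circle.exp_add, Circle.coe_mul, mul_assoc]

theorem rot_zero : rot 0 0 = 1 := by
  ext1 z
  apply Subtype.ext
  apply Prod.ext
  · rw [rot_fst]; simp
  · rw [rot_snd]; simp

theorem rot_zpow (α β : ℝ) (k : ℤ) : rot α β ^ k = rot (k * α) (k * β) := by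
  induction k using Int.induction_on with
  | zero => simp [rot_zero]
  | succ n ih =>
    rw [zpow_add_one, ih, rot_mul]
    congr 1 <;> push_cast <;> ring
  | pred n ih =>
    have h1 : (rot α β)⁻¹ = rot (-α) (-β) := by
      rw [inv_eq_iff_mul_eq_one, rot_mul, add_neg_cancel, add_neg_cancel, rot_zero]
    rw [zpow_sub_one, ih, h1, rot_mul]
    congr 1 <;> push_cast <;> ring

theorem toLens_eq_iff {p q : ℕ} {a b : S3} :
    toLens p q a = toLens p q b ↔ ∃ k : ℤ, (deck p q ^ k) b = a := by
  unfold toLens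
  constructor
  · intro h
    obtain ⟨⟨g, k, rfl⟩, hg⟩ := Quotient.exact h
    exact ⟨k, hg⟩
  · rintro ⟨k, rfl⟩
    exact Quotient.sound ⟨⟨deck p q ^ k, k, rfl⟩, rfl⟩

theorem mul_circle_exp_eq_iff {a b x y : ℝ} (ha : 0 < a) (hb : 0 < b) :
    (a : ℂ) * (Circle.exp x : ℂ) = (b : ℂ) * (Circle.exp y : ℂ) ↔
      a = b ∧ ∃ m : ℤ, x = y + m * (2 * Real.pi) := by
  constructor
  · intro h
    have hab : a = b := by
      have := congrArg norm h
      rwa [norm_mul, norm_mul, Circle.norm_coe, Circle.norm_coe, mul_one, mul_one,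
        Complex.norm_of_nonneg ha.le, Complex.norm_of_nonneg hb.le] at this
    subst hab
    have h1 : Circle.exp x = Circle.exp y :=
      Subtype.ext (mul_left_cancel₀ (by exact_mod_cast ha.ne') h)
    exact ⟨rfl, Circle.exp_eq_exp.1 h1⟩
  · rintro ⟨rfl, hm⟩
    rw [Circle.exp_eq_exp.2 hm]

namespace SpecialFront

variable {p q h v : ℕ} (F : SpecialFront p q h v)

/-- The Lagrangian projection in cylindrical coordinates: since `s = X - Y`, the azimuth at the
parameter `s` is `2 π s`. -/
theorem gamma_eq (hp : 0 < p) (s : ℝ) : F.gamma s = spherePoint s (F.rSq s) := by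
  have h0 := F.rSq_pos s
  have h1 := sub_pos.2 (F.rSq_lt_one s)
  have hpp : (p : ℝ) ≠ 0 := by exact_mod_cast hp.ne'
  change lagS3 p (F.knotS3 s) = _
  set A : ℝ := √(F.rSq s * (1 - F.rSq s)) with hA
  have hApos : 0 < A := Real.sqrt_pos.2 (mul_pos h0 h1)
  have hprod : (F.knotS3 s).1.1 * (starRingEnd ℂ) (F.knotS3 s).1.2
      = (A : ℂ) * (Circle.exp (2 * Real.pi * s / p) : ℂ) := by
    simp only [knotS3]
    rw [map_mul, Complex.conj_ofReal, ← Circle.coe_inv_eq_conj, ← Circle.exp_neg, hA,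
      Real.sqrt_mul h0.le]
    have : Circle.exp (2 * Real.pi * s / p) = Circle.exp (2 * Real.pi * F.X s / p)
        * Circle.exp (-(2 * Real.pi * F.Y s / p)) := by
      rw [← Circle.exp_add]
      congr 1
      linear_combination -(2 * Real.pi / p) * F.param s
    rw [this, Circle.coe_mul]
    push_cast
    ring
  have hsq : ∀ x y : ℝ, 0 ≤ x → ‖(√x : ℂ) * (Circle.exp y : ℂ)‖ ^ 2 = x := by
    intro x y hx
    rw [norm_mul, Circle.norm_coe, mul_one, Complex.norm_of_nonneg (Real.sqrt_nonneg x),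
      Real.sq_sqrt hx]
  apply Prod.ext
  · simp only [lagS3, spherePoint]
    rw [hprod, ← hA, mul_pow, norm_mul, Circle.norm_coe, mul_one, Complex.norm_of_nonneg hApos.le]
    have h2 : (Circle.exp (2 * Real.pi * s / p) : ℂ) ^ p = (Circle.exp (2 * Real.pi * s) : ℂ) := by
      rw [Circle.coe_exp, Circle.coe_exp, ← Complex.exp_nat_mul]
      congr 1
      have : (p : ℂ) ≠ 0 := by exact_mod_cast hp.ne'
      push_cast
      field_simp
    have hAc : (A : ℂ) ≠ 0 := by exact_mod_cast hApos.ne'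
    rw [h2]
    have h3 : (A : ℂ) ^ p = A ^ (p - 1) * A := by
      rw [← pow_succ, Nat.sub_add_cancel hp]
    rw [h3]
    push_cast
    field_simp
  · simp only [lagS3, spherePoint, knotS3]
    rw [hsq _ _ h0.le, hsq _ _ h1.le]
    ring

/-- Reeb chords in the universal cover of the torus, whose deck group is generated by `(q, 1)`,
`(p, 0)` and `(0, p)`. -/
theorem reeb_knot_eq_iff (hp : 0 < p) (l s t : ℝ) :
    reeb p q (2 * Real.pi * l) (F.knot s) = F.knot t ↔ F.rSq s = F.rSq t ∧
      ∃ k m n : ℤ, F.X s + p * l = F.X t + q * k + p * m ∧ F.Y s + p * l = F.Y t + k + p * n := by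
  have hpp : (p : ℝ) ≠ 0 := by exact_mod_cast hp.ne'
  have hpi := Real.pi_ne_zero
  have hs0 := F.rSq_pos s
  have hs1 := sub_pos.2 (F.rSq_lt_one s)
  have ht0 := F.rSq_pos t
  have ht1 := sub_pos.2 (F.rSq_lt_one t)
  have e1 : reeb p q (2 * Real.pi * l) (F.knot s)
      = toLens p q (rot (2 * Real.pi * l) (2 * Real.pi * l) (F.knotS3 s)) := rfl
  have e2 : F.knot t = toLens p q (F.knotS3 t) := rfl
  have key : ∀ k : ℤ, (deck p q ^ k) (F.knotS3 t)
        = rot (2 * Real.pi * l) (2 * Real.pi * l) (F.knotS3 s) ↔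
      F.rSq s = F.rSq t ∧ ∃ m n : ℤ, F.X s + p * l = F.X t + q * k + p * m ∧
        F.Y s + p * l = F.Y t + k + p * n := by
    intro k
    have hcirc : ∀ x y z : ℝ, (Circle.exp x : ℂ) * ((z : ℂ) * (Circle.exp y : ℂ))
        = (z : ℂ) * (Circle.exp (x + y) : ℂ) := by
      intro x y z
      rw [Circle.exp_add, Circle.coe_mul]
      ring
    have hext : ∀ a b : S3, a = b ↔ a.1.1 = b.1.1 ∧ a.1.2 = b.1.2 := fun a b =>
      ⟨fun hab => by rw [hab]; exact ⟨rfl, rfl⟩, fun hab => Subtype.ext (Prod.ext hab.1 hab.2)⟩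
    rw [deck, rot_zpow, hext, rot_fst, rot_snd, rot_fst, rot_snd]
    simp only [knotS3]
    rw [hcirc, hcirc, hcirc, hcirc, mul_circle_exp_eq_iff (Real.sqrt_pos.2 ht0)
      (Real.sqrt_pos.2 hs0), mul_circle_exp_eq_iff (Real.sqrt_pos.2 ht1) (Real.sqrt_pos.2 hs1)]
    constructor
    · rintro ⟨⟨h1, m, hm⟩, -, n, hn⟩
      refine ⟨((Real.sqrt_inj ht0.le hs0.le).1 h1).symm, -m, -n, ?_, ?_⟩
      · field_simp at hm
        push_cast
        linear_combination -hm
      · field_simp at hn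
        push_cast
        linear_combination -hn
    · rintro ⟨h1, m, n, hm, hn⟩
      refine ⟨⟨by rw [h1], -m, ?_⟩, by rw [h1], -n, ?_⟩
      · field_simp
        push_cast
        linear_combination -hm
      · field_simp
        push_cast
        linear_combination -hn
  rw [e1, e2, toLens_eq_iff]
  constructor
  · rintro ⟨k, hk⟩
    obtain ⟨h1, m, n, h2⟩ := (key k).1 hk
    exact ⟨h1, k, m, n, h2⟩
  · rintro ⟨h1, k, m, n, h2⟩
    exact ⟨k, (key k).2 ⟨h1, m, n, h2⟩⟩

theorem X_add_int_mul (s : ℝ) (a : ℤ) : F.X (s + a * (h + v : ℕ)) = F.X s + a * h := by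
  induction a using Int.induction_on with
  | zero => simp
  | succ n ih =>
    have := F.closed_X (s + (n : ℤ) * (h + v : ℕ))
    rw [ih] at this
    rw [show s + ((n : ℤ) + 1 : ℤ) * ((h + v : ℕ) : ℝ)
      = s + (n : ℤ) * ((h + v : ℕ) : ℝ) + (h + v : ℕ) by push_cast; ring, this]
    push_cast
    ring
  | pred n ih =>
    have := F.closed_X (s + (-(n : ℤ) - 1 : ℤ) * (h + v : ℕ))
    rw [show s + (-(n : ℤ) - 1 : ℤ) * ((h + v : ℕ) : ℝ) + (h + v : ℕ)
      = s + (-(n : ℤ) : ℤ) * ((h + v : ℕ) : ℝ) by push_cast; ring, ih] at this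
    push_cast at this ⊢
    linarith

theorem Y_add_int_mul (s : ℝ) (a : ℤ) : F.Y (s + a * (h + v : ℕ)) = F.Y s - a * v := by
  have h1 := F.X_add_int_mul s a
  have h2 := F.param (s + a * (h + v : ℕ))
  have h3 := F.param s
  push_cast at *
  linarith

theorem strictMono_X : StrictMono F.X := strictMono_of_deriv_pos F.deriv_X_pos

theorem strictAnti_Y : StrictAnti F.Y := strictAnti_of_deriv_neg F.deriv_Y_neg

theorem deriv_rSq_add_int_mul (s : ℝ) (k : ℤ) :
    deriv F.rSq (s + k * (h + v : ℕ)) = deriv F.rSq s := by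
  have h1 : (fun t => F.rSq (t + k * (h + v : ℕ))) = F.rSq := by
    ext t
    exact F.rSq_add_int_mul t k
  rw [← deriv_comp_add_const, h1]

open Classical in
/-- The parameter in `[0, h + v)` of the `0`-th branch at the `i`-th crossing. -/
def sinkParam (i : ℕ) : ℝ := if F.cross i < 0 then F.cross i + (h + v : ℕ) else F.cross i

theorem exists_sinkParam_eq (i : ℕ) : ∃ b : ℤ, F.sinkParam i = F.cross i + b * (h + v : ℕ) := by
  unfold sinkParam
  split_ifs
  · exact ⟨1, by simp⟩
  · exact ⟨0, by simp⟩

theorem sinkParam_mem {i : ℕ} (h0 : 0 < i) (hi : i < h + v) :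
    F.sinkParam i ∈ Set.Ico (0 : ℝ) (h + v : ℕ) := by
  have hc := F.cross_mem h0 hi
  have hε := F.ε_lt
  have hN : (1 : ℝ) ≤ (h + v : ℕ) := by exact_mod_cast (by omega : 1 ≤ h + v)
  unfold sinkParam
  split_ifs with h1
  · constructor <;> linarith [hc.1]
  · constructor <;> linarith [hc.2]

theorem sourceParam_mem {i : ℕ} (h0 : 0 < i) (hi : i < h + v) :
    F.cross i + i ∈ Set.Ico (0 : ℝ) (h + v : ℕ) := by
  have hc := F.cross_mem h0 hi
  have hε := F.ε_lt
  have h1 : (1 : ℝ) ≤ i := by exact_mod_cast h0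
  have h2 : (i : ℝ) + 1 ≤ (h + v : ℕ) := by exact_mod_cast hi
  constructor <;> linarith [hc.1, hc.2]

theorem eq_of_mem_Ico {N : ℕ} {s t : ℝ} (hs : s ∈ Set.Ico (0 : ℝ) N) (ht : t ∈ Set.Ico (0 : ℝ) N)
    {k : ℤ} (hk : s = t + k * N) : s = t := by
  have hN : (0 : ℝ) < N := hs.1.trans_lt hs.2
  have h1 : (k : ℝ) < 1 := by
    by_contra hc
    nlinarith [hs.2, ht.1]
  have h2 : (-1 : ℝ) < k := by
    by_contra hc
    nlinarith [hs.1, ht.2]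
  have h3 : k = 0 := by
    have h1' : k < 1 := by exact_mod_cast h1
    have h2' : -1 < k := by exact_mod_cast h2
    omega
  rw [hk, h3]
  simp

theorem eq_sourceParam {i : ℕ} (h0 : 0 < i) (hi : i < h + v) {s : ℝ}
    (hs : s ∈ Set.Ico (0 : ℝ) (h + v : ℕ)) {k : ℤ} (hk : s = F.cross i + i + k * (h + v : ℕ)) :
    s = F.cross i + i :=
  eq_of_mem_Ico hs (F.sourceParam_mem h0 hi) hk

theorem eq_sinkParam {i : ℕ} (h0 : 0 < i) (hi : i < h + v) {s : ℝ}
    (hs : s ∈ Set.Ico (0 : ℝ) (h + v : ℕ)) {k : ℤ} (hk : s = F.cross i + k * (h + v : ℕ)) :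
    s = F.sinkParam i := by
  obtain ⟨b, hb⟩ := F.exists_sinkParam_eq i
  refine eq_of_mem_Ico hs (F.sinkParam_mem h0 hi) (k := k - b) ?_
  rw [hk, hb]
  push_cast
  ring

/-- Integers are represented modulo `N` by numbers below `N`. -/
theorem exists_residue {N : ℕ} (hN : 0 < N) (a : ℤ) : ∃ i < N, ∃ k : ℤ, a = i + k * N := by
  have h1 : (0 : ℤ) < N := by exact_mod_cast hN
  refine ⟨(a % N).toNat, ?_, a / N, ?_⟩
  · have := Int.emod_lt_of_pos a h1
    have := Int.emod_nonneg a h1.ne'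
    omega
  · rw [Int.toNat_of_nonneg (Int.emod_nonneg a h1.ne')]
    linarith [Int.emod_add_mul_ediv a N, mul_comm (N : ℤ) (a / N)]

/-- Two parameters over the same point of `Γ` are those of a crossing. -/
theorem double_params {s t : ℝ} (hs : s ∈ Set.Ico (0 : ℝ) (h + v : ℕ))
    (ht : t ∈ Set.Ico (0 : ℝ) (h + v : ℕ)) (hne : s ≠ t) (hr : F.rSq s = F.rSq t)
    (hint : ∃ k : ℤ, s = t + k) : ∃ i, 0 < i ∧ i < h + v ∧
      ((s = F.cross i + i ∧ t = F.sinkParam i) ∨ (t = F.cross i + i ∧ s = F.sinkParam i)) := by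
  have hN : 0 < h + v := by
    have := hs.1.trans_lt hs.2
    exact_mod_cast this
  obtain ⟨k, hk⟩ := hint
  -- the representative of the azimuth in the window `[-ε, 1 - ε)`
  set c := toIcoMod one_pos (-F.ε) t with hc
  have hcm : c ∈ Set.Ico (-F.ε) (1 - F.ε) := by
    have := toIcoMod_mem_Ico one_pos (-F.ε) t
    rwa [← hc, show -F.ε + 1 = 1 - F.ε by ring] at this
  have htc : t = c + (toIcoDiv one_pos (-F.ε) t : ℤ) := by
    have := toIcoMod_add_toIcoDiv_zsmul one_pos (-F.ε) t
    rw [zsmul_one] at this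
    exact this.symm
  set b := toIcoDiv one_pos (-F.ε) t
  obtain ⟨j, hj, kj, hkj⟩ := exists_residue hN b
  obtain ⟨i, hi, ki, hki⟩ := exists_residue hN (b + k)
  have ht' : t = c + j + kj * (h + v : ℕ) := by
    rw [htc, hkj]; push_cast; ring
  have hs' : s = c + i + ki * (h + v : ℕ) := by
    have : s = c + (b + k : ℤ) := by rw [hk, htc]; push_cast; ring
    rw [this, hki]; push_cast; ring
  have hr' : F.rSq (c + i) = F.rSq (c + j) := by
    rw [hs', ht', F.rSq_add_int_mul, F.rSq_add_int_mul] at hr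
    exact hr
  rcases lt_trichotomy i j with hij | hij | hij
  · obtain ⟨hi0, hcj⟩ := F.double_point hij hj hcm hr'
    subst hi0
    rw [Nat.cast_zero, add_zero, hcj] at hs'
    rw [hcj] at ht'
    exact ⟨j, hij, hj, Or.inr ⟨F.eq_sourceParam hij hj ht ht', F.eq_sinkParam hij hj hs hs'⟩⟩
  · exfalso
    apply hne
    refine eq_of_mem_Ico hs ht (k := ki - kj) ?_
    rw [hs', ht', hij]
    push_cast
    ring
  · obtain ⟨hi0, hcj⟩ := F.double_point hij hi hcm hr'.symm
    subst hi0
    rw [Nat.cast_zero, add_zero, hcj] at ht'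
    rw [hcj] at hs'
    exact ⟨i, hij, hi, Or.inl ⟨F.eq_sourceParam hij hi hs hs', F.eq_sinkParam hij hi ht ht'⟩⟩

/-- The `i`-th crossing. -/
def crossPoint (i : ℕ) : Space := spherePoint (F.cross i) (F.crossHeight i)

theorem gamma_add_int_mul (hp : 0 < p) (s : ℝ) (k : ℤ) :
    F.gamma (s + k * (h + v : ℕ)) = F.gamma s := by
  rw [F.gamma_eq hp, F.gamma_eq hp, F.rSq_add_int_mul]
  have := spherePoint_add_int s (F.rSq s) (k * (h + v : ℕ))
  push_cast at this ⊢
  exact this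

theorem gamma_source (hp : 0 < p) {i : ℕ} (h0 : 0 < i) (hi : i < h + v) :
    F.gamma (F.cross i + i) = F.crossPoint i := by
  rw [F.gamma_eq hp, spherePoint_add_nat, ← F.rSq_cross h0 hi]
  rfl

theorem gamma_sink (hp : 0 < p) (i : ℕ) : F.gamma (F.sinkParam i) = F.crossPoint i := by
  obtain ⟨b, hb⟩ := F.exists_sinkParam_eq i
  rw [hb, F.gamma_add_int_mul hp, F.gamma_eq hp]
  rfl

theorem sourceParam_ne_sinkParam {i : ℕ} (h0 : 0 < i) (hi : i < h + v) :
    F.cross i + i ≠ F.sinkParam i := by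
  obtain ⟨b, hb⟩ := F.exists_sinkParam_eq i
  rw [hb]
  intro heq
  have h1 : (i : ℝ) = b * (h + v : ℕ) := by linarith
  have h2 : (i : ℤ) = b * (h + v : ℕ) := by exact_mod_cast h1
  have h3 : ((h + v : ℕ) : ℤ) ∣ i := ⟨b, by rw [h2]; ring⟩
  have := Nat.le_of_dvd h0 (by exact_mod_cast h3)
  omega

theorem mem_crossings_iff (hp : 0 < p) (P : Space) :
    P ∈ F.crossings ↔ ∃ i, 0 < i ∧ i < h + v ∧ P = F.crossPoint i := by
  constructor
  · rintro ⟨s, hs, t, ht, hne, hsP, htP⟩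
    have heq : F.gamma s = F.gamma t := hsP.trans htP.symm
    rw [F.gamma_eq hp, F.gamma_eq hp] at heq
    obtain ⟨hr, k, hk⟩ := spherePoint_inj ⟨F.rSq_pos s, F.rSq_lt_one s⟩ heq
    obtain ⟨i, h0, hi, ⟨h1, -⟩ | ⟨h1, -⟩⟩ := F.double_params hs ht hne hr ⟨k, hk⟩
    · exact ⟨i, h0, hi, by rw [← hsP, h1, F.gamma_source hp h0 hi]⟩
    · exact ⟨i, h0, hi, by rw [← htP, h1, F.gamma_source hp h0 hi]⟩
  · rintro ⟨i, h0, hi, rfl⟩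
    exact ⟨_, F.sourceParam_mem h0 hi, _, F.sinkParam_mem h0 hi, F.sourceParam_ne_sinkParam h0 hi,
      F.gamma_source hp h0 hi, F.gamma_sink hp i⟩

theorem crossPoint_height_lt_iff {i j : ℕ} (hi0 : 0 < i) (hi : i < h + v) (hj0 : 0 < j)
    (hj : j < h + v) : (F.crossPoint i).2 < (F.crossPoint j).2 ↔ j < i := by
  simp only [crossPoint, spherePoint]
  rcases lt_trichotomy i j with hlt | rfl | hlt
  · have := F.crossHeight_lt hi0 hlt hj
    constructor
    · intro h; linarith
    · intro h; omega
  · simp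
  · have := F.crossHeight_lt hj0 hlt hi
    exact ⟨fun _ => hlt, fun _ => by linarith⟩

namespace ReebChord

variable {F}

theorem exists_flow (hp : 0 < p) (x : F.ReebChord) : F.rSq x.source = F.rSq x.sink ∧
    ∃ k m n : ℤ, F.X x.source + p * x.length = F.X x.sink + q * k + p * m ∧
      F.Y x.source + p * x.length = F.Y x.sink + k + p * n :=
  (F.reeb_knot_eq_iff hp _ _ _).1 x.flow

theorem dvd_of_dvd_mul (hk : Int.gcd ((q : ℤ) - 1) p = 1) {k m : ℤ}
    (heq : ((q : ℤ) - 1) * k + p * m = 0) : (p : ℤ) ∣ k := by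
  have h1 : (p : ℤ) ∣ ((q : ℤ) - 1) * k := ⟨-m, by linarith⟩
  have h2 : IsCoprime (p : ℤ) ((q : ℤ) - 1) := (Int.isCoprime_iff_gcd_eq_one.2 hk).symm
  exact h2.dvd_of_dvd_mul_left h1

/-- As `q - 1` is prime to `p`, the only chords from a point to itself are full orbits. -/
theorem source_ne_sink (hp : 0 < p) (hk : Int.gcd ((q : ℤ) - 1) p = 1) (x : F.ReebChord) :
    x.source ≠ x.sink := by
  intro heq
  obtain ⟨-, k, m, n, h1, h2⟩ := x.exists_flow hp
  rw [heq] at h1 h2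
  have h3 : ((q : ℤ) - 1) * k + p * (m - n) = 0 := by
    have : ((q : ℝ) - 1) * k + p * (m - n) = 0 := by linarith
    exact_mod_cast this
  obtain ⟨c, rfl⟩ := dvd_of_dvd_mul hk h3
  have hpp : (0 : ℝ) < p := by exact_mod_cast hp
  push_cast at h2
  have h4 : (p : ℝ) * (x.length - (c + n)) = 0 := by linarith
  have h5 : x.length = (c + n : ℤ) := by
    push_cast
    linarith [(mul_eq_zero.1 h4).resolve_left hpp.ne']
  have hl := x.length_mem
  rw [h5] at hl
  have h6 : (0 : ℤ) < c + n := by exact_mod_cast hl.1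
  have h7 : c + n < (1 : ℤ) := by exact_mod_cast hl.2
  omega

/-- A Reeb chord is determined by its end points. -/
theorem ext_of_ends (hp : 0 < p) (hk : Int.gcd ((q : ℤ) - 1) p = 1) {x y : F.ReebChord}
    (hs : x.source = y.source) (ht : x.sink = y.sink) : x = y := by
  apply ReebChord.ext hs ht
  obtain ⟨-, k, m, n, h1, h2⟩ := x.exists_flow hp
  obtain ⟨-, k', m', n', h1', h2'⟩ := y.exists_flow hp
  rw [hs, ht] at h1 h2
  have h3 : ((q : ℤ) - 1) * (k - k') + p * ((m - m') - (n - n')) = 0 := by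
    have : ((q : ℝ) - 1) * (k - k') + p * ((m - m') - (n - n')) = 0 := by linarith
    exact_mod_cast this
  obtain ⟨c, hc⟩ := dvd_of_dvd_mul hk h3
  have hc' : (k : ℝ) = k' + p * c := by
    have : k = k' + p * c := by linarith
    exact_mod_cast this
  have hpp : (0 : ℝ) < p := by exact_mod_cast hp
  rw [hc'] at h2
  have h4 : (p : ℝ) * (x.length - y.length - (c + (n - n'))) = 0 := by linarith
  have h5 : x.length - y.length = (c + (n - n') : ℤ) := by
    push_cast
    linarith [(mul_eq_zero.1 h4).resolve_left hpp.ne']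
  have hl := x.length_mem
  have hl' := y.length_mem
  have h6 : (-1 : ℤ) < c + (n - n') := by
    have : (-1 : ℝ) < (c + (n - n') : ℤ) := by rw [← h5]; linarith [hl.1, hl'.2]
    exact_mod_cast this
  have h7 : c + (n - n') < (1 : ℤ) := by
    have : ((c + (n - n') : ℤ) : ℝ) < 1 := by rw [← h5]; linarith [hl.2, hl'.1]
    exact_mod_cast this
  have h8 : c + (n - n') = 0 := by omega
  rw [h8] at h5
  push_cast at h5
  linarith

/-- The preferred chords lead from the strand on which `r₁²` grows faster to the other one. -/
theorem isAType_iff (x : F.ReebChord) : x.IsAType ↔ deriv F.rSq x.sink < deriv F.rSq x.source := by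
  simp only [IsAType, label, and_self, sign_eq_one_iff, sub_pos]

/-- The source of a preferred chord is on the ascending strand. -/
theorem exists_index (hp : 0 < p) (hk : Int.gcd ((q : ℤ) - 1) p = 1) {x : F.ReebChord}
    (hx : x.IsAType) : ∃ i, 0 < i ∧ i < h + v ∧ x.source = F.cross i + i ∧
      x.sink = F.sinkParam i := by
  rw [isAType_iff] at hx
  obtain ⟨hr, k, m, n, h1, h2⟩ := x.exists_flow hp
  have hint : x.source = x.sink + ((q * k + p * m - k - p * n : ℤ) : ℝ) := by
    have h3 := F.param x.source
    have h4 := F.param x.sink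
    push_cast
    linarith
  obtain ⟨i, h0, hi, ⟨hs, ht⟩ | ⟨ht, hs⟩⟩ :=
    F.double_params x.source_mem x.sink_mem (x.source_ne_sink hp hk) hr ⟨_, hint⟩
  · exact ⟨i, h0, hi, hs, ht⟩
  · exfalso
    obtain ⟨b, hb⟩ := F.exists_sinkParam_eq i
    rw [ht, hs, hb, F.deriv_rSq_add_int_mul] at hx
    exact absurd (F.deriv_cross_lt h0 hi) hx.not_gt

theorem isAType_of_ends {x : F.ReebChord} {i : ℕ} (h0 : 0 < i) (hi : i < h + v)
    (hs : x.source = F.cross i + i) (ht : x.sink = F.sinkParam i) : x.IsAType := by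
  obtain ⟨b, hb⟩ := F.exists_sinkParam_eq i
  rw [isAType_iff, hs, ht, hb, F.deriv_rSq_add_int_mul]
  exact F.deriv_cross_lt h0 hi

/-- The crossings from the top down are those of the `0`-th branch with the branches `1, 2, …`. -/
theorem number_eq (hp : 0 < p) {x : F.ReebChord} {i : ℕ} (h0 : 0 < i) (hi : i < h + v)
    (hs : x.source = F.cross i + i) : x.number = i := by
  have hset : {P ∈ F.crossings | x.crossing.2 < P.2}
      = F.crossPoint '' (Finset.Ioo 0 i : Finset ℕ) := by
    ext P
    rw [crossing, hs, F.gamma_source hp h0 hi]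
    simp only [Finset.coe_Ioo, Set.mem_image, Set.mem_Ioo, Set.mem_ofPred_eq,
      F.mem_crossings_iff hp]
    constructor
    · rintro ⟨⟨k, hk0, hk, rfl⟩, hlt⟩
      exact ⟨k, ⟨hk0, (F.crossPoint_height_lt_iff h0 hi hk0 hk).1 hlt⟩, rfl⟩
    · rintro ⟨k, ⟨hk0, hki⟩, rfl⟩
      exact ⟨⟨k, hk0, hki.trans hi, rfl⟩,
        (F.crossPoint_height_lt_iff h0 hi hk0 (hki.trans hi)).2 hki⟩
  have hinj : Set.InjOn F.crossPoint (Finset.Ioo 0 i : Finset ℕ) := by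
    intro a ha b hb hab
    simp only [Finset.coe_Ioo, Set.mem_Ioo] at ha hb
    have h1 := F.crossPoint_height_lt_iff ha.1 (ha.2.trans hi) hb.1 (hb.2.trans hi)
    have h2 := F.crossPoint_height_lt_iff hb.1 (hb.2.trans hi) ha.1 (ha.2.trans hi)
    rw [hab] at h1 h2
    simp only [lt_self_iff_false, false_iff, not_lt] at h1 h2
    omega
  rw [number, hset, hinj.ncard_image, Set.ncard_coe_finset, Nat.card_Ioo]
  omega

/-- The preferred generator at the `i`-th crossing in terms of its end points. -/
theorem isA_iff (hp : 0 < p) (hk : Int.gcd ((q : ℤ) - 1) p = 1) {x : F.ReebChord} {i : ℕ}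
    (h0 : 0 < i) (hi : i < h + v) :
    x.IsA i ↔ x.source = F.cross i + i ∧ x.sink = F.sinkParam i := by
  constructor
  · rintro ⟨hA, hn⟩
    obtain ⟨k, hk0, hkN, hs, ht⟩ := exists_index hp hk hA
    rw [number_eq hp hk0 hkN hs] at hn
    subst hn
    exact ⟨hs, ht⟩
  · rintro ⟨hs, ht⟩
    exact ⟨isAType_of_ends h0 hi hs ht, number_eq hp h0 hi hs⟩

end ReebChord

/-- The generator `a_i` exists if the Reeb flow for a time that is not a multiple of the period
takes the ascending strand of the crossing to the descending one. -/
theorem existsUnique_isA (hp : 0 < p) (hk : Int.gcd ((q : ℤ) - 1) p = 1) (hgrid : p ∣ h + v * q)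
    {i : ℕ} (h0 : 0 < i) (hi : i < h + v) {l : ℝ} (hl : l ∈ Set.Ioo (0 : ℝ) 1) (a M M' : ℤ)
    (hX : F.X (F.cross i + i + a * (h + v : ℕ)) + p * l = F.X (F.cross i) + p * M)
    (hY : F.Y (F.cross i + i + a * (h + v : ℕ)) + p * l = F.Y (F.cross i) + p * M') :
    (∃! x : F.ReebChord, x.IsA i) ∧ ∀ x : F.ReebChord, x.IsA i → x.length = l := by
  obtain ⟨b, hb⟩ := F.exists_sinkParam_eq i
  obtain ⟨c, hc⟩ := hgrid
  have hc' : (h : ℝ) + v * q = p * c := by exact_mod_cast hc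
  have hflow : reeb p q (2 * Real.pi * l) (F.knot (F.cross i + i)) = F.knot (F.sinkParam i) := by
    rw [F.reeb_knot_eq_iff hp]
    refine ⟨?_, (a + b) * v, M - (a + b) * c, M', ?_, ?_⟩
    · rw [hb, F.rSq_add_int_mul, ← F.rSq_cross h0 hi]
    · rw [F.X_add_int_mul] at hX
      rw [hb, F.X_add_int_mul]
      push_cast
      linear_combination hX - (a + b) * hc'
    · rw [F.Y_add_int_mul] at hY
      rw [hb, F.Y_add_int_mul]
      push_cast
      linear_combination hY
  let x : F.ReebChord := ⟨F.cross i + i, F.sinkParam i, l, F.sourceParam_mem h0 hi,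
    F.sinkParam_mem h0 hi, hl, hflow⟩
  have hx : x.IsA i := (ReebChord.isA_iff hp hk h0 hi).2 ⟨rfl, rfl⟩
  have huniq : ∀ y : F.ReebChord, y.IsA i → y = x := by
    intro y hy
    obtain ⟨hs, ht⟩ := (ReebChord.isA_iff hp hk h0 hi).1 hy
    exact ReebChord.ext_of_ends hp hk hs ht
  exact ⟨⟨x, hx, huniq⟩, fun y hy => by rw [huniq y hy]⟩

/-! ### The components of the complement of the Lagrangian projection -/

/-- The point with cylindrical coordinates `s` and `y` is not on `Γ`. -/
def Off (s y : ℝ) : Prop := ∀ i < h + v, y ≠ F.rSq (s + i)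

/-- The number of branches of `Γ` between the point with cylindrical coordinates `s` and `y` and the
north pole. -/
def depth (s y : ℝ) : ℕ := ((Finset.range (h + v)).filter fun i : ℕ => F.rSq (s + i) < y).card

theorem rSq_add_int_of_residue {a k : ℤ} {i : ℕ} (hk : a = i + k * (h + v : ℕ)) (s : ℝ) :
    F.rSq (s + a) = F.rSq (s + i) := by
  rw [hk]
  push_cast
  rw [← add_assoc]
  have := F.rSq_add_int_mul (s + i) k
  push_cast at this
  exact this

theorem Off.ne_int {F : SpecialFront p q h v} {s y : ℝ} (hN : 0 < h + v) (ho : F.Off s y) (a : ℤ) :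
    y ≠ F.rSq (s + a) := by
  obtain ⟨i, hi, k, hk⟩ := exists_residue hN a
  rw [F.rSq_add_int_of_residue hk]
  exact ho i hi

theorem Off.ne_nat {F : SpecialFront p q h v} {s y : ℝ} (hN : 0 < h + v) (ho : F.Off s y) (a : ℕ) :
    y ≠ F.rSq (s + a) := by
  simpa using ho.ne_int hN a

theorem Off.add_int {F : SpecialFront p q h v} {s y : ℝ} (hN : 0 < h + v) (ho : F.Off s y) (a : ℤ) :
    F.Off (s + a) y := by
  intro i _
  have := ho.ne_int hN (a + i)
  push_cast at this
  rwa [← add_assoc] at this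

theorem off_add_int_iff (hN : 0 < h + v) (s y : ℝ) (a : ℤ) : F.Off (s + a) y ↔ F.Off s y := by
  refine ⟨fun ho => ?_, fun ho => ho.add_int hN a⟩
  have := ho.add_int hN (-a)
  simpa using this

theorem count_periodic {P : ℕ → Prop} [DecidablePred P] {N : ℕ} (hP : ∀ n, P (n + N) ↔ P n)
    (u j : ℕ) : Nat.count P (u * N + j) = u * Nat.count P N + Nat.count P j := by
  have hu : ∀ u n, P (u * N + n) ↔ P n := by
    intro u
    induction u with
    | zero => simp
    | succ u ih =>
      intro n
      rw [← ih n, ← hP (u * N + n)]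
      ring_nf
  have h1 : ∀ u m, Nat.count P (u * N + m) = u * Nat.count P N + Nat.count P m := by
    intro u
    induction u with
    | zero => simp
    | succ u ih =>
      intro m
      rw [show (u + 1) * N + m = u * N + (N + m) by ring, ih, Nat.count_add]
      have : (fun k => P (N + k)) = P := by
        ext k
        rw [add_comm N k, hP]
      simp only [this]
      ring
  exact h1 u j

theorem depth_add_int (hN : 0 < h + v) (s y : ℝ) (a : ℤ) : F.depth (s + a) y = F.depth s y := by
  classical
  obtain ⟨r, -, k, hk⟩ := exists_residue hN a
  have h1 : F.depth (s + a) y = F.depth (s + r) y := by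
    unfold depth
    congr 1
    apply Finset.filter_congr
    intro i _
    have := F.rSq_add_int_of_residue (i := r + i) (a := a + i) (k := k)
      (by rw [hk]; push_cast; ring) s
    push_cast at this
    rw [add_assoc s, add_assoc s, this]
  rw [h1]
  set P : ℕ → Prop := fun i => F.rSq (s + i) < y with hP
  have hper : ∀ n, P (n + (h + v)) ↔ P n := by
    intro n
    simp only [hP]
    have := F.rSq_add_period (s + n)
    rw [Nat.cast_add, ← add_assoc, this]
  have h2 := Nat.count_add P r (h + v)
  have h3 := count_periodic hper 1 r
  rw [one_mul, one_mul, add_comm (h + v) r, h2] at h3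
  unfold depth
  rw [← Nat.count_eq_card_filter_range, ← Nat.count_eq_card_filter_range]
  have h4 : (fun i : ℕ => F.rSq (s + r + i) < y) = fun i => P (r + i) := by
    ext i
    simp only [hP]
    push_cast
    rw [add_assoc]
  simp only [h4]
  change _ = Nat.count P (h + v)
  omega

theorem depth_le (s y : ℝ) : F.depth s y ≤ h + v := by
  unfold depth
  exact (Finset.card_filter_le _ _).trans (by simp)

theorem off_zero (s : ℝ) : F.Off s 0 := fun _ _ => (F.rSq_pos _).ne

theorem off_one (s : ℝ) : F.Off s 1 := fun _ _ => (F.rSq_lt_one _).ne'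

theorem depth_zero (s : ℝ) : F.depth s 0 = 0 := by
  unfold depth
  rw [Finset.card_eq_zero, Finset.filter_eq_empty_iff]
  intro i _
  exact (F.rSq_pos _).le.not_gt

theorem depth_one (s : ℝ) : F.depth s 1 = h + v := by
  unfold depth
  rw [Finset.filter_true_of_mem fun i _ => F.rSq_lt_one _, Finset.card_range]

theorem off_depth_congr (hN : 0 < h + v) {s y s' y' : ℝ} (hy : y ∈ Set.Icc (0 : ℝ) 1)
    (he : spherePoint s y = spherePoint s' y') :
    (F.Off s y ↔ F.Off s' y') ∧ F.depth s y = F.depth s' y' := by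
  have hyy := spherePoint_height he
  subst hyy
  rcases hy.1.eq_or_lt with rfl | h0
  · exact ⟨⟨fun _ => F.off_zero _, fun _ => F.off_zero _⟩, by rw [F.depth_zero, F.depth_zero]⟩
  rcases hy.2.eq_or_lt with rfl | h1
  · exact ⟨⟨fun _ => F.off_one _, fun _ => F.off_one _⟩, by rw [F.depth_one, F.depth_one]⟩
  obtain ⟨-, k, rfl⟩ := spherePoint_inj ⟨h0, h1⟩ he
  exact ⟨F.off_add_int_iff hN _ _ _, F.depth_add_int hN _ _ _⟩

theorem spherePoint_mem_Gamma_iff (hp : 0 < p) (hN : 0 < h + v) {s y : ℝ} :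
    spherePoint s y ∈ F.Gamma ↔ ¬ F.Off s y := by
  constructor
  · rintro ⟨t, ht⟩ ho
    rw [F.gamma_eq hp] at ht
    obtain ⟨h1, k, hk⟩ := spherePoint_inj ⟨F.rSq_pos t, F.rSq_lt_one t⟩ ht
    apply ho.ne_int hN k
    rw [← hk, h1]
  · intro ho
    unfold Off at ho
    push Not at ho
    obtain ⟨i, -, hi⟩ := ho
    exact ⟨s + i, by rw [F.gamma_eq hp, ← hi, spherePoint_add_nat]⟩

/-- The points of the sphere off `Γ` whose depth is in the set `A`. -/
def levels (A : Set ℕ) : Set Space :=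
  {P | ∃ s, ∃ y ∈ Set.Icc (0 : ℝ) 1, P = spherePoint s y ∧ F.Off s y ∧ F.depth s y ∈ A}

theorem spherePoint_mem_levels_iff (hN : 0 < h + v) {s y : ℝ} (hy : y ∈ Set.Icc (0 : ℝ) 1)
    {A : Set ℕ} : spherePoint s y ∈ F.levels A ↔ F.Off s y ∧ F.depth s y ∈ A := by
  constructor
  · rintro ⟨s', y', hy', he, ho, hd⟩
    obtain ⟨h1, h2⟩ := F.off_depth_congr hN hy he
    exact ⟨h1.2 ho, by rwa [h2]⟩
  · rintro ⟨ho, hd⟩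
    exact ⟨s, y, hy, rfl, ho, hd⟩

/-- The depth is locally constant off `Γ`. -/
theorem isOpen_off_depth (A : Set ℕ) :
    IsOpen {c : ℝ × ℝ | F.Off c.1 c.2 ∧ F.depth c.1 c.2 ∈ A} := by
  rw [isOpen_iff_mem_nhds]
  rintro ⟨s, y⟩ ⟨ho, hd⟩
  have hc : ∀ i : ℕ, ContinuousAt (fun c : ℝ × ℝ => F.rSq (c.1 + i)) (s, y) := fun i =>
    (F.contDiff_rSq.continuous.comp
      (by fun_prop : Continuous fun c : ℝ × ℝ => c.1 + i)).continuousAt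
  have h1 : ∀ i ∈ Finset.range (h + v), ∀ᶠ c : ℝ × ℝ in nhds (s, y),
      c.2 ≠ F.rSq (c.1 + i) ∧ (F.rSq (c.1 + i) < c.2 ↔ F.rSq (s + i) < y) := by
    intro i hi
    rcases lt_or_gt_of_ne (ho i (Finset.mem_range.1 hi)) with hlt | hlt
    · filter_upwards [continuousAt_snd.eventually_lt (hc i) hlt] with c hc'
      exact ⟨hc'.ne, ⟨fun h => absurd h hc'.not_gt, fun h => absurd h hlt.not_gt⟩⟩
    · filter_upwards [(hc i).eventually_lt continuousAt_snd hlt] with c hc'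
      exact ⟨hc'.ne', ⟨fun _ => hlt, fun _ => hc'⟩⟩
  rw [← Filter.eventually_all_finset] at h1
  filter_upwards [h1] with c hc'
  refine ⟨fun i hi => (hc' i (Finset.mem_range.2 hi)).1, ?_⟩
  have : F.depth c.1 c.2 = F.depth s y := by
    unfold depth
    congr 1
    exact Finset.filter_congr fun i hi => (hc' i hi).2
  rw [this]
  exact hd

/-- The sets `levels A` are open in the sphere. -/
theorem exists_isOpen_levels (hN : 0 < h + v) (A : Set ℕ) :
    ∃ U, IsOpen U ∧ ∀ P ∈ sphere2, (P ∈ U ↔ P ∈ F.levels A) := by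
  set K : Set (ℝ × ℝ) := (Set.Icc (0 : ℝ) 1 ×ˢ Set.Icc (0 : ℝ) 1) \
    {c : ℝ × ℝ | F.Off c.1 c.2 ∧ F.depth c.1 c.2 ∈ A} with hK
  have hKc : IsCompact K := (isCompact_Icc.prod isCompact_Icc).diff (F.isOpen_off_depth A)
  refine ⟨((fun c : ℝ × ℝ => spherePoint c.1 c.2) '' K)ᶜ,
    (hKc.image continuous_spherePoint).isClosed.isOpen_compl, fun P hP => ?_⟩
  obtain ⟨s, hs, y, hy, rfl⟩ := exists_spherePoint hP 0
  rw [zero_add] at hs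
  constructor
  · intro h1
    by_contra h2
    rw [F.spherePoint_mem_levels_iff hN hy] at h2
    exact h1 ⟨(s, y), ⟨⟨⟨hs.1, hs.2.le⟩, hy⟩, h2⟩, rfl⟩
  · rintro h1 ⟨⟨s', y'⟩, ⟨⟨-, hy'⟩, h2⟩, he⟩
    apply h2
    simp only at he
    rw [← he, F.spherePoint_mem_levels_iff hN hy'] at h1
    exact h1

/-- If the branches `0, …, k - 1` are below the other ones, then a point of depth `k` is between
the two groups. -/
theorem between_of_depth_eq {k : ℕ} (hk : k ≤ h + v) {s y : ℝ} (ho : F.Off s y)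
    (hd : F.depth s y = k)
    (hord : ∀ i < k, ∀ j, k ≤ j → j < h + v → F.rSq (s + i) ≤ F.rSq (s + j)) :
    (∀ i < k, F.rSq (s + i) < y) ∧ ∀ j, k ≤ j → j < h + v → y < F.rSq (s + j) := by
  unfold depth at hd
  set T := (Finset.range (h + v)).filter fun i : ℕ => F.rSq (s + i) < y with hT
  have hmem : ∀ i, i ∈ T ↔ i < h + v ∧ F.rSq (s + i) < y := by
    intro i; rw [hT, Finset.mem_filter, Finset.mem_range]
  -- If a branch of the lower group is above the point, then so is the whole upper group, and fewer
  -- than `k` branches remain.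
  have hlow : ∀ i < k, F.rSq (s + i) < y := by
    by_contra hcon
    push Not at hcon
    obtain ⟨i, hi, hle⟩ := hcon
    have hsub : T ⊆ (Finset.range k).erase i := by
      intro m hm
      obtain ⟨hm1, hm2⟩ := (hmem m).1 hm
      rw [Finset.mem_erase, Finset.mem_range]
      constructor
      · rintro rfl; linarith
      · by_contra hmk
        have := hord i hi m (not_lt.1 hmk) hm1
        linarith
    have := Finset.card_le_card hsub
    rw [Finset.card_erase_of_mem (Finset.mem_range.2 hi), Finset.card_range, hd] at this
    omega
  refine ⟨hlow, fun j hkj hj => ?_⟩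
  have hsub : Finset.range k ⊆ T := fun i hi =>
    (hmem i).2 ⟨(Finset.mem_range.1 hi).trans_le hk, hlow i (Finset.mem_range.1 hi)⟩
  have heq := Finset.eq_of_subset_of_card_le hsub (by rw [hd, Finset.card_range])
  have hjT : j ∉ T := by rw [← heq, Finset.mem_range]; omega
  rw [hmem] at hjT
  push Not at hjT
  exact lt_of_le_of_ne (hjT hj) (ho j hj)

theorem depth_eq_of_between {k : ℕ} (hk : k ≤ h + v) {s y : ℝ} (hl : ∀ i < k, F.rSq (s + i) < y)
    (hu : ∀ j, k ≤ j → j < h + v → y < F.rSq (s + j)) : F.Off s y ∧ F.depth s y = k := by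
  constructor
  · intro i hi
    rcases lt_or_ge i k with h1 | h1
    · exact (hl i h1).ne'
    · exact (hu i h1 hi).ne
  · have : (Finset.range (h + v)).filter (fun i : ℕ => F.rSq (s + i) < y) = Finset.range k := by
      ext i
      rw [Finset.mem_filter, Finset.mem_range, Finset.mem_range]
      constructor
      · rintro ⟨h1, h2⟩
        by_contra h3
        exact absurd h2 (hu i (not_lt.1 h3) h1).not_gt
      · intro h1
        exact ⟨by omega, hl i h1⟩
    rw [depth, this, Finset.card_range]

/-- The region at the north pole is star-shaped. -/
theorem isPreconnected_levels_zero (hN : 0 < h + v) : IsPreconnected (F.levels {0}) := by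
  apply isPreconnected_of_forall northPole
  rintro P ⟨s, y, hy, rfl, ho, hd⟩
  obtain ⟨-, hu⟩ := F.between_of_depth_eq (Nat.zero_le _) ho hd (fun i hi => absurd hi (by omega))
  refine ⟨(fun y' => spherePoint s y') '' Set.Icc 0 y, ?_, ⟨0, ⟨le_rfl, hy.1⟩, spherePoint_zero s⟩,
    ⟨y, ⟨hy.1, le_rfl⟩, rfl⟩, ?_⟩
  · rintro _ ⟨y', hy', rfl⟩
    refine (F.spherePoint_mem_levels_iff hN ⟨hy'.1, hy'.2.trans hy.2⟩).2 ?_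
    exact F.depth_eq_of_between (Nat.zero_le _) (fun i hi => absurd hi (by omega))
      fun j hj hjN => hy'.2.trans_lt (hu j hj hjN)
  · exact isPreconnected_Icc.image _
      (continuous_spherePoint.comp (by fun_prop : Continuous fun y' : ℝ => (s, y'))).continuousOn

/-- The region at the south pole is star-shaped. -/
theorem isPreconnected_levels_last (hN : 0 < h + v) : IsPreconnected (F.levels {h + v}) := by
  apply isPreconnected_of_forall southPole
  rintro P ⟨s, y, hy, rfl, ho, hd⟩
  obtain ⟨hl, -⟩ := F.between_of_depth_eq le_rfl ho hd (fun i _ j h1 h2 => absurd h1 (by omega))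
  refine ⟨(fun y' => spherePoint s y') '' Set.Icc y 1, ?_, ⟨1, ⟨hy.2, le_rfl⟩, spherePoint_one s⟩,
    ⟨y, ⟨le_rfl, hy.2⟩, rfl⟩, ?_⟩
  · rintro _ ⟨y', hy', rfl⟩
    refine (F.spherePoint_mem_levels_iff hN ⟨hy.1.trans hy'.1, hy'.2⟩).2 ?_
    exact F.depth_eq_of_between le_rfl (fun i hi => (hl i hi).trans_le hy'.1)
      fun j hj hjN => absurd hj (by omega)
  · exact isPreconnected_Icc.image _
      (continuous_spherePoint.comp (by fun_prop : Continuous fun y' : ℝ => (s, y'))).continuousOn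

/-- For `0 < k < h + v`, the points of depth `k` form a strip between the branches `0, …, k - 1` and
the branches `k, …, h + v - 1`. The strip is pinched off at the `k`-th crossing, and so it is the
image of a rectangle. -/
theorem isPreconnected_levels_middle {k : ℕ} (h0 : 0 < k) (hk : k < h + v) :
    IsPreconnected (F.levels {k}) := by
  have hN : 0 < h + v := by omega
  have hne1 : (Finset.range k).Nonempty := ⟨0, Finset.mem_range.2 h0⟩
  have hne2 : (Finset.Ico k (h + v)).Nonempty := ⟨k, Finset.mem_Ico.2 ⟨le_rfl, hk⟩⟩
  set lo : ℝ → ℝ := fun s => (Finset.range k).sup' hne1 fun i => F.rSq (s + i) with hlo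
  set hi : ℝ → ℝ := fun s => (Finset.Ico k (h + v)).inf' hne2 fun i => F.rSq (s + i) with hhi
  have hcw : ∀ i : ℕ, Continuous fun s => F.rSq (s + i) := fun i =>
    F.contDiff_rSq.continuous.comp (by fun_prop)
  have hclo : Continuous lo := Continuous.finset_sup'_apply hne1 fun i _ => hcw i
  have hchi : Continuous hi := Continuous.finset_inf'_apply hne2 fun i _ => hcw i
  have hlohi : ∀ s ∈ Set.Ioo (F.cross k) (F.cross k + 1), lo s < hi s := by
    intro s hs
    rw [hlo, hhi, Finset.sup'_lt_iff]
    intro i hi'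
    rw [Finset.lt_inf'_iff]
    intro j hj
    rw [Finset.mem_Ico] at hj
    exact F.rSq_lower_lt_upper h0 hk hs (Finset.mem_range.1 hi') hj.1 hj.2
  have hlo0 : ∀ s, 0 < lo s := fun s =>
    (F.rSq_pos (s + (0 : ℕ))).trans_le (Finset.le_sup' (fun i : ℕ => F.rSq (s + i))
      (Finset.mem_range.2 h0))
  have hhi1 : ∀ s, hi s < 1 := fun s =>
    (Finset.inf'_le (fun i : ℕ => F.rSq (s + i)) (Finset.mem_Ico.2 ⟨le_rfl, hk⟩)).trans_lt
      (F.rSq_lt_one (s + k))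
  have himg : F.levels {k} =
      (fun c : ℝ × ℝ => spherePoint c.1 (lo c.1 + c.2 * (hi c.1 - lo c.1))) ''
      (Set.Ioo (F.cross k) (F.cross k + 1) ×ˢ Set.Ioo (0 : ℝ) 1) := by
    ext P
    constructor
    · rintro ⟨s', y, hy, rfl, ho', hd'⟩
      obtain ⟨s, hs, y₁, hy₁, he⟩ := exists_spherePoint (spherePoint_mem hy.1 hy.2) (F.cross k)
      obtain rfl := spherePoint_height he
      obtain ⟨h1, h2⟩ := F.off_depth_congr hN hy he
      have ho := h1.1 ho'
      have hd : F.depth s y = k := h2 ▸ hd'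
      obtain ⟨hl, hu⟩ := F.between_of_depth_eq hk.le ho hd fun i hi' j hkj hj =>
        F.rSq_lower_le_upper h0 hk ⟨hs.1, hs.2.le⟩ hi' hkj hj
      have hs1 : F.cross k < s := by
        refine lt_of_le_of_ne hs.1 fun hcs => ?_
        have h3 := hl 0 h0
        have h4 := hu k le_rfl hk
        rw [← hcs, Nat.cast_zero, add_zero, F.rSq_cross h0 hk] at h3
        rw [← hcs] at h4
        linarith
      have hloy : lo s < y := by
        rw [hlo, Finset.sup'_lt_iff]
        exact fun i hi' => hl i (Finset.mem_range.1 hi')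
      have hyhi : y < hi s := by
        rw [hhi, Finset.lt_inf'_iff]
        intro j hj
        rw [Finset.mem_Ico] at hj
        exact hu j hj.1 hj.2
      have hpos : 0 < hi s - lo s := by linarith
      refine ⟨(s, (y - lo s) / (hi s - lo s)), ⟨⟨hs1, hs.2⟩, ?_, ?_⟩, ?_⟩
      · exact div_pos (by linarith) hpos
      · rw [div_lt_one hpos]; linarith
      · simp only
        rw [div_mul_cancel₀ _ hpos.ne', add_sub_cancel, he]
    · rintro ⟨⟨s, τ⟩, ⟨hs, hτ⟩, rfl⟩
      simp only at hs hτ ⊢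
      have h1 := hlohi s hs
      have h2 : lo s < lo s + τ * (hi s - lo s) := by nlinarith [hτ.1]
      have h3 : lo s + τ * (hi s - lo s) < hi s := by nlinarith [hτ.2]
      refine (F.spherePoint_mem_levels_iff hN ⟨by linarith [hlo0 s], by linarith [hhi1 s]⟩).2 ?_
      refine F.depth_eq_of_between hk.le (fun i hi' => ?_) fun j hkj hj => ?_
      · exact (Finset.le_sup' (fun i : ℕ => F.rSq (s + i)) (Finset.mem_range.2 hi')).trans_lt h2
      · exact h3.trans_le (Finset.inf'_le (fun i : ℕ => F.rSq (s + i)) (Finset.mem_Ico.2 ⟨hkj, hj⟩))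
  rw [himg]
  refine (isPreconnected_Ioo.prod isPreconnected_Ioo).image _ (Continuous.continuousOn ?_)
  exact continuous_spherePoint.comp (f := fun c : ℝ × ℝ => (c.1, lo c.1 + c.2 * (hi c.1 - lo c.1)))
    (by fun_prop)

theorem isPreconnected_levels (hN : 0 < h + v) {k : ℕ} (hk : k ≤ h + v) :
    IsPreconnected (F.levels {k}) := by
  rcases Nat.eq_zero_or_pos k with rfl | h0
  · exact F.isPreconnected_levels_zero hN
  rcases hk.eq_or_lt with rfl | hk
  · exact F.isPreconnected_levels_last hN
  · exact F.isPreconnected_levels_middle h0 hk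

theorem levels_subset (hp : 0 < p) (hN : 0 < h + v) (A : Set ℕ) :
    F.levels A ⊆ sphere2 \ F.Gamma := by
  rintro P ⟨s, y, hy, rfl, ho, -⟩
  refine ⟨spherePoint_mem hy.1 hy.2, ?_⟩
  rw [F.spherePoint_mem_Gamma_iff hp hN, not_not]
  exact ho

theorem connectedComponentIn_levels (hp : 0 < p) (hN : 0 < h + v) {k : ℕ} (hk : k ≤ h + v)
    {P : Space} (hP : P ∈ F.levels {k}) :
    connectedComponentIn (sphere2 \ F.Gamma) P = F.levels {k} := by
  apply Set.Subset.antisymm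
  · obtain ⟨U, hU, hU'⟩ := F.exists_isOpen_levels hN {k}
    obtain ⟨W, hW, hW'⟩ := F.exists_isOpen_levels hN {k}ᶜ
    have hsub := connectedComponentIn_subset (sphere2 \ F.Gamma) P
    have hdisj : connectedComponentIn (sphere2 \ F.Gamma) P ∩ (U ∩ W) = ∅ := by
      rw [Set.eq_empty_iff_forall_notMem]
      rintro Q ⟨hQ, hQU, hQW⟩
      have hQs := (hsub hQ).1
      obtain ⟨s, -, y, hy, rfl⟩ := exists_spherePoint hQs 0
      rw [hU' _ hQs, F.spherePoint_mem_levels_iff hN hy] at hQU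
      rw [hW' _ hQs, F.spherePoint_mem_levels_iff hN hy] at hQW
      exact hQW.2 hQU.2
    have hcov : connectedComponentIn (sphere2 \ F.Gamma) P ⊆ U ∪ W := by
      intro Q hQ
      have hQs := hsub hQ
      obtain ⟨s, -, y, hy, rfl⟩ := exists_spherePoint hQs.1 0
      have ho := not_not.1 (mt (F.spherePoint_mem_Gamma_iff hp hN).2 hQs.2)
      by_cases hd : F.depth s y ∈ ({k} : Set ℕ)
      · exact Or.inl ((hU' _ hQs.1).2 ((F.spherePoint_mem_levels_iff hN hy).2 ⟨ho, hd⟩))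
      · exact Or.inr ((hW' _ hQs.1).2 ((F.spherePoint_mem_levels_iff hN hy).2 ⟨ho, hd⟩))
    have hPs := F.levels_subset hp hN _ hP
    rcases isPreconnected_iff_subset_of_disjoint.1 isPreconnected_connectedComponentIn U W hU hW
      hcov hdisj with h1 | h1
    · exact fun Q hQ => (hU' _ (hsub hQ).1).1 (h1 hQ)
    · exfalso
      have hPc := mem_connectedComponentIn hPs
      rw [Set.eq_empty_iff_forall_notMem] at hdisj
      exact hdisj P ⟨hPc, (hU' _ hPs.1).2 hP, h1 hPc⟩
  · exact (F.isPreconnected_levels hN hk).subset_connectedComponentIn hP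
      (F.levels_subset hp hN _)

/-- All depths up to `h + v` occur, between consecutive levels. -/
theorem exists_depth_eq {k : ℕ} (hk : k ≤ h + v) :
    ∃ y ∈ Set.Ioo (0 : ℝ) 1, F.Off (1 / 2) y ∧ F.depth (1 / 2) y = k := by
  have hlev : ∀ i : ℕ, F.rSq (1 / 2 + i) = F.level i := fun i => by rw [level, add_comm]
  have hpos : ∀ i, 0 < F.level i := fun i => F.rSq_pos _
  have hlt : ∀ i, F.level i < 1 := fun i => F.rSq_lt_one _
  suffices hs : ∃ y ∈ Set.Ioo (0 : ℝ) 1, (∀ i < k, F.level i < y) ∧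
      ∀ j, k ≤ j → j < h + v → y < F.level j by
    obtain ⟨y, hy, hl, hu⟩ := hs
    refine ⟨y, hy, F.depth_eq_of_between hk (fun i hi => ?_) fun j hkj hj => ?_⟩
    · rw [hlev]; exact hl i hi
    · rw [hlev]; exact hu j hkj hj
  rcases Nat.eq_zero_or_pos k with rfl | h0
  · refine ⟨F.level 0 / 2, ⟨by linarith [hpos 0], by linarith [hlt 0]⟩,
      fun i hi => absurd hi (by omega), fun j _ hj => ?_⟩
    linarith [F.level_le (Nat.zero_le j) hj, hpos 0]
  obtain ⟨m, rfl⟩ := Nat.exists_eq_succ_of_ne_zero h0.ne'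
  rcases hk.eq_or_lt with hkN | hkN
  · refine ⟨(F.level m + 1) / 2, ⟨by linarith [hpos m], by linarith [hlt m]⟩, fun i hi => ?_,
      fun j hkj hj => absurd hj (by omega)⟩
    linarith [F.level_le (Nat.lt_succ_iff.1 hi) (by omega), hlt m]
  · have hmm := F.level_lt (Nat.lt_succ_self m) hkN
    refine ⟨(F.level m + F.level (m + 1)) / 2,
      ⟨by linarith [hpos m, hpos (m + 1)], by linarith [hlt m, hlt (m + 1)]⟩, fun i hi => ?_,
      fun j hkj hj => ?_⟩
    · have := F.level_le (Nat.lt_succ_iff.1 hi) (by omega)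
      simp only [Nat.succ_eq_add_one] at hmm
      linarith
    · have := F.level_le hkj hj
      simp only [Nat.succ_eq_add_one] at hmm this
      linarith

theorem injOn_levels (hN : 0 < h + v) :
    Set.InjOn (fun k : ℕ => F.levels {k}) (Finset.range (h + v + 1) : Finset ℕ) := by
  intro k hk k' _ heq
  rw [Finset.coe_range, Set.mem_Iio] at hk
  obtain ⟨y, hy, ho, hd⟩ := F.exists_depth_eq (Nat.lt_succ_iff.1 hk)
  have hy' : y ∈ Set.Icc (0 : ℝ) 1 := Set.Ioo_subset_Icc_self hy
  have h1 : spherePoint (1 / 2) y ∈ F.levels {k} :=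
    (F.spherePoint_mem_levels_iff hN hy').2 ⟨ho, hd⟩
  simp only at heq
  rw [heq, F.spherePoint_mem_levels_iff hN hy'] at h1
  exact hd.symm.trans h1.2

/-- The components of the complement of `Γ` are the sets of constant depth. -/
theorem regions_eq (hp : 0 < p) (hN : 0 < h + v) :
    F.regions = (fun k : ℕ => F.levels {k}) '' (Finset.range (h + v + 1) : Finset ℕ) := by
  ext R
  simp only [regions, Set.mem_ofPred_eq, Finset.coe_range, Set.mem_image, Set.mem_Iio]
  constructor
  · rintro ⟨P, hP, rfl⟩
    obtain ⟨s, -, y, hy, rfl⟩ := exists_spherePoint hP.1 0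
    have ho := not_not.1 (mt (F.spherePoint_mem_Gamma_iff hp hN).2 hP.2)
    have hk := F.depth_le s y
    exact ⟨F.depth s y, Nat.lt_succ_iff.2 hk, (F.connectedComponentIn_levels hp hN hk
      ((F.spherePoint_mem_levels_iff hN hy).2 ⟨ho, rfl⟩)).symm⟩
  · rintro ⟨k, hk, rfl⟩
    obtain ⟨y, hy, ho, hd⟩ := F.exists_depth_eq (Nat.lt_succ_iff.1 hk)
    have hP : spherePoint (1 / 2) y ∈ F.levels {k} :=
      (F.spherePoint_mem_levels_iff hN (Set.Ioo_subset_Icc_self hy)).2 ⟨ho, hd⟩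
    exact ⟨_, F.levels_subset hp hN _ hP,
      (F.connectedComponentIn_levels hp hN (Nat.lt_succ_iff.1 hk) hP).symm⟩

/-- If the number of preimages of points away from the poles and from `Γ` depends only on the depth,
then it is the multiplicity of the regions. By periodicity it is enough to consider azimuths in one
fundamental domain. -/
theorem multiplicity_levels (hN : 0 < h + v) {f : ℂ → Space} {M : ℕ → ℕ} {s₀ : ℝ}
    (hf : ∀ s ∈ Set.Icc s₀ (s₀ + 1), ∀ y ∈ Set.Ioo (0 : ℝ) 1, F.Off s y →
      {z ∈ disc | f z = spherePoint s y}.ncard = M (F.depth s y)) {k : ℕ} (hk : k ≤ h + v) :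
    multiplicity f (F.levels {k}) = M k := by
  have himg : (fun P => {z ∈ disc | f z = P}.ncard) '' (F.levels {k} \ {northPole, southPole})
      = {M k} := by
    apply Set.eq_singleton_iff_nonempty_unique_mem.2
    constructor
    · obtain ⟨y, hy, ho, hd⟩ := F.exists_depth_eq hk
      refine Set.Nonempty.image _ ⟨spherePoint (1 / 2) y,
        (F.spherePoint_mem_levels_iff hN (Set.Ioo_subset_Icc_self hy)).2 ⟨ho, hd⟩, ?_⟩
      rintro (hn | hn)
      · rw [← spherePoint_zero (1 / 2)] at hn
        exact hy.1.ne' (spherePoint_height hn)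
      · rw [Set.mem_singleton_iff, ← spherePoint_one (1 / 2)] at hn
        exact hy.2.ne (spherePoint_height hn)
    · rintro _ ⟨P, ⟨⟨s', y, hy, rfl, ho', hd'⟩, hpole⟩, rfl⟩
      obtain ⟨s, hs, y₁, -, he⟩ := exists_spherePoint (spherePoint_mem (s := s') hy.1 hy.2) s₀
      obtain rfl := spherePoint_height he
      obtain ⟨h1, h2⟩ := F.off_depth_congr hN hy he
      have hy0 : y ≠ 0 := by
        rintro rfl
        exact hpole (Or.inl (spherePoint_zero s'))
      have hy1 : y ≠ 1 := by
        rintro rfl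
        exact hpole (Or.inr (spherePoint_one s'))
      simp only
      rw [he, hf s ⟨hs.1, hs.2.le⟩ y ⟨lt_of_le_of_ne hy.1 hy0.symm, lt_of_le_of_ne hy.2 hy1⟩
        (h1.1 ho'), ← h2]
      exact congrArg M hd'
  rw [multiplicity, himg, csSup_singleton]

/-! ### The corners of the regions -/

/-- The depth of the region that fills a quadrant at the `i`-th crossing. -/
def quadrantDepth (i : ℕ) : Quadrant → ℕ
  | .north => i - 1
  | .east => i
  | .south => i + 1
  | .west => i

/-- Near the `i`-th crossing the other branches stay on their sides. -/
theorem exists_other_branches {i : ℕ} (h0 : 0 < i) (hi : i < h + v) :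
    ∃ δ > 0, ∀ r y : ℝ, |r| < δ → |y - F.crossHeight i| < δ → ∀ k < h + v, 0 < k → k ≠ i →
      (k < i → F.rSq (F.cross i + r + k) < y) ∧ (i < k → y < F.rSq (F.cross i + r + k)) := by
  have hc := F.cross_mem h0 hi
  have hcont : ∀ k : ℕ, ContinuousAt (fun c : ℝ × ℝ => F.rSq (F.cross i + c.1 + k))
      (0, F.crossHeight i) := fun k =>
    (F.contDiff_rSq.continuous.comp (by fun_prop : Continuous fun c : ℝ × ℝ =>
      F.cross i + c.1 + k)).continuousAt
  have h1 : ∀ k ∈ Finset.range (h + v), ∀ᶠ c : ℝ × ℝ in nhds (0, F.crossHeight i), 0 < k → k ≠ i →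
      (k < i → F.rSq (F.cross i + c.1 + k) < c.2) ∧
      (i < k → c.2 < F.rSq (F.cross i + c.1 + k)) := by
    intro k hk
    rw [Finset.mem_range] at hk
    by_cases hk0 : 0 < k ∧ k ≠ i
    swap
    · exact Filter.Eventually.of_forall fun c h2 h3 => absurd ⟨h2, h3⟩ hk0
    rcases lt_or_gt_of_ne hk0.2 with hlt | hlt
    · have h2 : F.rSq (F.cross i + 0 + k) < F.crossHeight i := by
        rw [add_zero, crossHeight, F.rSq_cross h0 hi]
        exact F.rSq_branch_lt hk0.1 hlt hi hc.1.le hc.2.le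
      filter_upwards [(hcont k).eventually_lt continuousAt_snd h2] with c hc' _ _
      exact ⟨fun _ => hc', fun h3 => absurd h3 (by omega)⟩
    · have h2 : F.crossHeight i < F.rSq (F.cross i + 0 + k) := by
        rw [add_zero, crossHeight, F.rSq_cross h0 hi]
        exact F.rSq_branch_lt h0 hlt hk hc.1.le hc.2.le
      filter_upwards [continuousAt_snd.eventually_lt (hcont k) h2] with c hc' _ _
      exact ⟨fun h3 => absurd h3 (by omega), fun _ => hc'⟩
  rw [← Filter.eventually_all_finset] at h1
  obtain ⟨δ, hδ, hball⟩ := Metric.eventually_nhds_iff.1 h1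
  refine ⟨δ, hδ, fun r y hr hy k hk => ?_⟩
  refine hball (y := (r, y)) ?_ k (Finset.mem_range.2 hk)
  rw [Prod.dist_eq, max_lt_iff, Real.dist_eq, Real.dist_eq]
  exact ⟨by simpa using hr, hy⟩

/-- Near the `i`-th crossing the branches `1, …, i - 1` are above a point and the branches beyond
`i` below it on the sphere, so the depth depends on the two strands of the crossing only. -/
theorem depth_near_cross {i : ℕ} (h0 : 0 < i) (hi : i < h + v) {s y : ℝ}
    (hoth : ∀ k < h + v, 0 < k → k ≠ i →
      (k < i → F.rSq (s + k) < y) ∧ (i < k → y < F.rSq (s + k)))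
    (hs : y ≠ F.rSq s) (hsi : y ≠ F.rSq (s + i)) :
    F.Off s y ∧ F.depth s y = i - 1 + (if F.rSq s < y then 1 else 0)
      + (if F.rSq (s + i) < y then 1 else 0) := by
  have key : ∀ k < h + v, y ≠ F.rSq (s + k) ∧ (F.rSq (s + k) < y ↔
      (k = 0 ∧ F.rSq s < y) ∨ (0 < k ∧ k < i) ∨ (k = i ∧ F.rSq (s + i) < y)) := by
    intro k hk
    rcases Nat.eq_zero_or_pos k with rfl | hk0
    · rw [Nat.cast_zero, add_zero]
      refine ⟨hs, ⟨fun h1 => Or.inl ⟨rfl, h1⟩, ?_⟩⟩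
      rintro (⟨-, h1⟩ | ⟨h1, -⟩ | ⟨h1, -⟩)
      · exact h1
      · omega
      · omega
    · rcases eq_or_ne k i with rfl | hki
      · refine ⟨hsi, ⟨fun h1 => Or.inr (Or.inr ⟨rfl, h1⟩), ?_⟩⟩
        rintro (⟨h1, -⟩ | ⟨-, h1⟩ | ⟨-, h1⟩)
        · omega
        · omega
        · exact h1
      · obtain ⟨h1, h2⟩ := hoth k hk hk0 hki
        rcases lt_or_gt_of_ne hki with hlt | hlt
        · exact ⟨(h1 hlt).ne', ⟨fun _ => Or.inr (Or.inl ⟨hk0, hlt⟩), fun _ => h1 hlt⟩⟩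
        · refine ⟨(h2 hlt).ne, ⟨fun h3 => absurd h3 (h2 hlt).not_gt, ?_⟩⟩
          rintro (⟨h3, -⟩ | ⟨-, h3⟩ | ⟨h3, -⟩) <;> omega
  refine ⟨fun k hk => (key k hk).1, ?_⟩
  unfold depth
  have hfil : (Finset.range (h + v)).filter (fun k : ℕ => F.rSq (s + k) < y) =
      (Finset.range (h + v)).filter fun k : ℕ => (k = 0 ∧ F.rSq s < y) ∨ (0 < k ∧ k < i) ∨
        (k = i ∧ F.rSq (s + i) < y) :=
    Finset.filter_congr fun k hk => (key k (Finset.mem_range.1 hk)).2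
  rw [hfil]
  by_cases ha : F.rSq s < y <;> by_cases hb : F.rSq (s + i) < y
  · rw [if_pos ha, if_pos hb, show i - 1 + 1 + 1 = (Finset.range (i + 1)).card by simp; omega]
    congr 1
    ext k
    simp only [Finset.mem_filter, Finset.mem_range, ha, hb, and_true]
    omega
  · rw [if_pos ha, if_neg hb, show i - 1 + 1 + 0 = (Finset.range i).card by simp; omega]
    congr 1
    ext k
    simp only [Finset.mem_filter, Finset.mem_range, ha, hb, and_true, and_false, or_false]
    omega
  · rw [if_neg ha, if_pos hb, show i - 1 + 0 + 1 = (Finset.Ioc 0 i).card by simp; omega]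
    congr 1
    ext k
    simp only [Finset.mem_filter, Finset.mem_range, Finset.mem_Ioc, ha, hb, and_true,
      and_false, false_or]
    omega
  · rw [if_neg ha, if_neg hb, show i - 1 + 0 + 0 = (Finset.Ioo 0 i).card by simp]
    congr 1
    ext k
    simp only [Finset.mem_filter, Finset.mem_range, Finset.mem_Ioo, ha, hb, and_false, or_false,
      false_or]
    omega

namespace ReebChord

variable {F}

theorem rSq_sink_add {x : F.ReebChord} {i : ℕ} (ht : x.sink = F.sinkParam i) (r : ℝ) :
    F.rSq (x.sink + r) = F.rSq (F.cross i + r) := by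
  obtain ⟨b, hb⟩ := F.exists_sinkParam_eq i
  rw [ht, hb, add_right_comm, F.rSq_add_int_mul]

theorem crossing_eq (hp : 0 < p) {x : F.ReebChord} {i : ℕ} (h0 : 0 < i) (hi : i < h + v)
    (hs : x.source = F.cross i + i) : x.crossing = F.crossPoint i := by
  rw [crossing, hs, F.gamma_source hp h0 hi]

/-- The four quadrants at the `i`-th crossing have the depths `i - 1`, `i`, `i + 1`, `i`. -/
theorem exists_quadrant_subset (hp : 0 < p) {x : F.ReebChord} {i : ℕ} (h0 : 0 < i)
    (hi : i < h + v) (hs : x.source = F.cross i + i) (ht : x.sink = F.sinkParam i) (Q : Quadrant) :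
    ∃ V ∈ nhds x.crossing, x.quadrant Q ∩ V ⊆ F.levels {quadrantDepth i Q} := by
  have hN : 0 < h + v := by omega
  obtain ⟨δ, hδ, hoth⟩ := F.exists_other_branches h0 hi
  have hy0 : F.crossHeight i ∈ Set.Ioo (0 : ℝ) 1 := ⟨F.rSq_pos _, F.rSq_lt_one _⟩
  obtain ⟨V, hV, hloc⟩ := exists_nhds_spherePoint (F.cross i) hy0 hδ
  refine ⟨V, by rw [crossing_eq hp h0 hi hs]; exact hV, ?_⟩
  -- all quadrants are treated alike: the depth depends on the sides of the two strands
  have key : ∀ r ∈ Set.Icc (-1 / 2 : ℝ) (1 / 2), ∀ w ∈ Set.Ioo (0 : ℝ) 1,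
      spherePoint (x.source + r) w ∈ V → w ≠ F.rSq (x.sink + r) → w ≠ F.rSq (x.source + r) →
      i - 1 + (if F.rSq (x.sink + r) < w then 1 else 0)
        + (if F.rSq (x.source + r) < w then 1 else 0) = quadrantDepth i Q →
      spherePoint (x.source + r) w ∈ F.levels {quadrantDepth i Q} := by
    intro r hr w hw hmem h1 h2 h3
    have hsr : x.source + r = F.cross i + r + i := by rw [hs]; ring
    rw [rSq_sink_add ht] at h1 h3
    rw [hsr] at hmem h2 h3 ⊢
    rw [spherePoint_add_nat] at hmem ⊢
    obtain ⟨hr', hw'⟩ := hloc r hr w (Set.Ioo_subset_Icc_self hw) hmem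
    obtain ⟨ho, hd⟩ := F.depth_near_cross h0 hi (hoth r w hr' hw') h1 h2
    exact (F.spherePoint_mem_levels_iff hN (Set.Ioo_subset_Icc_self hw)).2 ⟨ho, hd.trans h3⟩
  cases Q with
  | north =>
    rintro _ ⟨⟨r, hr, w, hw, rfl, h1, h2⟩, hPV⟩
    refine key r (Set.Ioo_subset_Icc_self hr) w hw hPV h2.ne h1.ne ?_
    rw [if_neg h2.not_gt, if_neg h1.not_gt]
    rfl
  | south =>
    rintro _ ⟨⟨r, hr, w, hw, rfl, h1, h2⟩, hPV⟩
    refine key r (Set.Ioo_subset_Icc_self hr) w hw hPV h2.ne' h1.ne' ?_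
    rw [if_pos h2, if_pos h1, quadrantDepth]
    omega
  | east =>
    rintro _ ⟨⟨r, hr, w, hw, rfl, h1, h2⟩, hPV⟩
    refine key r ⟨by linarith [hr.1], hr.2.le⟩ w hw hPV ?_ ?_ ?_ <;>
      rcases le_total (F.rSq (x.source + r)) (F.rSq (x.sink + r)) with hle | hle
    · rw [max_eq_right hle] at h2; exact h2.ne
    · rw [min_eq_right hle] at h1; exact h1.ne'
    · rw [min_eq_left hle] at h1; exact h1.ne'
    · rw [max_eq_left hle] at h2; exact h2.ne
    · rw [max_eq_right hle] at h2
      rw [min_eq_left hle] at h1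
      rw [if_neg h2.not_gt, if_pos h1, quadrantDepth]
      omega
    · rw [max_eq_left hle] at h2
      rw [min_eq_right hle] at h1
      rw [if_pos h1, if_neg h2.not_gt, quadrantDepth]
      omega
  | west =>
    rintro _ ⟨⟨r, hr, w, hw, rfl, h1, h2⟩, hPV⟩
    refine key r ⟨hr.1.le, by linarith [hr.2]⟩ w hw hPV ?_ ?_ ?_ <;>
      rcases le_total (F.rSq (x.source + r)) (F.rSq (x.sink + r)) with hle | hle
    · rw [max_eq_right hle] at h2; exact h2.ne
    · rw [min_eq_right hle] at h1; exact h1.ne'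
    · rw [min_eq_left hle] at h1; exact h1.ne'
    · rw [max_eq_left hle] at h2; exact h2.ne
    · rw [max_eq_right hle] at h2
      rw [min_eq_left hle] at h1
      rw [if_neg h2.not_gt, if_pos h1, quadrantDepth]
      omega
    · rw [max_eq_left hle] at h2
      rw [min_eq_right hle] at h1
      rw [if_pos h1, if_neg h2.not_gt, quadrantDepth]
      omega

theorem quadrant_inter_nonempty (hp : 0 < p) {x : F.ReebChord} {i : ℕ} (h0 : 0 < i)
    (hi : i < h + v) (hs : x.source = F.cross i + i) (ht : x.sink = F.sinkParam i) (Q : Quadrant)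
    {V : Set Space} (hV : V ∈ nhds x.crossing) : (x.quadrant Q ∩ V).Nonempty := by
  have hc := F.cross_mem h0 hi
  have hε := F.ε_lt
  set y₀ := F.crossHeight i with hy₀
  have hy0 : y₀ ∈ Set.Ioo (0 : ℝ) 1 := ⟨F.rSq_pos _, F.rSq_lt_one _⟩
  have hcr : x.crossing = spherePoint x.source y₀ := by
    rw [crossing_eq hp h0 hi hs, hs, spherePoint_add_nat, crossPoint]
  have e1 : F.rSq (x.source + 0) = y₀ := by
    rw [add_zero, hs, hy₀, crossHeight, F.rSq_cross h0 hi]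
  have e2 : F.rSq (x.sink + 0) = y₀ := by rw [rSq_sink_add ht, add_zero]; rfl
  have hcs : Continuous fun t => F.rSq (x.source + t) :=
    F.contDiff_rSq.continuous.comp (by fun_prop)
  have hct : Continuous fun t => F.rSq (x.sink + t) :=
    F.contDiff_rSq.continuous.comp (by fun_prop)
  have hcv : Continuous fun t => spherePoint x.source (y₀ + t) :=
    continuous_spherePoint.comp (by fun_prop : Continuous fun t : ℝ => (x.source, y₀ + t))
  have hV1 : ∀ᶠ t in nhds (0 : ℝ), spherePoint x.source (y₀ + t) ∈ V := by
    refine hcv.continuousAt.eventually_mem ?_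
    rw [add_zero, ← hcr]
    exact hV
  have hcm : Continuous fun t => spherePoint (x.source + t)
      ((F.rSq (x.source + t) + F.rSq (x.sink + t)) / 2) :=
    continuous_spherePoint.comp (f := fun t : ℝ => (x.source + t,
      (F.rSq (x.source + t) + F.rSq (x.sink + t)) / 2)) (by fun_prop)
  have hV2 : ∀ᶠ t in nhds (0 : ℝ), spherePoint (x.source + t)
      ((F.rSq (x.source + t) + F.rSq (x.sink + t)) / 2) ∈ V := by
    refine hcm.continuousAt.eventually_mem ?_
    rw [e1, e2, add_zero, add_self_div_two, ← hcr]
    exact hV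
  have hmid : ∀ t, (F.rSq (x.source + t) + F.rSq (x.sink + t)) / 2 ∈ Set.Ioo (0 : ℝ) 1 := fun t =>
    ⟨by linarith [F.rSq_pos (x.source + t), F.rSq_pos (x.sink + t)],
      by linarith [F.rSq_lt_one (x.source + t), F.rSq_lt_one (x.sink + t)]⟩
  have hbetween : ∀ a b : ℝ, a ≠ b → (a + b) / 2 ∈ Set.Ioo (min a b) (max a b) := by
    intro a b hab
    rcases lt_or_gt_of_ne hab with hlt | hlt
    · rw [min_eq_left hlt.le, max_eq_right hlt.le]
      constructor <;> linarith
    · rw [min_eq_right hlt.le, max_eq_left hlt.le]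
      constructor <;> linarith
  have hsr : ∀ t, F.rSq (x.source + t) = F.rSq (F.cross i + t + i) := by
    intro t; rw [hs]; congr 1; ring
  cases Q with
  | north =>
    obtain ⟨t, ht1, ht2, ht3⟩ := ((Filter.Eventually.and (nhdsWithin_le_nhds hV1)
      ((Filter.eventually_of_mem (Ioo_mem_nhdsLT (neg_lt_zero.2 hy0.1))
        fun t ht => ht) : ∀ᶠ t in nhdsWithin (0 : ℝ) (Set.Iio 0), t ∈ Set.Ioo (-y₀) 0)).exists)
    refine ⟨_, ⟨0, by norm_num, y₀ + t, ⟨by linarith, by linarith [hy0.2]⟩,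
      by rw [add_zero], ?_, ?_⟩, ht1⟩
    · rw [e1]; linarith
    · rw [e2]; linarith
  | south =>
    obtain ⟨t, ht1, ht2, ht3⟩ := ((Filter.Eventually.and (nhdsWithin_le_nhds hV1)
      ((Filter.eventually_of_mem (Ioo_mem_nhdsGT (sub_pos.2 hy0.2))
        fun t ht => ht) : ∀ᶠ t in nhdsWithin (0 : ℝ) (Set.Ioi 0), t ∈ Set.Ioo 0 (1 - y₀))).exists)
    refine ⟨_, ⟨0, by norm_num, y₀ + t, ⟨by linarith [hy0.1], by linarith⟩,
      by rw [add_zero], ?_, ?_⟩, ht1⟩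
    · rw [e1]; linarith
    · rw [e2]; linarith
  | east =>
    have hpos : 0 < min (1 / 2) (F.ε - F.cross i) := lt_min (by norm_num) (by linarith [hc.2])
    obtain ⟨t, ht1, ht2, ht3⟩ := ((Filter.Eventually.and (nhdsWithin_le_nhds hV2)
      ((Filter.eventually_of_mem (Ioo_mem_nhdsGT hpos) fun t ht => ht) :
        ∀ᶠ t in nhdsWithin (0 : ℝ) (Set.Ioi 0), t ∈ Set.Ioo 0 _)).exists)
    rw [lt_min_iff] at ht3
    refine ⟨_, ⟨t, ⟨ht2, ht3.1⟩, _, hmid t, rfl, hbetween _ _ ?_⟩, ht1⟩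
    rw [hsr, rSq_sink_add ht]
    exact (F.zero_branch_lt_branch h0 hi (by linarith) (by linarith)).ne'
  | west =>
    have hneg : max (-1 / 2) (-F.ε - F.cross i) < 0 := max_lt (by norm_num) (by linarith [hc.1])
    obtain ⟨t, ht1, ht2, ht3⟩ := ((Filter.Eventually.and (nhdsWithin_le_nhds hV2)
      ((Filter.eventually_of_mem (Ioo_mem_nhdsLT hneg) fun t ht => ht) :
        ∀ᶠ t in nhdsWithin (0 : ℝ) (Set.Iio 0), t ∈ Set.Ioo _ 0)).exists)
    rw [max_lt_iff] at ht2
    refine ⟨_, ⟨t, ⟨ht2.1, ht3⟩, _, hmid t, rfl, hbetween _ _ ?_⟩, ht1⟩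
    rw [hsr, rSq_sink_add ht]
    exact (F.branch_lt_zero_branch h0 hi (by linarith) (by linarith)).ne

theorem regionFills_iff (hp : 0 < p) {x : F.ReebChord} {i : ℕ} (h0 : 0 < i)
    (hi : i < h + v) (hs : x.source = F.cross i + i) (ht : x.sink = F.sinkParam i) (Q : Quadrant)
    (k : ℕ) : F.RegionFills (F.levels {k}) x Q ↔ k = quadrantDepth i Q := by
  have hN : 0 < h + v := by omega
  obtain ⟨V, hV, hsub⟩ := exists_quadrant_subset hp h0 hi hs ht Q
  constructor
  · rintro ⟨V', hV', hsub'⟩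
    obtain ⟨P, hPQ, hPV, hPV'⟩ :=
      quadrant_inter_nonempty hp h0 hi hs ht Q (Filter.inter_mem hV hV')
    obtain ⟨s, y, hy, rfl, -, hd⟩ := hsub ⟨hPQ, hPV⟩
    have h1 := hsub' ⟨hPQ, hPV'⟩
    rw [F.spherePoint_mem_levels_iff hN hy] at h1
    exact h1.2.symm.trans hd
  · rintro rfl
    exact ⟨V, hV, hsub⟩

/-- At the crossing of a preferred chord, the labels alternate. -/
theorem label_eq {x : F.ReebChord} (hx : x.IsAType) :
    x.label .north = 1 ∧ x.label .south = 1 ∧ x.label .east = -1 ∧ x.label .west = -1 := by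
  have h1 := (isAType_iff x).1 hx
  have h2 : SignType.sign (deriv F.rSq x.sink - deriv F.rSq x.source) = -1 :=
    sign_neg (sub_neg.2 h1)
  exact ⟨hx.1, hx.2, h2, h2⟩

/-- The contribution of the corners at one crossing to the defect of a disc whose multiplicity on
the region of depth `k` is `M k` is the second difference of `M`. -/
theorem sum_cornerTerm (hp : 0 < p) {x : F.ReebChord} {i : ℕ} (h0 : 0 < i)
    (hi : i < h + v) (hs : x.source = F.cross i + i) (ht : x.sink = F.sinkParam i) (M : ℕ → ℝ) :
    ∑ k ∈ Finset.range (h + v + 1), M k * (F.cornerTerm (F.levels {k}) x .north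
      + F.cornerTerm (F.levels {k}) x .east + F.cornerTerm (F.levels {k}) x .south
      + F.cornerTerm (F.levels {k}) x .west) = (M (i - 1) + M (i + 1) - 2 * M i) * x.length := by
  obtain ⟨l1, l2, l3, l4⟩ := label_eq (isAType_of_ends h0 hi hs ht)
  have hterm : ∀ Q, ∑ k ∈ Finset.range (h + v + 1), M k * F.cornerTerm (F.levels {k}) x Q
      = M (quadrantDepth i Q) * (((x.label Q : SignType) : ℝ) * x.length) := by
    intro Q
    have hmem : quadrantDepth i Q ∈ Finset.range (h + v + 1) := by
      rw [Finset.mem_range]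
      cases Q <;> simp only [quadrantDepth] <;> omega
    rw [Finset.sum_eq_single_of_mem _ hmem]
    · rw [cornerTerm, if_pos ((regionFills_iff hp h0 hi hs ht Q _).2 rfl)]
    · intro k _ hk
      rw [cornerTerm, if_neg (mt (regionFills_iff hp h0 hi hs ht Q k).1 hk), mul_zero]
  simp only [mul_add, Finset.sum_add_distrib, hterm]
  rw [l1, l2, l3, l4]
  simp only [quadrantDepth, SignType.coe_one, SignType.coe_neg_one]
  ring

theorem finite_isAType (hp : 0 < p) (hk : Int.gcd ((q : ℤ) - 1) p = 1) :
    {x : F.ReebChord | x.IsAType}.Finite := by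
  refine Set.Finite.of_injOn (f := number) (t := Set.Iio (h + v)) ?_ ?_ (Set.finite_Iio _)
  · intro x hx
    obtain ⟨i, h0, hi, hs, -⟩ := exists_index hp hk hx
    rw [Set.mem_Iio, number_eq hp h0 hi hs]
    exact hi
  · intro x hx y hy hxy
    obtain ⟨i, h0, hi, hs, ht⟩ := exists_index hp hk hx
    obtain ⟨i', h0', hi', hs', ht'⟩ := exists_index hp hk hy
    rw [number_eq hp h0 hi hs, number_eq hp h0' hi' hs'] at hxy
    subst hxy
    exact ext_of_ends hp hk (hs.trans hs'.symm) (ht.trans ht'.symm)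

end ReebChord

/-! ### Areas and defects -/

open MeasureTheory

/-- On almost every point of a meridian, `Γ` is avoided. -/
theorem ae_off (s : ℝ) : ∀ᵐ y : ℝ, F.Off s y := by
  have hfin : (⋃ i ∈ Finset.range (h + v), {F.rSq (s + (i : ℕ))}).Finite :=
    Set.Finite.biUnion (Finset.finite_toSet _) fun i _ => Set.finite_singleton _
  refine measure_mono_null ?_ (hfin.measure_zero volume)
  intro y hy
  simp only [Off, Set.mem_compl_iff, Set.mem_ofPred_eq, not_forall, not_not] at hy
  obtain ⟨i, hi, he⟩ := hy
  exact Set.mem_biUnion (Finset.mem_coe.2 (Finset.mem_range.2 hi)) he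

/-- The area below an arc of `Γ`, by the Legendrian condition. -/
theorem integral_rSq (a b : ℝ) : ∫ s in a..b, F.rSq s = F.Y a - F.Y b := by
  have h1 : ∀ s, F.rSq s = -deriv F.Y s := F.rSq_eq
  simp only [h1]
  rw [intervalIntegral.integral_neg, intervalIntegral.integral_deriv_eq_sub]
  · ring
  · exact fun x _ => (F.smooth_Y.differentiable (by norm_num)).differentiableAt
  · exact (F.smooth_Y.continuous_deriv (by norm_num)).intervalIntegrable _ _

theorem integral_sum_rSq (s₀ : ℝ) (m : ℕ) :
    ∫ s in s₀..s₀ + 1, ∑ n ∈ Finset.range m, F.rSq (s + n) = F.Y s₀ - F.Y (s₀ + m) := by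
  have hc : ∀ n : ℕ, Continuous fun s => F.rSq (s + n) := fun n =>
    F.contDiff_rSq.continuous.comp (by fun_prop)
  rw [intervalIntegral.integral_finsetSum fun n _ => (hc n).intervalIntegrable _ _]
  have h1 : ∀ n : ℕ, ∫ s in s₀..s₀ + 1, F.rSq (s + n) = F.Y (s₀ + n) - F.Y (s₀ + (n + 1 : ℕ)) := by
    intro n
    rw [intervalIntegral.integral_comp_add_right fun s => F.rSq s, integral_rSq]
    congr 2
    push_cast
    ring
  simp only [h1]
  rw [Finset.sum_range_sub' fun n : ℕ => F.Y (s₀ + n)]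
  simp

/-- Along a meridian, the integral of the number of branches below a point is the sum of the
heights of the branches. -/
theorem integral_card_lt (s : ℝ) (m : ℕ) :
    IntegrableOn (fun y => (((Finset.range m).filter fun n : ℕ => y < F.rSq (s + n)).card : ℝ))
      (Set.Ioo 0 1) ∧
    ∫ y in Set.Ioo (0 : ℝ) 1, (((Finset.range m).filter fun n : ℕ => y < F.rSq (s + n)).card : ℝ)
      = ∑ n ∈ Finset.range m, F.rSq (s + n) := by
  have h1 : ∀ y, (((Finset.range m).filter fun n : ℕ => y < F.rSq (s + n)).card : ℝ)
      = ∑ n ∈ Finset.range m, (Set.Iio (F.rSq (s + n))).indicator 1 y := by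
    intro y
    rw [Finset.card_filter]
    push_cast
    exact Finset.sum_congr rfl fun n _ => by simp [Set.indicator_apply]
  have hint : ∀ n ∈ Finset.range m, IntegrableOn
      (fun y : ℝ => (Set.Iio (F.rSq (s + n))).indicator (1 : ℝ → ℝ) y) (Set.Ioo 0 1) := fun n _ =>
    (integrable_const (1 : ℝ)).indicator measurableSet_Iio
  simp only [h1]
  refine ⟨integrable_finsetSum _ hint, ?_⟩
  rw [integral_finsetSum _ hint]
  refine Finset.sum_congr rfl fun n _ => ?_
  rw [integral_indicator_one measurableSet_Iio, measureReal_restrict_apply measurableSet_Iio]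
  have : Set.Iio (F.rSq (s + n)) ∩ Set.Ioo (0 : ℝ) 1 = Set.Ioo 0 (F.rSq (s + n)) := by
    ext y
    have := F.rSq_lt_one (s + n)
    simp only [Set.mem_inter_iff, Set.mem_Iio, Set.mem_Ioo]
    constructor
    · rintro ⟨h1, h2, -⟩; exact ⟨h2, h1⟩
    · rintro ⟨h1, h2⟩; exact ⟨h2, h1, h2.trans this⟩
  rw [this, Real.volume_real_Ioo_of_le (F.rSq_pos _).le, sub_zero]

/-- The weighted sum of the areas of the regions, if the weights count the branches below a point
over a window of length `p`. -/
theorem sum_area (hN : 0 < h + v) {s₀ a b : ℝ} {M : ℕ → ℝ}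
    (hM : ∀ s ∈ Set.Icc s₀ (s₀ + 1), ∀ y ∈ Set.Ioo (0 : ℝ) 1, F.Off s y →
      M (F.depth s y) = a + b * ((Finset.range p).filter fun n : ℕ => y < F.rSq (s + n)).card) :
    ∑ k ∈ Finset.range (h + v + 1), M k * F.area (F.levels {k})
      = 1 / p * (a + b * (F.Y s₀ - F.Y (s₀ + p))) := by
  set O : ℕ → Set (ℝ × ℝ) := fun k => {c | F.Off c.1 c.2 ∧ F.depth c.1 c.2 ∈ ({k} : Set ℕ)} with hO
  have hOm : ∀ k, MeasurableSet (O k) := fun k => (F.isOpen_off_depth {k}).measurableSet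
  set B : Set (ℝ × ℝ) := Set.Ioc (0 : ℝ) 1 ×ˢ Set.Ioo (0 : ℝ) 1 with hB
  set φ : ℝ × ℝ → ℝ := fun c => ∑ k ∈ Finset.range (h + v + 1), M k * (O k).indicator 1 c with hφ
  have hφ_eq : ∀ s y, F.Off s y → φ (s, y) = M (F.depth s y) := by
    intro s y ho
    simp only [hφ]
    rw [Finset.sum_eq_single_of_mem (F.depth s y)
      (Finset.mem_range.2 (Nat.lt_succ_of_le (F.depth_le s y)))]
    · rw [Set.indicator_of_mem (show (s, y) ∈ O (F.depth s y) from ⟨ho, rfl⟩), Pi.one_apply,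
        mul_one]
    · intro k _ hk
      rw [Set.indicator_of_notMem (fun h1 => hk h1.2.symm), mul_zero]
  have hBfin : volume B ≠ ⊤ := by
    rw [hB, Measure.volume_eq_prod, Measure.prod_prod]
    simp
  have hfin : IsFiniteMeasure (volume.restrict B) := ⟨by
    rw [Measure.restrict_apply_univ]; exact hBfin.lt_top⟩
  have hint : ∀ k ∈ Finset.range (h + v + 1),
      IntegrableOn (fun c => M k * (O k).indicator (1 : ℝ × ℝ → ℝ) c) B := fun k _ =>
    ((integrable_const (1 : ℝ)).indicator (hOm k)).const_mul (M k)
  have h1 : ∑ k ∈ Finset.range (h + v + 1), M k * F.area (F.levels {k})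
      = 1 / p * ∫ c in B, φ c := by
    rw [hφ, integral_finsetSum _ hint, Finset.mul_sum]
    refine Finset.sum_congr rfl fun k _ => ?_
    rw [integral_const_mul, integral_indicator_one (hOm k), measureReal_restrict_apply (hOm k),
      area, Measure.real]
    have : {c : ℝ × ℝ | c ∈ Set.Ioc (0 : ℝ) 1 ×ˢ Set.Ioo (0 : ℝ) 1 ∧
        spherePoint c.1 c.2 ∈ F.levels {k}} = O k ∩ B := by
      ext c
      simp only [hB, hO, Set.mem_ofPred_eq, Set.mem_inter_iff]
      constructor
      · rintro ⟨hc, h2⟩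
        exact ⟨(F.spherePoint_mem_levels_iff hN (Set.Ioo_subset_Icc_self hc.2)).1 h2, hc⟩
      · rintro ⟨h2, hc⟩
        exact ⟨hc, (F.spherePoint_mem_levels_iff hN (Set.Ioo_subset_Icc_self hc.2)).2 h2⟩
    rw [this]
    ring
  have h2 : ∫ c in B, φ c = ∫ s in (0 : ℝ)..1, ∫ y in Set.Ioo (0 : ℝ) 1, φ (s, y) := by
    rw [intervalIntegral.integral_of_le zero_le_one, hB, Measure.volume_eq_prod, setIntegral_prod]
    rw [← Measure.volume_eq_prod]
    exact integrable_finsetSum _ hint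
  classical
  have hper : Function.Periodic (fun s => ∫ y in Set.Ioo (0 : ℝ) 1, φ (s, y)) 1 := by
    intro s
    have h3 : ∀ k y, ((s + 1, y) ∈ O k) ↔ ((s, y) ∈ O k) := by
      intro k y
      have e1 := F.off_add_int_iff hN s y 1
      have e2 := F.depth_add_int hN s y 1
      rw [Int.cast_one] at e1 e2
      simp only [hO, Set.mem_ofPred_eq, e1, e2]
    simp only [hφ, Set.indicator_apply, h3, Pi.one_apply]
  -- by periodicity, the azimuth may run over the window in which the weights are known
  have h4 := hper.intervalIntegral_add_eq 0 s₀
  rw [zero_add] at h4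
  rw [h1, h2, h4]
  congr 1
  have h5 : ∀ s ∈ Set.uIcc s₀ (s₀ + 1), ∫ y in Set.Ioo (0 : ℝ) 1, φ (s, y)
      = a + b * ∑ n ∈ Finset.range p, F.rSq (s + n) := by
    intro s hs
    rw [Set.uIcc_of_le (by linarith)] at hs
    obtain ⟨i1, i2⟩ := F.integral_card_lt s p
    rw [← i2]
    have h6 : ∫ y in Set.Ioo (0 : ℝ) 1, φ (s, y) = ∫ y in Set.Ioo (0 : ℝ) 1,
        (a + b * (((Finset.range p).filter fun n : ℕ => y < F.rSq (s + n)).card : ℝ)) := by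
      refine setIntegral_congr_ae measurableSet_Ioo ?_
      filter_upwards [F.ae_off s] with y ho hy
      rw [hφ_eq s y ho, hM s hs y hy ho]
    rw [h6, integral_add (integrable_const a) (i1.const_mul b), integral_const_mul]
    simp
  rw [intervalIntegral.integral_congr h5, intervalIntegral.integral_add,
    intervalIntegral.integral_const_mul, integral_sum_rSq]
  · simp
  · exact intervalIntegrable_const
  · refine Continuous.intervalIntegrable ?_ _ _
    exact continuous_const.mul (continuous_finsetSum _ fun n _ =>
      F.contDiff_rSq.continuous.comp (by fun_prop))

/-- The defect of a disc with one corner, whose multiplicities are given by a function of the depth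
with second difference concentrated at this corner. -/
theorem discDefect_eq (hp : 0 < p) (hk : Int.gcd ((q : ℤ) - 1) p = 1) {f : ℂ → Space}
    {M : ℕ → ℕ} {s₀ a b : ℝ} {i : ℕ} {x : F.ReebChord} (h0 : 0 < i) (hi : i < h + v)
    (hs : x.source = F.cross i + i) (ht : x.sink = F.sinkParam i)
    (hmult : ∀ k ≤ h + v, multiplicity f (F.levels {k}) = M k)
    (hdiff : ∀ k, 0 < k → k < h + v →
      (M (k - 1) + M (k + 1) - 2 * M k : ℝ) = if k = i then 1 else 0)
    (hM : ∀ s ∈ Set.Icc s₀ (s₀ + 1), ∀ y ∈ Set.Ioo (0 : ℝ) 1, F.Off s y →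
      (M (F.depth s y) : ℝ)
        = a + b * ((Finset.range p).filter fun n : ℕ => y < F.rSq (s + n)).card) :
    F.discDefect f = x.length - 1 / p * (a + b * (F.Y s₀ - F.Y (s₀ + p))) := by
  classical
  have hN : 0 < h + v := by omega
  have hfin := ReebChord.finite_isAType (F := F) hp hk
  rw [discDefect, F.regions_eq hp hN, finsum_mem_image (F.injOn_levels hN), finsum_mem_coe_finset]
  have h1 : ∀ k ∈ Finset.range (h + v + 1),
      (multiplicity f (F.levels {k}) : ℝ) * F.regionDefect (F.levels {k})
        = -(M k * F.area (F.levels {k})) + ∑ x ∈ hfin.toFinset, M k *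
          (F.cornerTerm (F.levels {k}) x .north + F.cornerTerm (F.levels {k}) x .east
            + F.cornerTerm (F.levels {k}) x .south + F.cornerTerm (F.levels {k}) x .west) := by
    intro k hk
    rw [hmult k (Nat.lt_succ_iff.1 (Finset.mem_range.1 hk)), regionDefect, mul_add, mul_neg,
      ← Finset.mul_sum]
    congr 2
    exact finsum_mem_eq_finite_toFinset_sum _ hfin
  rw [Finset.sum_congr rfl h1, Finset.sum_add_distrib, Finset.sum_neg_distrib, F.sum_area hN hM,
    Finset.sum_comm]
  have h2 : ∀ y ∈ hfin.toFinset, ∑ k ∈ Finset.range (h + v + 1), (M k : ℝ) *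
      (F.cornerTerm (F.levels {k}) y .north + F.cornerTerm (F.levels {k}) y .east
        + F.cornerTerm (F.levels {k}) y .south + F.cornerTerm (F.levels {k}) y .west)
      = if y = x then x.length else 0 := by
    intro y hy
    rw [Set.Finite.mem_toFinset] at hy
    obtain ⟨i', h0', hi', hs', ht'⟩ := ReebChord.exists_index hp hk hy
    rw [ReebChord.sum_cornerTerm hp h0' hi' hs' ht' fun k => (M k : ℝ), hdiff i' h0' hi']
    by_cases hii : i' = i
    · subst hii
      have := ReebChord.ext_of_ends hp hk (hs'.trans hs.symm) (ht'.trans ht.symm)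
      rw [if_pos rfl, if_pos this, this, one_mul]
    · rw [if_neg hii, if_neg, zero_mul]
      rintro rfl
      refine hii ?_
      rw [← ReebChord.number_eq hp h0' hi' hs', ReebChord.number_eq hp h0 hi hs]
  have hx : x ∈ hfin.toFinset := by
    rw [Set.Finite.mem_toFinset]
    exact ReebChord.isAType_of_ends h0 hi hs ht
  rw [Finset.sum_congr rfl h2, Finset.sum_ite_eq', if_pos hx]
  ring

end SpecialFront

/-! ### From branched discs to terms of the boundary map -/

/-- If the interior of a disc is mapped into `A` near the boundary point `1`, then the boundary is
mapped into the closure of `A` there. -/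
theorem eventually_mem_closure_of_ball {f : ℂ → Space} {A : Set Space} (hf : Continuous f)
    (hA : ∀ᶠ w in nhdsWithin (1 : ℂ) (Metric.ball 0 1), f w ∈ A) :
    ∀ᶠ z in nhds (1 : ℂ), z ∈ disc → f z ∈ closure A := by
  obtain ⟨U, hU, hUo, h1⟩ := eventually_nhds_iff.1 (eventually_nhdsWithin_iff.1 hA)
  filter_upwards [hUo.mem_nhds h1] with z hz hzd
  have h2 : z ∈ closure (U ∩ Metric.ball 0 1) := by
    apply hUo.inter_closure
    rw [closure_ball _ one_ne_zero]
    exact ⟨hz, hzd⟩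
  refine closure_mono ?_ (image_closure_subset_closure_image hf ⟨z, h2, rfl⟩)
  rintro _ ⟨w, hw, rfl⟩
  exact hU w hw.1 hw.2

namespace SpecialFront

variable {p q h v : ℕ} {F : SpecialFront p q h v}

/-- A branched disc with one corner, of defect zero, whose boundary runs along `Γ` between the two
strands at a crossing. -/
theorem capContributesOne_of_isCapDisc {x : F.ReebChord} {f : ℂ → Space} {pole P : Space}
    {Q : Quadrant} {s t : ℝ} (hx : x.IsAType) (hf : IsCapDisc p f pole)
    (hpole : pole = northPole ∨ pole = southPole) (hQ : x.label Q = 1) (hfill : F.DiscFills f 1 x Q)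
    (hbd : ∀ τ ∈ Set.Icc (0 : ℝ) 1,
      f (Circle.exp (2 * Real.pi * τ) : ℂ) = F.gamma (s + τ * (t - s)))
    (hs : ∃ k : ℤ, s = x.sink + k * (h + v : ℕ)) (ht : ∃ k : ℤ, t = x.source + k * (h + v : ℕ))
    (hdef : F.discDefect f = 0) (hP : ∀ z ∈ disc, f z ≠ P) : CapContributesOne x P := by
  have hone : (Circle.exp 0 : ℂ) = 1 := by simp
  have hrange : (Set.range fun _ : Fin (0 + 1) => (Circle.exp 0 : ℂ)) = {1} := by
    rw [Set.range_const, hone]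
  have hmem : ∀ τ : ℝ, (Circle.exp (2 * Real.pi * τ) : ℂ) ∈ disc := fun τ => by
    simp only [disc, Metric.mem_closedBall, dist_zero_right, Circle.norm_coe, le_refl]
  have hcl := eventually_mem_closure_of_ball hf.continuous hfill.2.1
  have hcont : Continuous fun τ : ℝ => (Circle.exp (2 * Real.pi * τ) : ℂ) := by fun_prop
  let D : F.AdmissibleDisc :=
    { f := f
      m := 0
      angle := fun _ => 0
      angle_mono := fun a b hab => absurd hab (by omega)
      angle_lt := by linarith [Real.pi_pos]
      maps_sphere := hf.maps_sphere
      continuous := hf.continuous.continuousOn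
      boundary := by
        intro z hz
        have hz1 : ‖z‖ = 1 := by simpa using hz
        obtain ⟨τ, hτ, he⟩ : ∃ τ ∈ Set.Icc (0 : ℝ) 1, (Circle.exp (2 * Real.pi * τ) : ℂ) = z := by
          have hpi := Real.pi_pos
          have h1 := toIcoMod_mem_Ico Real.two_pi_pos 0 z.arg
          refine ⟨toIcoMod Real.two_pi_pos 0 z.arg / (2 * Real.pi), ⟨?_, ?_⟩, ?_⟩
          · exact div_nonneg h1.1 Real.two_pi_pos.le
          · rw [div_le_one Real.two_pi_pos]; linarith [h1.2]
          · rw [mul_div_cancel₀ _ Real.two_pi_pos.ne']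
            have h2 : Circle.exp (toIcoMod Real.two_pi_pos 0 z.arg) = Circle.exp z.arg := by
              rw [Circle.exp_eq_exp]
              refine ⟨-toIcoDiv Real.two_pi_pos 0 z.arg, ?_⟩
              rw [toIcoMod, zsmul_eq_mul]
              push_cast
              ring
            rw [h2]
            have h3 := CapData.exists_polar z
            rw [hz1, Complex.ofReal_one, one_mul] at h3
            exact h3.symm
        rw [← he, hbd τ hτ]
        exact ⟨_, rfl⟩
      smooth := by
        rw [hrange]
        exact fun z hz => (hf.smooth z hz.1 hz.2).contDiffWithinAt
      immersion := by
        rw [hrange]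
        intro z hz
        rcases eq_or_ne z 0 with rfl | h0
        · right
          refine ⟨by simp, ?_, hf.branched⟩
          rwa [hf.zero]
        · exact Or.inl (hf.immersion z hz.1 hz.2 h0)
      corner := fun _ => ⟨x, Q, by rw [hone]; exact hfill⟩ }
  let d : F.BoundaryDisc x :=
    { D with
      neg := Fin.elim0
      pos_corner := ⟨Q, by
        change F.DiscFills f (Circle.exp 0 : ℂ) x Q
        rw [hone]; exact hfill, hQ⟩
      neg_corner := fun k => k.elim0
      defect_eq_zero := by
        rw [if_pos hx]
        change F.discDefect f - _ + _ = _
        rw [hdef]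
        simp [Set.eq_empty_of_isEmpty] }
  have hturn : ∀ᶠ τ in nhds (0 : ℝ), f (Circle.exp (2 * Real.pi * τ) : ℂ) ∈ closure (x.quadrant Q) ∧
      f (Circle.exp (2 * Real.pi * (1 - τ)) : ℂ) ∈ closure (x.quadrant Q) := by
    have h1 : Filter.Tendsto (fun τ : ℝ => (Circle.exp (2 * Real.pi * τ) : ℂ)) (nhds 0)
        (nhds 1) := by
      have := hcont.tendsto 0
      simpa using this
    have h2 : Filter.Tendsto (fun τ : ℝ => (Circle.exp (2 * Real.pi * (1 - τ)) : ℂ)) (nhds 0)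
        (nhds 1) := by
      have := (hcont.comp
        (continuous_const.sub continuous_id : Continuous fun τ : ℝ => 1 - τ)).tendsto 0
      simpa [Function.comp_def] using this
    filter_upwards [h1.eventually hcl, h2.eventually hcl] with τ e1 e2
    exact ⟨e1 (hmem _), e2 (hmem _)⟩
  let η : F.CappingPath x :=
    { start := s
      finish := t
      strands := Or.inr ⟨hs, ht⟩
      turns := by
        refine ⟨Q, hQ, ?_⟩
        filter_upwards [nhdsWithin_le_nhds hturn, Ioo_mem_nhdsGT one_pos] with τ h1 h2
        rw [hbd τ ⟨h2.1.le, h2.2.le⟩, hbd (1 - τ) ⟨by linarith [h2.2], by linarith [h2.1]⟩] at h1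
        refine ⟨h1.1, ?_⟩
        have e : t + τ * (s - t) = s + (1 - τ) * (t - s) := by ring
        rw [e]
        exact h1.2 }
  refine ⟨η, d, ⟨id, continuousOn_id, strictMono_id.strictMonoOn _, rfl, rfl, fun τ hτ => ?_⟩, hP,
    ?_⟩
  · change f (Circle.exp (0 + 2 * Real.pi * τ) : ℂ) = F.gamma (s + τ * (t - s))
    rw [zero_add]
    exact hbd τ hτ
  · change ((List.ofFn (Fin.elim0 : Fin 0 → F.ReebChord)).map (FreeAlgebra.ι (ZMod 2))).prod = 1
    simp

/-! ### Multiplicities -/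

variable (F)

theorem depth_eq_count (s y : ℝ) :
    F.depth s y = Nat.count (fun n : ℕ => F.rSq (s + n) < y) (h + v) := by
  rw [Nat.count_eq_card_filter_range, depth]

/-- Between the `i`-th crossing and its translate by one turn, the first `i` branches are below the
other ones. -/
theorem count_eq_min {i : ℕ} (h0 : 0 < i) (hi : i < h + v) {s : ℝ}
    (hs : s ∈ Set.Icc (F.cross i) (F.cross i + 1)) (y : ℝ) :
    Nat.count (fun n : ℕ => F.rSq (s + n) < y) i = min i (F.depth s y) := by
  set P : ℕ → Prop := fun n : ℕ => F.rSq (s + n) < y with hP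
  have hd : F.depth s y = Nat.count P i + Nat.count (fun n => P (i + n)) (h + v - i) := by
    rw [← Nat.count_add, F.depth_eq_count]
    congr 1
    omega
  have hle : Nat.count P i ≤ i := Nat.count_le _
  change Nat.count P i = _
  by_cases hex : ∃ m, i ≤ m ∧ m < h + v ∧ P m
  · obtain ⟨m, hm1, hm2, hm⟩ := hex
    have : Nat.count P i = i := by
      rw [Nat.count_iff_forall]
      intro n hn
      exact (F.rSq_lower_le_upper h0 hi hs hn hm1 hm2).trans_lt hm
    omega
  · have : Nat.count (fun n => P (i + n)) (h + v - i) = 0 := by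
      rw [Nat.count_iff_forall_not]
      intro n hn hn'
      exact hex ⟨i + n, by omega, by omega, hn'⟩
    omega

theorem rSq_lt_periodic (s y : ℝ) (n : ℕ) :
    F.rSq (s + (n + (h + v) : ℕ)) < y ↔ F.rSq (s + n) < y := by
  have := F.rSq_add_period (s + n)
  rw [Nat.cast_add, ← add_assoc, this]

/-- The number of branches above a point in a window of length `p` that starts at the `i`-th
crossing, for `p ≡ i` modulo the period. -/
theorem card_lt_eq {u i : ℕ} (hp : p = u * (h + v) + i) (h0 : 0 < i) (hi : i < h + v) {s y : ℝ}
    (hs : s ∈ Set.Icc (F.cross i) (F.cross i + 1)) (ho : F.Off s y) :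
    ((Finset.range p).filter fun n : ℕ => y < F.rSq (s + n)).card
      = u * (h + v - F.depth s y) + (i - F.depth s y) := by
  have h1 : (Finset.range p).filter (fun n : ℕ => y < F.rSq (s + n))
      = (Finset.range p).filter fun n : ℕ => ¬ F.rSq (s + n) < y :=
    Finset.filter_congr fun n _ => ⟨fun h1 => h1.not_gt,
      fun h1 => lt_of_le_of_ne (not_lt.1 h1) (ho.ne_nat (by omega) n)⟩
  have h2 := Finset.card_filter_add_card_filter_not (s := Finset.range p)
    (fun n : ℕ => F.rSq (s + n) < y)
  rw [← h1, ← Nat.count_eq_card_filter_range, Finset.card_range] at h2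
  have h3 := count_periodic (P := fun n : ℕ => F.rSq (s + n) < y) (F.rSq_lt_periodic s y) u i
  rw [← hp, ← F.depth_eq_count, F.count_eq_min h0 hi hs] at h3
  have h4 := F.depth_le s y
  obtain ⟨e, he⟩ := Nat.exists_eq_add_of_le h4
  have h5 : h + v - F.depth s y = e := by omega
  have h6 : p = u * F.depth s y + u * e + i := hp.trans (by rw [he]; ring)
  rw [h5]
  omega

/-- The number of branches below a point in a window of length `p` that ends at the `i`-th
crossing, for `p ≡ -i` modulo the period. -/
theorem card_gt_eq {u i j : ℕ} (hp : p = u * (h + v) + j) (hij : i + j = h + v) (h0 : 0 < i)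
    (hi : i < h + v) {s y : ℝ} (hs : s ∈ Set.Icc (F.cross i - p) (F.cross i - p + 1)) :
    ((Finset.range p).filter fun n : ℕ => F.rSq (s + n) < y).card
      = u * F.depth s y + (F.depth s y - i) := by
  have hN : 0 < h + v := by omega
  have h1 : ∀ n : ℕ, F.rSq (s + n) = F.rSq (s + p + (i + n : ℕ)) := by
    intro n
    have e : s + p + (i + n : ℕ) = s + n + ((u + 1 : ℤ) : ℝ) * (h + v : ℕ) := by
      have e1 : (p : ℝ) = u * (h + v) + j := by exact_mod_cast hp
      have e2 : (i : ℝ) + j = h + v := by exact_mod_cast hij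
      push_cast
      linear_combination e1 + e2
    rw [e, F.rSq_add_int_mul]
  have hd : F.depth (s + p) y = F.depth s y := by
    simpa using F.depth_add_int hN s y p
  rw [← Nat.count_eq_card_filter_range]
  have h3 := count_periodic (P := fun n : ℕ => F.rSq (s + n) < y) (F.rSq_lt_periodic s y) u j
  rw [← hp, ← F.depth_eq_count] at h3
  have h4 := F.count_eq_min h0 hi (s := s + p) ⟨by linarith [hs.1], by linarith [hs.2]⟩ y
  have h5 := F.depth_eq_count (s + p) y
  rw [← hij, Nat.count_add, h4] at h5
  simp only [← h1] at h5
  rw [hd] at h5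
  omega

/-- The multiplicities of the northern disc are affine in the depth except for one kink. -/
theorem secondDiff_north {N u i : ℕ} (k : ℕ) (hk0 : 0 < k) (hk : k < N) :
    (((u * (N - (k - 1)) + (i - (k - 1)) : ℕ) : ℝ) + ((u * (N - (k + 1)) + (i - (k + 1)) : ℕ) : ℝ)
      - 2 * ((u * (N - k) + (i - k) : ℕ) : ℝ)) = if k = i then 1 else 0 := by
  obtain ⟨k, rfl⟩ := Nat.exists_eq_succ_of_ne_zero hk0.ne'
  obtain ⟨e, rfl⟩ := Nat.exists_eq_add_of_lt hk
  have e1 : k.succ + e + 1 - (k.succ - 1) = e + 2 := by omega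
  have e2 : k.succ + e + 1 - (k.succ + 1) = e := by omega
  have e3 : k.succ + e + 1 - k.succ = e + 1 := by omega
  -- truncated subtraction makes the kink at `k = i`
  have e4 : i - (k.succ - 1) + (i - (k.succ + 1))
      = 2 * (i - k.succ) + if k.succ = i then 1 else 0 := by
    split_ifs <;> omega
  have e5 : ((i - (k.succ - 1) : ℕ) : ℝ) + ((i - (k.succ + 1) : ℕ) : ℝ)
      = 2 * ((i - k.succ : ℕ) : ℝ) + if k.succ = i then 1 else 0 := by exact_mod_cast e4
  rw [e1, e2, e3]
  rw [Nat.succ_sub_one] at e5 ⊢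
  simp only [Nat.cast_add, Nat.cast_mul, Nat.cast_one, Nat.cast_ofNat]
  linear_combination e5

/-- The multiplicities of the southern disc are affine in the depth except for one kink. -/
theorem secondDiff_south {u i : ℕ} (k : ℕ) (hk0 : 0 < k) :
    (((u * (k - 1) + (k - 1 - i) : ℕ) : ℝ) + ((u * (k + 1) + (k + 1 - i) : ℕ) : ℝ)
      - 2 * ((u * k + (k - i) : ℕ) : ℝ)) = if k = i then 1 else 0 := by
  obtain ⟨k, rfl⟩ := Nat.exists_eq_succ_of_ne_zero hk0.ne'
  -- truncated subtraction makes the kink at `k = i`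
  have e4 : k.succ - 1 - i + (k.succ + 1 - i) = 2 * (k.succ - i) + if k.succ = i then 1 else 0 := by
    split_ifs <;> omega
  have e5 : ((k.succ - 1 - i : ℕ) : ℝ) + ((k.succ + 1 - i : ℕ) : ℝ)
      = 2 * ((k.succ - i : ℕ) : ℝ) + if k.succ = i then 1 else 0 := by exact_mod_cast e4
  rw [Nat.succ_sub_one] at e5 ⊢
  simp only [Nat.cast_add, Nat.cast_mul, Nat.cast_succ]
  linear_combination e5

/-! ### The two discs -/

/-- The disc over the northern hemisphere at the `i`-th crossing, for `p ≡ i` modulo `h + v`. Its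
boundary leaves the crossing along the `0`-th branch and runs eastwards for `p` turns, to arrive
along the `i`-th branch. -/
theorem capContributesOne_southPole {u i : ℕ} (hp : p = u * (h + v) + i) (hp0 : 0 < p)
    (hk : Int.gcd ((q : ℤ) - 1) p = 1) (h0 : 0 < i) (hi : i < h + v) {x : F.ReebChord}
    (hs : x.source = F.cross i + i) (ht : x.sink = F.sinkParam i)
    (hl : x.length = (F.Y (F.cross i) - F.Y (F.cross i + p)) / p) :
    CapContributesOne x southPole := by
  have hN : 0 < h + v := by omega
  have hA := ReebChord.isAType_of_ends h0 hi hs ht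
  have hpi : ∀ r, F.cross i + p + r = F.cross i + i + r + (u : ℤ) * (h + v : ℕ) := by
    intro r
    have e1 : (p : ℝ) = u * (h + v) + i := by exact_mod_cast hp
    push_cast
    linear_combination e1
  have hper : ∀ r, F.rSq (F.cross i + p + r) = F.rSq (x.source + r) := by
    intro r
    rw [hpi, F.rSq_add_int_mul, hs]
  have hclosed : F.rSq (F.cross i + p) = F.rSq (F.cross i) := by
    have := hper 0
    rw [add_zero, add_zero, hs, ← F.rSq_cross h0 hi] at this
    exact this
  obtain ⟨d⟩ := CapData.nonempty_of_deriv_lt (s₀ := F.cross i) hp0 F.contDiff_rSq hclosed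
    F.rSq_lt_one (by
      have := hpi 0
      rw [add_zero, add_zero] at this
      rw [this, F.deriv_rSq_add_int_mul]
      exact F.deriv_cross_lt h0 hi) (F.exists_rSq_lower hN)
  have hcross : x.crossing = spherePoint (F.cross i) (F.rSq (F.cross i)) :=
    ReebChord.crossing_eq hp0 h0 hi hs
  have hsrc : ∀ r y, spherePoint (x.source + r) y = spherePoint (F.cross i + r) y := by
    intro r y
    rw [hs, add_right_comm, spherePoint_add_nat]
  have hfill : F.DiscFills d.cap 1 x .north := by
    refine ⟨?_, ?_, fun U hU => ?_⟩
    · have := d.cap_boundary le_rfl zero_le_one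
      simpa [hcross] using this
    · filter_upwards [d.cap_corner] with z hz
      obtain ⟨r, hr, y, hy, he, h1, h2⟩ := hz
      refine ⟨r, hr, y, hy, by rw [he, hsrc], ?_, ?_⟩
      · rwa [← hper]
      · rwa [ReebChord.rSq_sink_add ht]
    · obtain ⟨δ, hδ, hball⟩ := Metric.eventually_nhds_iff.1 (d.cap_fills hU)
      obtain ⟨V, hV, hloc⟩ := exists_nhds_spherePoint (F.cross i)
        ⟨F.rSq_pos (F.cross i), F.rSq_lt_one _⟩ hδ
      refine ⟨V, by rwa [hcross], ?_⟩
      rintro _ ⟨⟨r, hr, w, hw, rfl, h1, h2⟩, hPV⟩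
      rw [hsrc] at hPV ⊢
      obtain ⟨h3, h4⟩ := hloc r (Set.Ioo_subset_Icc_self hr) w (Set.Ioo_subset_Icc_self hw) hPV
      rw [ReebChord.rSq_sink_add ht] at h2
      rw [← hper] at h1
      refine hball (y := (r, w)) ?_ h2 h1
      rw [Prod.dist_eq, max_lt_iff, Real.dist_eq, Real.dist_eq, sub_zero]
      exact ⟨h3, h4⟩
  have hmult : ∀ s ∈ Set.Icc (F.cross i) (F.cross i + 1), ∀ y ∈ Set.Ioo (0 : ℝ) 1, F.Off s y →
      ((Finset.range p).filter fun n : ℕ => y < F.rSq (s + n)).card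
        = u * (h + v - F.depth s y) + (i - F.depth s y) := fun s hs y _ ho =>
    F.card_lt_eq hp h0 hi hs ho
  refine capContributesOne_of_isCapDisc (s := F.cross i) (t := F.cross i + p) hA d.isCapDisc
    (Or.inl rfl) (ReebChord.label_eq hA).1 hfill ?_ ?_ ?_ ?_ ?_
  · intro τ hτ
    rw [d.cap_boundary hτ.1 hτ.2, F.gamma_eq hp0]
    congr 2 <;> ring
  · obtain ⟨b, hb⟩ := F.exists_sinkParam_eq i
    refine ⟨-b, ?_⟩
    rw [ht, hb]
    push_cast
    ring
  · refine ⟨u, ?_⟩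
    have := hpi 0
    rwa [add_zero, add_zero, ← hs] at this
  · rw [F.discDefect_eq (M := fun k => u * (h + v - k) + (i - k)) (s₀ := F.cross i) (a := 0)
      (b := 1) hp0 hk h0 hi hs ht ?_ ?_ ?_, hl]
    · ring
    · intro k hk'
      refine F.multiplicity_levels (s₀ := F.cross i)
        (M := fun k => u * (h + v - k) + (i - k)) hN (fun s hs y hy ho => ?_) hk'
      rw [d.ncard_cap_preimage hs hy fun n _ => ho.ne_nat hN n]
      exact hmult s hs y hy ho
    · exact fun k hk0 hkN => secondDiff_north k hk0 hkN
    · intro s hs y hy ho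
      rw [hmult s hs y hy ho]
      ring
  · intro z hz he
    rw [d.cap_eq_spherePoint, ← spherePoint_one 0] at he
    exact (d.G_lt_one (by simpa [disc] using hz)).ne (spherePoint_height he)

/-- The disc over the southern hemisphere at the `i`-th crossing, for `p ≡ -i` modulo `h + v`. Its
boundary leaves the crossing along the `0`-th branch and runs westwards for `p` turns, to arrive
along the `i`-th branch. The rotation `flip` takes it to the boundary of a cap over the north
pole. -/
theorem capContributesOne_northPole {u i j : ℕ} (hp : p = u * (h + v) + j) (hij : i + j = h + v)
    (hp0 : 0 < p) (hk : Int.gcd ((q : ℤ) - 1) p = 1) (h0 : 0 < i) (hi : i < h + v) {x : F.ReebChord}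
    (hs : x.source = F.cross i + i) (ht : x.sink = F.sinkParam i)
    (hl : x.length = (F.X (F.cross i) - F.X (F.cross i - p)) / p) :
    CapContributesOne x northPole := by
  have hN : 0 < h + v := by omega
  have hA := ReebChord.isAType_of_ends h0 hi hs ht
  have hpi : ∀ r, F.cross i - p + r = F.cross i + i + r + ((-(u + 1) : ℤ) : ℝ) * (h + v : ℕ) := by
    intro r
    have e1 : (p : ℝ) = u * (h + v) + j := by exact_mod_cast hp
    have e2 : (i : ℝ) + j = h + v := by exact_mod_cast hij
    push_cast
    linear_combination -e1 - e2
  have hper : ∀ r, F.rSq (F.cross i - p + r) = F.rSq (x.source + r) := by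
    intro r
    rw [hpi, F.rSq_add_int_mul, hs]
  have hclosed : F.rSq (F.cross i - p) = F.rSq (F.cross i) := by
    have := hper 0
    rw [add_zero, add_zero, hs, ← F.rSq_cross h0 hi] at this
    exact this
  set g : ℝ → ℝ := fun s => 1 - F.rSq (-s) with hg
  have hgs : ContDiff ℝ ∞ g := contDiff_const.sub (F.contDiff_rSq.comp contDiff_neg)
  have hgd : ∀ s, deriv g s = deriv F.rSq (-s) := by
    intro s
    rw [hg, deriv_const_sub, deriv_comp_neg, neg_neg]
  obtain ⟨c, hc, hcs⟩ := F.exists_rSq_upper hN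
  have hend : -(-F.cross i + p) = F.cross i - p := by ring
  obtain ⟨d⟩ := CapData.nonempty_of_deriv_lt (s₀ := -F.cross i) (g := g) hp0 hgs
    (by rw [hg]; simp only; rw [hend, neg_neg, hclosed])
    (fun s => by linarith [F.rSq_pos (-s)])
    (by
      have := hpi 0
      rw [add_zero, add_zero] at this
      rw [hgd, hgd, hend, neg_neg, this, F.deriv_rSq_add_int_mul]
      exact F.deriv_cross_lt h0 hi) ⟨c, hc, fun s => hcs _⟩
  have hg0 : ∀ r, g (-F.cross i + r) = 1 - F.rSq (F.cross i - r) := by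
    intro r
    rw [hg]
    simp only
    congr 2
    ring
  have hgp : ∀ r, g (-F.cross i + p + r) = 1 - F.rSq (x.source - r) := by
    intro r
    rw [sub_eq_add_neg x.source, ← hper, hg]
    simp only
    congr 2
    ring
  have hcross : x.crossing = spherePoint (F.cross i) (F.rSq (F.cross i)) :=
    ReebChord.crossing_eq hp0 h0 hi hs
  have hsrc : ∀ r y, spherePoint (x.source + r) y = spherePoint (F.cross i + r) y := by
    intro r y
    rw [hs, add_right_comm, spherePoint_add_nat]
  have hone : (Circle.exp 0 : ℂ) = 1 := by simp
  have hbd : ∀ τ ∈ Set.Icc (0 : ℝ) 1, (flip ∘ d.cap) (Circle.exp (2 * Real.pi * τ) : ℂ)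
      = F.gamma (F.cross i + τ * (F.cross i - p - F.cross i)) := by
    intro τ hτ
    have e : F.cross i + τ * (F.cross i - p - F.cross i) = F.cross i - p * τ := by ring
    rw [Function.comp_apply, d.cap_boundary hτ.1 hτ.2, flip_spherePoint, F.gamma_eq hp0, hg0, e]
    congr 1 <;> ring
  have hfill : F.DiscFills (flip ∘ d.cap) 1 x .south := by
    refine ⟨?_, ?_, fun U hU => ?_⟩
    · have := hbd 0 ⟨le_rfl, zero_le_one⟩
      rw [mul_zero, hone, zero_mul, add_zero, F.gamma_eq hp0] at this
      rw [this, hcross]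
    · filter_upwards [d.cap_corner] with z hz
      obtain ⟨r, hr, y, hy, he, h1, h2⟩ := hz
      rw [hg0] at h1
      rw [hgp] at h2
      refine ⟨-r, ⟨by linarith [hr.2], by linarith [hr.1]⟩, 1 - y,
        ⟨by linarith [hy.2], by linarith [hy.1]⟩, ?_, ?_, ?_⟩
      · rw [Function.comp_apply, he, flip_spherePoint, hsrc]
        congr 1
        ring
      · rw [← sub_eq_add_neg]; linarith
      · rw [ReebChord.rSq_sink_add ht, ← sub_eq_add_neg]; linarith
    · obtain ⟨δ, hδ, hball⟩ := Metric.eventually_nhds_iff.1 (d.cap_fills hU)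
      obtain ⟨V, hV, hloc⟩ := exists_nhds_spherePoint (F.cross i)
        ⟨F.rSq_pos (F.cross i), F.rSq_lt_one _⟩ hδ
      refine ⟨V, by rwa [hcross], ?_⟩
      rintro _ ⟨⟨r, hr, w, hw, rfl, h1, h2⟩, hPV⟩
      rw [hsrc] at hPV ⊢
      obtain ⟨h3, h4⟩ := hloc r (Set.Ioo_subset_Icc_self hr) w (Set.Ioo_subset_Icc_self hw) hPV
      rw [ReebChord.rSq_sink_add ht] at h2
      have h5 := hball (y := (-r, 1 - w)) (by
        have e : g (-F.cross i) = 1 - F.rSq (F.cross i) := by rw [hg]; simp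
        rw [Prod.dist_eq, max_lt_iff, Real.dist_eq, Real.dist_eq, sub_zero, abs_neg, e]
        refine ⟨h3, ?_⟩
        rwa [sub_sub_sub_cancel_left, abs_sub_comm])
        (by rw [hg0, sub_neg_eq_add]; linarith) (by rw [hgp, sub_neg_eq_add]; linarith)
      obtain ⟨z, hz, he⟩ := h5
      refine ⟨z, hz, ?_⟩
      rw [Function.comp_apply, he, flip_spherePoint]
      congr 1 <;> ring
  have hlow : ∀ s ∈ Set.Icc (F.cross i - p) (F.cross i - p + 1), ∀ y ∈ Set.Ioo (0 : ℝ) 1,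
      F.Off s y → ((Finset.range p).filter fun n : ℕ => F.rSq (s + n) < y).card
        = u * F.depth s y + (F.depth s y - i) := fun s hs y _ _ =>
    F.card_gt_eq hp hij h0 hi hs
  refine capContributesOne_of_isCapDisc (s := F.cross i) (t := F.cross i - p) hA d.isCapDisc.flip
    (Or.inr flip_northPole) (ReebChord.label_eq hA).2.1 hfill hbd ?_ ?_ ?_ ?_
  · obtain ⟨b, hb⟩ := F.exists_sinkParam_eq i
    refine ⟨-b, ?_⟩
    rw [ht, hb]
    push_cast
    ring
  · refine ⟨-(u + 1), ?_⟩
    have := hpi 0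
    rwa [add_zero, add_zero, ← hs] at this
  · rw [F.discDefect_eq (M := fun k => u * k + (k - i)) (s₀ := F.cross i - p) (a := p) (b := -1)
      hp0 hk h0 hi hs ht ?_ ?_ ?_, hl, sub_add_cancel]
    · have e1 := F.param (F.cross i)
      have e2 := F.param (F.cross i - p)
      have e3 : F.X (F.cross i) - F.X (F.cross i - p)
        = p + -1 * (F.Y (F.cross i - p) - F.Y (F.cross i)) := by linarith
      rw [e3]
      ring
    · intro k hk'
      refine F.multiplicity_levels (s₀ := F.cross i - p) (M := fun k => u * k + (k - i)) hN
        (fun s hs y hy ho => ?_) hk'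
      rw [← hlow s hs y hy ho]
      -- The reflected azimuth `-s` is shifted by whole turns into the first turn of the cap.
      have hpt : spherePoint (-s - (p - 1)) (1 - y) = spherePoint (-s) (1 - y) := by
        have := spherePoint_add_int (-s) (1 - y) (-(p - 1))
        push_cast at this
        rw [← this]
        congr 1
      have hset : {z ∈ disc | (flip ∘ d.cap) z = spherePoint s y}
          = {z ∈ disc | d.cap z = spherePoint (-s - (p - 1)) (1 - y)} := by
        ext z
        simp only [Set.mem_ofPred_eq, Function.comp_apply]
        rw [hpt, ← flip_spherePoint, flip.injective.eq_iff' (flip_flip _)]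
      have hgn : ∀ n < p, g (-s - (p - 1) + n) = 1 - F.rSq (s + (p - 1 - n : ℕ)) := by
        intro n hn
        rw [hg, Nat.sub_sub, Nat.cast_sub (by omega)]
        simp only
        congr 2
        push_cast
        ring
      rw [hset, d.ncard_cap_preimage ⟨by linarith [hs.2], by linarith [hs.1]⟩
        ⟨by linarith [hy.2], by linarith [hy.1]⟩]
      · rw [Finset.card_filter, Finset.card_filter, ← Finset.sum_range_reflect]
        refine Finset.sum_congr rfl fun n hn => ?_
        rw [Finset.mem_range] at hn
        rw [hgn _ (by omega), show p - 1 - (p - 1 - n) = n by omega]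
        simp only [sub_lt_sub_iff_left]
      · intro n hn he
        rw [hgn n hn] at he
        exact ho.ne_nat hN (p - 1 - n) (by linarith)
    · exact fun k hk0 _ => secondDiff_south k hk0
    · intro s hs y hy ho
      rw [← hlow s hs y hy ho]
      have h1 : (Finset.range p).filter (fun n : ℕ => y < F.rSq (s + n))
          = (Finset.range p).filter fun n : ℕ => ¬ F.rSq (s + n) < y :=
        Finset.filter_congr fun n _ => ⟨fun h1 => h1.not_gt,
          fun h1 => lt_of_le_of_ne (not_lt.1 h1) (ho.ne_nat hN n)⟩
      have h2 := Finset.card_filter_add_card_filter_not (s := Finset.range p)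
        (fun n : ℕ => F.rSq (s + n) < y)
      rw [← h1, Finset.card_range] at h2
      have h3 : (((Finset.range p).filter fun n : ℕ => F.rSq (s + n) < y).card : ℝ)
          + ((Finset.range p).filter fun n : ℕ => y < F.rSq (s + n)).card = p := by
        exact_mod_cast h2
      linarith
  · intro z hz he
    rw [Function.comp_apply, d.cap_eq_spherePoint, flip_spherePoint, ← spherePoint_zero 0] at he
    linarith [d.G_lt_one (z := z) (by simpa [disc] using hz), spherePoint_height he]

end SpecialFront

/-- From `h + v q = (h + v) + v (q - 1)`: if `h + v` divides `p`, it divides `v (q - 1)`, and it is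
prime to `q - 1`, hence it divides `v`. -/
theorem not_dvd_of_dvd_add_mul {p q h v : ℕ} (hk : Int.gcd ((q : ℤ) - 1) p = 1) (hh : 0 < h)
    (hv : 0 < v) (hgrid : p ∣ h + v * q) : ¬ h + v ∣ p := by
  intro hd
  have h1 : ((h + v : ℕ) : ℤ) ∣ ((h + v * q : ℕ) : ℤ) := by exact_mod_cast hd.trans hgrid
  have h2 : ((h + v : ℕ) : ℤ) ∣ v * ((q : ℤ) - 1) := by
    have e : (v : ℤ) * ((q : ℤ) - 1) = ((h + v * q : ℕ) : ℤ) - ((h + v : ℕ) : ℤ) := by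
      push_cast
      ring
    rw [e]
    exact dvd_sub h1 dvd_rfl
  have h3 : IsCoprime ((h + v : ℕ) : ℤ) ((q : ℤ) - 1) :=
    (Int.isCoprime_iff_gcd_eq_one.2 hk).symm.of_isCoprime_of_dvd_left (by exact_mod_cast hd)
  have h4 : h + v ∣ v := by exact_mod_cast h3.dvd_of_dvd_mul_right h2
  have := Nat.le_of_dvd hv h4
  omega

end LensKnot
end

theorem proposition4p4 (p q h v : ℕ)
    (hqp : Nat.Coprime q p) (hk : Int.gcd ((q : ℤ) - 1) p = 1)
    (hh : 0 < h) (hv : 0 < v) (hhv : h + v < p) (hgrid : p ∣ h + v * q)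
    (hprim : Nat.Coprime h p)
    (F : LensKnot.SpecialFront p q h v) (j : ℕ) (hj : j = p % (h + v)) :
    (∃! a : F.ReebChord, a.IsA j) ∧
    (∀ a : F.ReebChord, a.IsA j →
      LensKnot.SpecialFront.CapContributesOne a LensKnot.southPole) ∧
    (∃! a : F.ReebChord, a.IsA (h + v - j)) ∧
    (∀ a : F.ReebChord, a.IsA (h + v - j) →
      LensKnot.SpecialFront.CapContributesOne a LensKnot.northPole) := by
  have hp : 0 < p := by omega
  have hp' : (0 : ℝ) < p := by exact_mod_cast hp
  obtain ⟨u, hu⟩ : ∃ u, p = u * (h + v) + j := ⟨p / (h + v), by rw [hj, Nat.div_add_mod']⟩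
  have hu' : (p : ℝ) = u * (h + v) + j := by exact_mod_cast hu
  have hjN : j < h + v := by rw [hj]; exact Nat.mod_lt _ (by omega)
  have hj0 : 0 < j := Nat.pos_of_ne_zero fun h0 =>
    LensKnot.not_dvd_of_dvd_add_mul hk hh hv hgrid (Nat.dvd_of_mod_eq_zero (hj.symm.trans h0))
  -- Over a parameter interval of length `p`, both `X` and `-Y` increase by less than `p`.
  have hinc : ∀ s, 0 < F.Y s - F.Y (s + p) ∧ F.Y s - F.Y (s + p) < p ∧
      F.X (s + p) - F.X s = p - (F.Y s - F.Y (s + p)) := by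
    intro s
    have h1 := F.strictAnti_Y (by linarith : s < s + p)
    have h2 := F.strictMono_X (by linarith : s < s + p)
    have h3 := F.param s
    have h4 := F.param (s + p)
    refine ⟨by linarith, by linarith, by linarith⟩
  -- The flow for the time `l` takes the end of the northern arc to its initial point.
  set l : ℝ := (F.Y (F.cross j) - F.Y (F.cross j + p)) / p with hl
  obtain ⟨hl1, hl2, hl3⟩ := hinc (F.cross j)
  have hpl : p * l = F.Y (F.cross j) - F.Y (F.cross j + p) := mul_div_cancel₀ _ hp'.ne'
  have hs : F.cross j + j + ((u : ℤ) : ℝ) * (h + v : ℕ) = F.cross j + p := by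
    push_cast
    linear_combination -hu'
  obtain ⟨hex, hlen⟩ := F.existsUnique_isA hp hk hgrid hj0 hjN (l := l)
    ⟨div_pos hl1 hp', (div_lt_one hp').2 hl2⟩ u 1 0
    (by rw [hs, hpl]; push_cast; linarith) (by rw [hs, hpl]; push_cast; linarith)
  set i : ℕ := h + v - j with hi
  have hij : i + j = h + v := by omega
  have hij' : (i : ℝ) + j = h + v := by exact_mod_cast hij
  -- The flow for the time `m` takes the end of the southern arc to its initial point.
  set m : ℝ := (F.X (F.cross i) - F.X (F.cross i - p)) / p with hm
  have hm' := hinc (F.cross i - p)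
  rw [sub_add_cancel] at hm'
  obtain ⟨hm1, hm2, hm3⟩ := hm'
  have hpm : p * m = F.X (F.cross i) - F.X (F.cross i - p) := mul_div_cancel₀ _ hp'.ne'
  have ht : F.cross i + i + ((-(u + 1) : ℤ) : ℝ) * (h + v : ℕ) = F.cross i - p := by
    push_cast
    linear_combination hu' + hij'
  obtain ⟨hex', hlen'⟩ := F.existsUnique_isA hp hk hgrid (i := i) (by omega) (by omega) (l := m)
    ⟨div_pos (by linarith) hp', (div_lt_one hp').2 (by linarith)⟩ (-(u + 1)) 0 1
    (by rw [ht, hpm]; push_cast; linarith) (by rw [ht, hpm]; push_cast; linarith)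
  refine ⟨hex, fun x hx => ?_, hex', fun x hx => ?_⟩
  · obtain ⟨h1, h2⟩ := (LensKnot.SpecialFront.ReebChord.isA_iff hp hk hj0 hjN).1 hx
    exact F.capContributesOne_southPole hu hp hk hj0 hjN h1 h2 (hlen x hx)
  · obtain ⟨h1, h2⟩ := (LensKnot.SpecialFront.ReebChord.isA_iff hp hk (by omega) (by omega)).1 hx
    exact F.capContributesOne_northPole hu hij hp hk (by omega) (by omega) h1 h2 (hlen' x hx)
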